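/- **Model.** For odd $n\ge 3$ one observes $y_j=S(x_j)+\sigma_j(S)\,\xi_j$, $x_j=j/n$, $1\le j\le n$. For $k\ge 1$ and $r>0$ let $W^k_r$ be the set of $1$-periodic, $k$ times differentiable functions $S:\mathbb R\to\mathbb R$ with $\sum_{j=0}^k\|S^{(j)}\|^2\le r$, where $\|f\|^2=\int_0^1 f^2(t)\,dt$ (all these norms finite). Let $\mathcal P_n$ be the set of laws $p$ on $\mathbb R^n$ of vectors $(\xi_1,\dots,\xi_n)$ with independent components, $\mathbf E\xi_j=0$, $\mathbf E\xi_j^2=1$, $\max_j\mathbf E\xi_j^4\le l^*_n$, where $l_n^*\ge 3$ is slowly increasing; a sequence $a_n$ is called slowly increasing if $a_n\to\infty$ and $a_n/n^\nu\to0$ for every $\nu>0$. **Estimator.** Let $\phi_1=1$ and, for $j\ge2$, $\phi_j(x)=\sqrt2\cos(2\pi[j/2]x)$ if $j$ is even, $\phi_j(x)=\sqrt2\sin(2\pi[j/2]x)$ if $j$ is odd. Put $\widehat\theta_{j,n}=\frac1n\sum_{l=1}^n y_l\phi_j(x_l)$ and, for a weight vector $\lambda=(\lambda(1),\dots,\lambda(n))$,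 $\widehat S_\lambda=\sum_{j=1}^n\lambda(j)\widehat\theta_{j,n}\phi_j$. Let $k^*_n\ge1$, $0<\varepsilon_n\le1$, $L_n\ge0$ satisfy $k^*_n\to\infty$, $k_n^*/\ln n\to0$, $\varepsilon_n\to0$, $n^\nu\varepsilon_n\to\infty$ for every $\nu>0$, and $L_n$ slowly increasing; let $\bar\omega\ge0$ be a constant. For $\alpha=(\beta,t)$ with an integer $1\le\beta\le k^*_n$ and $t\in\{i\varepsilon_n:1\le i\le[1/\varepsilon_n^2]\}$ put $$\omega(\alpha)=\bar\omega+(A_\beta t\,n)^{1/(2\beta+1)},\quad A_\beta=\frac{(\beta+1)(2\beta+1)}{\beta\pi^{2\beta}},\quad j_0=[\omega(\alpha)\varepsilon_n],$$ $$\lambda_\alpha(j)=\mathbf 1_{\{1\le j\le j_0\}}+\bigl(1-(j/\omega(\alpha))^\beta\bigr)\mathbf 1_{\{j_0<j\le\omega(\alpha)\}},$$ and let $\Lambda$ be the finite set of these $\lambda_\alpha$. Let $\widehat\varsigma_n=\sum_{j=l_n+1}^n\widehat\theta_{j,n}^2$ with $l_n=[n^{1/3}+1]$, $\rho=1/(3+L_n)$,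 and $$J_n(\lambda)=\sum_{j=1}^n\lambda^2(j)\widehat\theta_{j,n}^2-2\sum_{j=1}^n\lambda(j)\Bigl(\widehat\theta^2_{j,n}-\frac{\widehat\varsigma_n}{n}\Bigr)+\rho\,\frac{\widehat\varsigma_n}{n}\sum_{j=1}^n\lambda^2(j).$$ Let $\widehat\lambda$ be any measurable choice of a minimiser of $J_n$ over $\Lambda$, and $\widehat S_*=\widehat S_{\widehat\lambda}$. The estimator does not involve $k$, $r$ or $\sigma_j(S)$. **Condition $\mathbf H_1$** (for the given $k\ge1$, $r>0$). $\sigma_j(S)=g(x_j,S)$ for a function $g\ge0$ of $x\in[0,1]$ and $S$ such that $g(\cdot,S)$ is square integrable on $[0,1]$ for $S\in W^k_r$; with $\varsigma(S)=\int_0^1g^2(x,S)\,dx$, $$\lim_{n\to\infty}\sup_{S\in W^k_r}\Bigl|\frac1n\sum_{j=1}^ng^2(x_j,S)-\varsigma(S)\Bigr|=0,$$ $$\inf_{0\le x\le1}\inf_{S\in W^k_r}g^2(x,S)>0,\qquad\sup_{S\in W^k_r}\varsigma(S)<\infty,\qquad \sup_{0\le x\le1}\sup_{S\in W^k_r}g^2(x,S)<\infty.$$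 **Risks.** With $\|f\|_n^2=\frac1n\sum_{j=1}^nf^2(x_j)$, put $$\mathcal R_n(\widehat S,S)=\sup_{p\in\mathcal P_n}\mathbf E_{S,p}\|\widehat S-S\|_n^2,\qquad \mathcal T_n(\widehat S,S)=\sup_{p\in\mathcal P_n}\mathbf E_{S,p}\|\widehat S-S\|^2,$$ and $$\gamma_k(S)=\Gamma^*_k\,r^{\frac1{2k+1}}\varsigma(S)^{\frac{2k}{2k+1}},\qquad \Gamma_k^*=(2k+1)^{\frac1{2k+1}}\Bigl(\frac{k}{\pi(k+1)}\Bigr)^{\frac{2k}{2k+1}}.$$ **Theorem.** For every $k\ge1$, $r>0$ and every $g$ satisfying $\mathbf H_1$, as $n\to\infty$ through the odd integers, $$\limsup_{n\to\infty}n^{\frac{2k}{2k+1}}\sup_{S\in W^k_r}\frac{\mathcal R_n(\widehat S_*,S)}{\gamma_k(S)}\le1,\qquad \limsup_{n\to\infty}n^{\frac{2k}{2k+1}}\sup_{S\in W^k_r}\frac{\mathcal T_n(\widehat S_*,S)}{\gamma_k(S)}\le1 .$$ The second inequality holds both for $\widehat S_*$ itself, as a function on $[0,1]$, and for the step function that equals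 $\widehat S_*(x_1)$ on $[0,x_1]$ and $\widehat S_*(x_j)$ on $(x_{j-1},x_j]$, $2\le j\le n$. -/

import Mathlib

open MeasureTheory ProbabilityTheory Filter Topology
open scoped ENNReal

noncomputable section

namespace HeteroReg

/-- The sample size `n` tends to infinity through the odd integers. -/
def oddAtTop : Filter ℕ := atTop ⊓ 𝓟 {n | Odd n}

/-- The design points `x_l = l / n`, `1 ≤ l ≤ n`, indexed by `Fin n` (so `l` stands for `l + 1`). -/
def designPoint (n : ℕ) (l : Fin n) : ℝ := ((l : ℕ) + 1 : ℝ) / n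

/-- The trigonometric basis `φ_j`, `j ≥ 1` (the value at `j = 0` is never used);
`j / 2` is the integer part. -/
def trigBasis (j : ℕ) (x : ℝ) : ℝ :=
  if j = 1 then 1
  else if Even j then √2 * Real.cos (2 * Real.pi * ((j / 2 : ℕ) : ℝ) * x)
  else √2 * Real.sin (2 * Real.pi * ((j / 2 : ℕ) : ℝ) * x)

/-- The empirical inner product of two vectors of `ℝⁿ`. -/
def empInner (n : ℕ) (u v : Fin n → ℝ) : ℝ := (1 / (n : ℝ)) * ∑ l, u l * v l

/-- The empirical Fourier coefficients of the observations `y`. -/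
def thetaHat (n : ℕ) (y : Fin n → ℝ) (j : ℕ) : ℝ :=
  empInner n y (fun l => trigBasis j (designPoint n l))

/-- A sequence that increases to infinity more slowly than any power of `n`. -/
def IsSlowlyIncreasing (a : ℕ → ℝ) : Prop :=
  Tendsto a oddAtTop atTop ∧
    ∀ ν : ℝ, 0 < ν → Tendsto (fun n : ℕ => a n / (n : ℝ) ^ ν) oddAtTop (𝓝 0)

/-- The tuning parameters `k*_n`, `ε_n`, `L_n` and the constant in `ω(α)`. -/
structure Tuning where
  kstar : ℕ → ℝ
  eps : ℕ → ℝ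
  L : ℕ → ℝ
  omegaBar : ℝ

structure Tuning.Admissible (P : Tuning) : Prop where
  one_le_kstar : ∀ n, 3 ≤ n → Odd n → 1 ≤ P.kstar n
  eps_pos : ∀ n, 3 ≤ n → Odd n → 0 < P.eps n
  eps_le_one : ∀ n, 3 ≤ n → Odd n → P.eps n ≤ 1
  tendsto_kstar : Tendsto P.kstar oddAtTop atTop
  tendsto_kstar_div_log :
    Tendsto (fun n : ℕ => P.kstar n / Real.log n) oddAtTop (𝓝 0)
  tendsto_eps : Tendsto P.eps oddAtTop (𝓝 0)
  tendsto_pow_mul_eps : ∀ ν : ℝ, 0 < ν →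
    Tendsto (fun n : ℕ => (n : ℝ) ^ ν * P.eps n) oddAtTop atTop
  L_nonneg : ∀ n, 3 ≤ n → Odd n → 0 ≤ P.L n
  L_slow : IsSlowlyIncreasing P.L
  omegaBar_nonneg : 0 ≤ P.omegaBar

/-- The index set: `(β, i)` stands for the pair `(β, t_i)` with `t_i = i ε_n`,
`1 ≤ β ≤ k*_n` and `1 ≤ i ≤ [1 / ε_n²]`. -/
def indexSet (P : Tuning) (n : ℕ) : Set (ℕ × ℕ) :=
  {α | 1 ≤ α.1 ∧ (α.1 : ℝ) ≤ P.kstar n ∧ 1 ≤ α.2 ∧ α.2 ≤ ⌊1 / P.eps n ^ 2⌋₊}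

def coefA (β : ℕ) : ℝ :=
  (((β : ℝ) + 1) * (2 * β + 1)) / (β * Real.pi ^ (2 * β))

def omega (P : Tuning) (n : ℕ) (α : ℕ × ℕ) : ℝ :=
  P.omegaBar + (coefA α.1 * (α.2 * P.eps n)) ^ (1 / (2 * (α.1 : ℝ) + 1))
    * (n : ℝ) ^ (1 / (2 * (α.1 : ℝ) + 1))

/-- The weights `λ_α(j)`, `1 ≤ j ≤ n`. -/
def weight (P : Tuning) (n : ℕ) (α : ℕ × ℕ) (j : ℕ) : ℝ :=
  if j ≤ ⌊omega P n α * P.eps n⌋₊ then 1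
  else if (j : ℝ) ≤ omega P n α then 1 - ((j : ℝ) / omega P n α) ^ α.1
  else 0

/-- The weighted least squares estimator with weights `lam(1), …, lam(n)`. -/
def wlsEstimator (n : ℕ) (lam : ℕ → ℝ) (y : Fin n → ℝ) (x : ℝ) : ℝ :=
  ∑ j ∈ Finset.Icc 1 n, lam j * thetaHat n y j * trigBasis j x

/-- The estimator of the integrated variance, with `l_n = [n^{1/3} + 1]`. -/
def varHat (n : ℕ) (y : Fin n → ℝ) : ℝ :=
  ∑ j ∈ Finset.Icc (⌊(n : ℝ) ^ (1 / 3 : ℝ) + 1⌋₊ + 1) n, thetaHat n y j ^ 2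

def thetaTilde (n : ℕ) (y : Fin n → ℝ) (j : ℕ) : ℝ :=
  thetaHat n y j ^ 2 - (1 / (n : ℝ)) * varHat n y

def penalty (n : ℕ) (lam : ℕ → ℝ) (y : Fin n → ℝ) : ℝ :=
  (∑ j ∈ Finset.Icc 1 n, lam j ^ 2) * varHat n y / n

/-- The penalised cost function `J_n(λ)`. -/
def cost (P : Tuning) (n : ℕ) (lam : ℕ → ℝ) (y : Fin n → ℝ) : ℝ :=
  ∑ j ∈ Finset.Icc 1 n, lam j ^ 2 * thetaHat n y j ^ 2
    - 2 * ∑ j ∈ Finset.Icc 1 n, lam j * thetaTilde n y j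
    + 1 / (3 + P.L n) * penalty n lam y

/-- `sel` is a measurable choice of a minimiser of the cost function over the weight family. -/
structure IsCostMinimiser (P : Tuning) (n : ℕ) (sel : (Fin n → ℝ) → ℕ × ℕ) : Prop where
  measurable : Measurable sel
  mem : ∀ y, sel y ∈ indexSet P n
  le : ∀ y, ∀ α ∈ indexSet P n, cost P n (weight P n (sel y)) y ≤ cost P n (weight P n α) y

/-- The model selection estimator given by the choice `sel` of a minimiser. -/
def selectedEstimator (P : Tuning) (n : ℕ) (sel : (Fin n → ℝ) → ℕ × ℕ)
    (y : Fin n → ℝ) : ℝ → ℝ :=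
  wlsEstimator n (weight P n (sel y)) y

/-- The class `W^k_r` of `1`-periodic, `k` times differentiable functions with
`∑_{j ≤ k} ‖f^{(j)}‖² ≤ r`, norms in `L²[0,1]`. -/
def sobolevClass (k : ℕ) (r : ℝ) : Set (ℝ → ℝ) :=
  {f | Function.Periodic f 1 ∧
    (∀ j < k, Differentiable ℝ (iteratedDeriv j f)) ∧
    (∀ j ≤ k, IntervalIntegrable (fun t => iteratedDeriv j f t ^ 2) volume 0 1) ∧
    ∑ j ∈ Finset.range (k + 1), ∫ t in (0 : ℝ)..1, iteratedDeriv j f t ^ 2 ≤ r}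

/-- `ς(S)`. -/
def intVar (g : ℝ → (ℝ → ℝ) → ℝ) (S : ℝ → ℝ) : ℝ := ∫ x in (0 : ℝ)..1, g x S ^ 2

/-- The conditions on the scale functional `g`, where `σ_j(S) = g(x_j, S)`. -/
structure ScaleCondition (k : ℕ) (r : ℝ) (g : ℝ → (ℝ → ℝ) → ℝ) : Prop where
  nonneg : ∀ x ∈ Set.Icc (0 : ℝ) 1, ∀ S ∈ sobolevClass k r, 0 ≤ g x S
  square_integrable : ∀ S ∈ sobolevClass k r,
    MemLp (fun x => g x S) 2 (volume.restrict (Set.Icc (0 : ℝ) 1))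
  riemann_sums : TendstoUniformlyOn
    (fun (n : ℕ) (S : ℝ → ℝ) => (1 / (n : ℝ)) * ∑ l : Fin n, g (designPoint n l) S ^ 2)
    (intVar g) oddAtTop (sobolevClass k r)
  bounded_below : ∃ c > 0, ∀ x ∈ Set.Icc (0 : ℝ) 1, ∀ S ∈ sobolevClass k r, c ≤ g x S ^ 2
  intVar_bounded : ∃ C, ∀ S ∈ sobolevClass k r, intVar g S ≤ C
  bounded_above : ∃ C, ∀ x ∈ Set.Icc (0 : ℝ) 1, ∀ S ∈ sobolevClass k r, g x S ^ 2 ≤ C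

/-- The family of noise distributions on `ℝⁿ`: independent centred coordinates with unit
variance and fourth moments at most `c`. -/
structure IsNoiseLaw (n : ℕ) (c : ℝ) (p : Measure (Fin n → ℝ)) : Prop where
  isProb : IsProbabilityMeasure p
  indep : iIndepFun (fun (l : Fin n) (ξ : Fin n → ℝ) => ξ l) p
  memLp : ∀ l : Fin n, MemLp (fun ξ : Fin n → ℝ => ξ l) 4 p
  centred : ∀ l : Fin n, ∫ ξ, ξ l ∂p = 0
  unit_variance : ∀ l : Fin n, ∫ ξ, ξ l ^ 2 ∂p = 1
  fourth_moment : ∀ l : Fin n, ∫ ξ, ξ l ^ 4 ∂p ≤ c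

/-- The observations `y_l = S(x_l) + σ_l(S) ξ_l`. -/
def observation (n : ℕ) (g : ℝ → (ℝ → ℝ) → ℝ) (S : ℝ → ℝ) (ξ : Fin n → ℝ) : Fin n → ℝ :=
  fun l => S (designPoint n l) + g (designPoint n l) S * ξ l

/-- The squared empirical norm of a function. -/
def empNormSq (n : ℕ) (f : ℝ → ℝ) : ℝ :=
  empInner n (fun l => f (designPoint n l)) (fun l => f (designPoint n l))

/-- The squared norm of a function in `L²[0,1]`. -/
def normSq (f : ℝ → ℝ) : ℝ := ∫ t in (0 : ℝ)..1, f t ^ 2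

/-- The worst mean, over the noise laws with fourth moments at most `c`, of the loss `loss`
evaluated at the error of the estimator `est`. -/
def robustRisk (n : ℕ) (c : ℝ) (g : ℝ → (ℝ → ℝ) → ℝ) (loss : (ℝ → ℝ) → ℝ)
    (est : (Fin n → ℝ) → ℝ → ℝ) (S : ℝ → ℝ) : ℝ≥0∞ :=
  ⨆ (p : Measure (Fin n → ℝ)) (_ : IsNoiseLaw n c p),
    ∫⁻ ξ, ENNReal.ofReal (loss (fun x => est (observation n g S ξ) x - S x)) ∂p

/-- The risk for the empirical norm. -/
def empRisk (n : ℕ) (c : ℝ) (g : ℝ → (ℝ → ℝ) → ℝ)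
    (est : (Fin n → ℝ) → ℝ → ℝ) (S : ℝ → ℝ) : ℝ≥0∞ :=
  robustRisk n c g (empNormSq n) est S

/-- The risk for the norm of `L²[0,1]`. -/
def intRisk (n : ℕ) (c : ℝ) (g : ℝ → (ℝ → ℝ) → ℝ)
    (est : (Fin n → ℝ) → ℝ → ℝ) (S : ℝ → ℝ) : ℝ≥0∞ :=
  robustRisk n c g normSq est S

/-- The extension of the values of `f` at the design points to a step function on `[0,1]`. -/
def stepExtension (n : ℕ) (f : ℝ → ℝ) (x : ℝ) : ℝ :=
  (Set.Icc (0 : ℝ) (1 / n)).indicator (fun _ => f (1 / n)) x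
    + ∑ i ∈ Finset.Icc 2 n,
        (Set.Ioc (((i : ℝ) - 1) / n) ((i : ℝ) / n)).indicator (fun _ => f ((i : ℝ) / n)) x

/-- `Γ*_k`. -/
def pinskerConst (k : ℕ) : ℝ :=
  (2 * (k : ℝ) + 1) ^ (1 / (2 * (k : ℝ) + 1)) *
    ((k : ℝ) / (Real.pi * (k + 1))) ^ (2 * (k : ℝ) / (2 * k + 1))

/-- `γ_k(S)`. -/
def gammaK (k : ℕ) (r : ℝ) (g : ℝ → (ℝ → ℝ) → ℝ) (S : ℝ → ℝ) : ℝ :=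
  pinskerConst k * r ^ (1 / (2 * (k : ℝ) + 1)) * intVar g S ^ (2 * (k : ℝ) / (2 * k + 1))

/-- `n^{2k/(2k+1)} sup_{S ∈ W^k_r} R(n, S) / γ_k(S)` for a risk `R`. -/
def normalisedRisk (k : ℕ) (r : ℝ) (g : ℝ → (ℝ → ℝ) → ℝ)
    (R : ℕ → (ℝ → ℝ) → ℝ≥0∞) (n : ℕ) : ℝ≥0∞ :=
  ENNReal.ofReal ((n : ℝ) ^ (2 * (k : ℝ) / (2 * k + 1))) *
    ⨆ S ∈ sobolevClass k r, R n S / ENNReal.ofReal (gammaK k r g S)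

end HeteroReg

end

namespace HeteroReg

/-! ### The trigonometric basis on the design points -/

/-! For odd `n` the functions φ_1, …, φ_n are orthonormal for the empirical inner product
(`sum_trigBasis_mul_trigBasis`). In these coordinates the data are θ̂_j = θ_j + η_j, and the
empirical loss of weights λ is Σ (λ(j) θ̂_j − θ_j)². The theorem then follows from an oracle
inequality for the selected weights, a sharp risk bound for one member of the family, and a
comparison of norms.

Oracle inequality. Up to a term free of λ and the penalty, the cost differs from the loss by
statistics linear in λ: the cross term Σ λθη, the centred squares Σ λ(η² − v) with v the variance of
η, the deviation of the variances v from their mean, and the error of the variance estimator. When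
the minimiser is compared with a fixed λ₀, each of the first two statistics T satisfies T² ≤ Uq,
where q is a quadratic form in λ − λ₀ and one random variable U serves the whole family, at the
price of the cardinality of the family in its mean (`exists_uniform_sq_bound`). Only second moments
of linear and quadratic forms of the noise enter, so fourth moments suffice and the bounds are
uniform over the noise laws (`IsNoiseLaw.quadForm_moments`). In 2|T| ≤ δq + U/δ the term δq is
absorbed by the loss and by the penalty (`coordLoss_oracle`). Unequal variances cost only O(1/n),
because the weights decrease and cos² + sin² = 1 (`IsWeight.abs_sum_noiseVar_sub_le`). Up to
subpolynomial factors, the weights live on n^{1/3} frequencies and the variance estimator errs by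
n^{-1/3}, so the remainder is a subpolynomial factor over n (`oracleRem_le`), negligible against
n^{-2k/(2k+1)}.

Sharp bound. The k-th difference with step 1/n multiplies the amplitude of the empirical
coefficients at frequency m by (2 sin(πm/n))^k, and its empirical norm is at most n^{-k} ‖S^{(k)}‖,
with no loss in the constant. Hence the empirical coefficients themselves lie in a Sobolev ellipsoid
(`sum_sobolev_thetaHat_sq_le`) whose axes 2n sin(π[j/2]/n) are close to πj at the frequencies that
matter; they need not be compared with the continuous Fourier coefficients. The weights with β = k
and t close to r/ς(S) balance bias and variance and give the Pinsker constant (`ideal_risk_eq`,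
`eventually_oracle_sharp`).

Comparison of norms. The squared norm of L²[0,1] exceeds (1 + δ) times the empirical one by at most
(1 + 1/δ) n^{-2} times the energy of a derivative (`normSq_le_empNormSq`). For the estimator this
energy is at most of order n up to subpolynomial factors, so the excess is again negligible. -/

lemma trigBasis_one (x : ℝ) : trigBasis 1 x = 1 := by simp [trigBasis]

lemma trigBasis_even {m : ℕ} (x : ℝ) :
    trigBasis (2 * m) x = √2 * Real.cos (2 * Real.pi * m * x) := by
  have h1 : 2 * m ≠ 1 := by omega
  simp [trigBasis, h1]

lemma trigBasis_odd {m : ℕ} (hm : 1 ≤ m) (x : ℝ) :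
    trigBasis (2 * m + 1) x = √2 * Real.sin (2 * Real.pi * m * x) := by
  have h1 : 2 * m + 1 ≠ 1 := by omega
  have h2 : ¬ Even (2 * m + 1) := by simp
  have h3 : (2 * m + 1) / 2 = m := by omega
  have h4 : m ≠ 0 := by omega
  simp [trigBasis, h2, h3, h4]

lemma trigBasis_sq_le (j : ℕ) (x : ℝ) : trigBasis j x ^ 2 ≤ 2 := by
  unfold trigBasis
  split_ifs
  · norm_num
  · rw [mul_pow, Real.sq_sqrt (by norm_num)]
    nlinarith [Real.cos_sq_le_one (2 * Real.pi * ((j / 2 : ℕ) : ℝ) * x)]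
  · rw [mul_pow, Real.sq_sqrt (by norm_num)]
    nlinarith [Real.sin_sq_le_one (2 * Real.pi * ((j / 2 : ℕ) : ℝ) * x)]

/-- With z = exp(2πid/n) the terms are z, z², …, zⁿ: a geometric sum with zⁿ = 1 and z ≠ 1. -/
lemma sum_exp_designPoint {n : ℕ} {d : ℤ} (hd : ¬ (n : ℤ) ∣ d) :
    ∑ l : Fin n, Complex.exp (((2 * Real.pi * d * designPoint n l : ℝ) : ℂ) * Complex.I) = 0 := by
  rcases Nat.eq_zero_or_pos n with rfl | hn
  · simp
  have hn' : (n : ℂ) ≠ 0 := by exact_mod_cast hn.ne'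
  set z : ℂ := Complex.exp (2 * Real.pi * Complex.I * (d / n)) with hz
  have hzn : z ^ n = 1 := by
    rw [hz, ← Complex.exp_nat_mul, Complex.exp_eq_one_iff]
    refine ⟨d, ?_⟩
    field_simp
  have hz1 : z ≠ 1 := by
    intro h
    rw [hz, Complex.exp_eq_one_iff] at h
    obtain ⟨m, hm⟩ := h
    apply hd
    refine ⟨m, ?_⟩
    have h2 : (2 * Real.pi * Complex.I : ℂ) ≠ 0 := Complex.two_pi_I_ne_zero
    have h3 : (d : ℂ) / n = m := by
      apply mul_left_cancel₀ h2
      rw [hm]; ring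
    rw [div_eq_iff hn'] at h3
    have h4 : ((d : ℤ) : ℂ) = ((n * m : ℤ) : ℂ) := by rw [h3]; push_cast; ring
    exact_mod_cast h4
  have hterm : ∀ l : Fin n,
      Complex.exp (((2 * Real.pi * d * designPoint n l : ℝ) : ℂ) * Complex.I)
        = z * z ^ (l : ℕ) := by
    intro l
    rw [← pow_succ', hz, ← Complex.exp_nat_mul]
    congr 1
    unfold designPoint
    push_cast
    field_simp
  rw [Finset.sum_congr rfl fun l _ => hterm l, ← Finset.mul_sum,
    Fin.sum_univ_eq_sum_range (fun l => z ^ l) n, geom_sum_eq hz1, hzn]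
  simp

lemma sum_cos_designPoint {n : ℕ} {d : ℤ} (hd : ¬ (n : ℤ) ∣ d) :
    ∑ l : Fin n, Real.cos (2 * Real.pi * d * designPoint n l) = 0 := by
  have h := congrArg Complex.re (sum_exp_designPoint hd)
  simpa only [Complex.re_sum, Complex.exp_ofReal_mul_I_re, Complex.zero_re] using h

lemma sum_sin_designPoint {n : ℕ} {d : ℤ} (hd : ¬ (n : ℤ) ∣ d) :
    ∑ l : Fin n, Real.sin (2 * Real.pi * d * designPoint n l) = 0 := by
  have h := congrArg Complex.im (sum_exp_designPoint hd)
  simpa only [Complex.im_sum, Complex.exp_ofReal_mul_I_im, Complex.zero_im] using h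

lemma not_dvd_of_abs_lt {n : ℕ} {d : ℤ} (h0 : d ≠ 0) (h1 : |d| < n) : ¬ (n : ℤ) ∣ d := by
  intro h
  exact h0 (Int.eq_zero_of_abs_lt_dvd h h1)

lemma sum_cos_mul_cos {n a b : ℕ} (hab : a + b < n) (hb : 1 ≤ a + b) :
    ∑ l : Fin n, Real.cos (2 * Real.pi * a * designPoint n l)
        * Real.cos (2 * Real.pi * b * designPoint n l) = if a = b then (n : ℝ) / 2 else 0 := by
  have key : ∀ l : Fin n, Real.cos (2 * Real.pi * a * designPoint n l)
        * Real.cos (2 * Real.pi * b * designPoint n l)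
      = (Real.cos (2 * Real.pi * ((a - b : ℤ) : ℝ) * designPoint n l)
        + Real.cos (2 * Real.pi * ((a + b : ℤ) : ℝ) * designPoint n l)) / 2 := by
    intro l
    have e1 : 2 * Real.pi * ((a - b : ℤ) : ℝ) * designPoint n l
      = 2 * Real.pi * a * designPoint n l - 2 * Real.pi * b * designPoint n l := by
      push_cast; ring
    have e2 : 2 * Real.pi * ((a + b : ℤ) : ℝ) * designPoint n l
      = 2 * Real.pi * a * designPoint n l + 2 * Real.pi * b * designPoint n l := by
      push_cast; ring
    rw [e1, e2, Real.cos_sub, Real.cos_add]; ring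
  rw [Finset.sum_congr rfl fun l _ => key l, ← Finset.sum_div, Finset.sum_add_distrib,
    sum_cos_designPoint (d := (a + b : ℤ))
      (not_dvd_of_abs_lt (by omega) (by rw [abs_lt]; omega))]
  split_ifs with h
  · subst h; simp
  · rw [sum_cos_designPoint (d := (a - b : ℤ))
      (not_dvd_of_abs_lt (by omega) (by rw [abs_lt]; omega))]
    simp

lemma sum_sin_mul_sin {n a b : ℕ} (hab : a + b < n) (hb : 1 ≤ a + b) :
    ∑ l : Fin n, Real.sin (2 * Real.pi * a * designPoint n l)
        * Real.sin (2 * Real.pi * b * designPoint n l) = if a = b then (n : ℝ) / 2 else 0 := by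
  have key : ∀ l : Fin n, Real.sin (2 * Real.pi * a * designPoint n l)
        * Real.sin (2 * Real.pi * b * designPoint n l)
      = (Real.cos (2 * Real.pi * ((a - b : ℤ) : ℝ) * designPoint n l)
        - Real.cos (2 * Real.pi * ((a + b : ℤ) : ℝ) * designPoint n l)) / 2 := by
    intro l
    have e1 : 2 * Real.pi * ((a - b : ℤ) : ℝ) * designPoint n l
      = 2 * Real.pi * a * designPoint n l - 2 * Real.pi * b * designPoint n l := by
      push_cast; ring
    have e2 : 2 * Real.pi * ((a + b : ℤ) : ℝ) * designPoint n l
      = 2 * Real.pi * a * designPoint n l + 2 * Real.pi * b * designPoint n l := by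
      push_cast; ring
    rw [e1, e2, Real.cos_sub, Real.cos_add]; ring
  rw [Finset.sum_congr rfl fun l _ => key l, ← Finset.sum_div, Finset.sum_sub_distrib,
    sum_cos_designPoint (d := (a + b : ℤ))
      (not_dvd_of_abs_lt (by omega) (by rw [abs_lt]; omega))]
  split_ifs with h
  · subst h; simp
  · rw [sum_cos_designPoint (d := (a - b : ℤ))
      (not_dvd_of_abs_lt (by omega) (by rw [abs_lt]; omega))]
    simp

lemma sum_sin_designPoint_eq_zero {n : ℕ} {d : ℤ} (hd : |d| < n) :
    ∑ l : Fin n, Real.sin (2 * Real.pi * d * designPoint n l) = 0 := by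
  rcases eq_or_ne d 0 with rfl | h0
  · simp
  · exact sum_sin_designPoint (not_dvd_of_abs_lt h0 hd)

lemma sum_sin_mul_cos {n a b : ℕ} (hab : a + b < n) :
    ∑ l : Fin n, Real.sin (2 * Real.pi * a * designPoint n l)
        * Real.cos (2 * Real.pi * b * designPoint n l) = 0 := by
  have key : ∀ l : Fin n, Real.sin (2 * Real.pi * a * designPoint n l)
        * Real.cos (2 * Real.pi * b * designPoint n l)
      = (Real.sin (2 * Real.pi * ((a - b : ℤ) : ℝ) * designPoint n l)
        + Real.sin (2 * Real.pi * ((a + b : ℤ) : ℝ) * designPoint n l)) / 2 := by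
    intro l
    have e1 : 2 * Real.pi * ((a - b : ℤ) : ℝ) * designPoint n l
      = 2 * Real.pi * a * designPoint n l - 2 * Real.pi * b * designPoint n l := by
      push_cast; ring
    have e2 : 2 * Real.pi * ((a + b : ℤ) : ℝ) * designPoint n l
      = 2 * Real.pi * a * designPoint n l + 2 * Real.pi * b * designPoint n l := by
      push_cast; ring
    rw [e1, e2, Real.sin_sub, Real.sin_add]; ring
  rw [Finset.sum_congr rfl fun l _ => key l, ← Finset.sum_div, Finset.sum_add_distrib,
    sum_sin_designPoint_eq_zero (d := (a + b : ℤ)) (by rw [abs_lt]; omega),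
    sum_sin_designPoint_eq_zero (d := (a - b : ℤ)) (by rw [abs_lt]; omega)]
  simp

lemma eq_one_or_even_or_odd {j : ℕ} (hj : 1 ≤ j) :
    j = 1 ∨ (∃ m, 1 ≤ m ∧ j = 2 * m) ∨ ∃ m, 1 ≤ m ∧ j = 2 * m + 1 := by
  rcases Nat.even_or_odd' j with ⟨m, rfl | rfl⟩
  · exact Or.inr (Or.inl ⟨m, by omega, rfl⟩)
  · rcases Nat.eq_zero_or_pos m with rfl | hm
    · exact Or.inl rfl
    · exact Or.inr (Or.inr ⟨m, hm, rfl⟩)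

/-- For odd `n` the functions `φ_1, …, φ_n` are orthogonal on the design points. -/
lemma sum_trigBasis_mul_trigBasis {n i j : ℕ} (hn : Odd n) (hi : i ∈ Finset.Icc 1 n)
    (hj : j ∈ Finset.Icc 1 n) :
    ∑ l : Fin n, trigBasis i (designPoint n l) * trigBasis j (designPoint n l)
      = if i = j then (n : ℝ) else 0 := by
  -- With n = 2q + 1 every frequency is at most q, so the sum of two of them stays below n and no
  -- aliasing occurs; this is where oddness enters.
  obtain ⟨q, hq⟩ := hn
  have h2 : √2 * √2 = (2 : ℝ) := Real.mul_self_sqrt (by norm_num)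
  rw [Finset.mem_Icc] at hi hj
  have cc : ∀ x y : ℝ, (√2 * x) * (√2 * y) = 2 * (x * y) := fun x y => by
    linear_combination x * y * h2
  have c0 : ∀ m, 1 ≤ m → m < n →
      ∑ l : Fin n, Real.cos (2 * Real.pi * m * designPoint n l) = 0 := fun m h1 h3 => by
    have := sum_cos_designPoint (n := n) (d := (m : ℤ))
      (not_dvd_of_abs_lt (by omega) (by rw [abs_lt]; omega))
    exact_mod_cast this
  have s0 : ∀ m, 1 ≤ m → m < n →
      ∑ l : Fin n, Real.sin (2 * Real.pi * m * designPoint n l) = 0 := fun m h1 h3 => by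
    have := sum_sin_designPoint (n := n) (d := (m : ℤ))
      (not_dvd_of_abs_lt (by omega) (by rw [abs_lt]; omega))
    exact_mod_cast this
  rcases eq_one_or_even_or_odd hi.1 with rfl | ⟨a, ha, rfl⟩ | ⟨a, ha, rfl⟩ <;>
  rcases eq_one_or_even_or_odd hj.1 with rfl | ⟨b, hb, rfl⟩ | ⟨b, hb, rfl⟩
  · simp [trigBasis_one]
  · have : ¬ (1 = 2 * b) := by omega
    simp only [trigBasis_one, trigBasis_even, one_mul, this, if_false]
    rw [← Finset.mul_sum, c0 b hb (by omega), mul_zero]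
  · have : ¬ (1 = 2 * b + 1) := by omega
    simp only [trigBasis_one, trigBasis_odd hb, one_mul, this, if_false]
    rw [← Finset.mul_sum, s0 b hb (by omega), mul_zero]
  · have : ¬ (2 * a = 1) := by omega
    simp only [trigBasis_one, trigBasis_even, mul_one, this, if_false]
    rw [← Finset.mul_sum, c0 a ha (by omega), mul_zero]
  · have : (2 * a = 2 * b) ↔ a = b := by omega
    simp only [trigBasis_even, cc, this]
    rw [← Finset.mul_sum, sum_cos_mul_cos (by omega) (by omega)]
    split_ifs <;> ring
  · have : ¬ (2 * a = 2 * b + 1) := by omega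
    simp only [trigBasis_even, trigBasis_odd hb, cc, this, if_false]
    rw [← Finset.mul_sum]
    simp only [mul_comm (Real.cos _) (Real.sin _)]
    rw [sum_sin_mul_cos (by omega), mul_zero]
  · have : ¬ (2 * a + 1 = 1) := by omega
    simp only [trigBasis_one, trigBasis_odd ha, mul_one, this, if_false]
    rw [← Finset.mul_sum, s0 a ha (by omega), mul_zero]
  · have : ¬ (2 * a + 1 = 2 * b) := by omega
    simp only [trigBasis_even, trigBasis_odd ha, cc, this, if_false]
    rw [← Finset.mul_sum, sum_sin_mul_cos (by omega), mul_zero]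
  · have : (2 * a + 1 = 2 * b + 1) ↔ a = b := by omega
    simp only [trigBasis_odd ha, trigBasis_odd hb, cc, this]
    rw [← Finset.mul_sum, sum_sin_mul_sin (by omega) (by omega)]
    split_ifs <;> ring

lemma sum_Icc_one_eq_sum_fin {M : Type*} [AddCommMonoid M] (n : ℕ) (F : ℕ → M) :
    ∑ j ∈ Finset.Icc 1 n, F j = ∑ j : Fin n, F (j + 1) := by
  rw [Fin.sum_univ_eq_sum_range (fun j => F (j + 1)) n, Finset.range_eq_Ico,
    Finset.sum_Ico_add' F 0 n 1]
  rfl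

/-- The dual orthogonality relation. -/
lemma sum_trigBasis_designPoint_mul {n : ℕ} (hn : Odd n) (a b : Fin n) :
    ∑ j ∈ Finset.Icc 1 n, trigBasis j (designPoint n a) * trigBasis j (designPoint n b)
      = if a = b then (n : ℝ) else 0 := by
  have hn0 : (n : ℝ) ≠ 0 := by
    have := hn.pos
    exact_mod_cast this.ne'
  set A : Matrix (Fin n) (Fin n) ℝ := Matrix.of fun j l => trigBasis (j + 1) (designPoint n l) with hA
  have h1 : A * ((n : ℝ)⁻¹ • A.transpose) = 1 := by
    ext i j
    have h := sum_trigBasis_mul_trigBasis (n := n) (i := i + 1) (j := j + 1) hn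
      (by simp only [Finset.mem_Icc]; omega) (by simp only [Finset.mem_Icc]; omega)
    rw [Matrix.mul_smul, Matrix.smul_apply, Matrix.mul_apply]
    simp only [Matrix.transpose_apply, hA, Matrix.of_apply]
    rw [h]
    by_cases hij : i = j
    · subst hij; simp [hn0]
    · have : ¬ ((i : ℕ) + 1 = j + 1) := fun h => hij (Fin.ext (by omega))
      rw [if_neg this, Matrix.one_apply_ne hij, smul_zero]
  -- A one-sided inverse of a square matrix is two-sided, so orthogonality of the rows gives that of
  -- the columns.
  have h2 : (((n : ℝ)⁻¹ • A.transpose) * A) a b = (1 : Matrix (Fin n) (Fin n) ℝ) a b := by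
    rw [mul_eq_one_comm.mp h1]
  rw [Matrix.smul_mul, Matrix.smul_apply, Matrix.mul_apply, Matrix.one_apply] at h2
  simp only [Matrix.transpose_apply, hA, Matrix.of_apply, smul_eq_mul] at h2
  rw [sum_Icc_one_eq_sum_fin]
  rw [inv_mul_eq_iff_eq_mul₀ hn0] at h2
  rw [h2]; split_ifs <;> simp

lemma thetaHat_eq (n : ℕ) (u : Fin n → ℝ) (j : ℕ) :
    thetaHat n u j = (1 / (n : ℝ)) * ∑ l, u l * trigBasis j (designPoint n l) := rfl

lemma thetaHat_add (n : ℕ) (u v : Fin n → ℝ) (j : ℕ) :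
    thetaHat n (fun l => u l + v l) j = thetaHat n u j + thetaHat n v j := by
  simp only [thetaHat_eq, add_mul, Finset.sum_add_distrib, mul_add]

lemma thetaHat_sub (n : ℕ) (u v : Fin n → ℝ) (j : ℕ) :
    thetaHat n (fun l => u l - v l) j = thetaHat n u j - thetaHat n v j := by
  simp only [thetaHat_eq, sub_mul, Finset.sum_sub_distrib, mul_sub]

/-- Parseval's identity for the empirical inner product. -/
lemma sum_thetaHat_sq {n : ℕ} (hn : Odd n) (u : Fin n → ℝ) :
    ∑ j ∈ Finset.Icc 1 n, thetaHat n u j ^ 2 = (1 / (n : ℝ)) * ∑ l, u l ^ 2 := by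
  have hn0 : (n : ℝ) ≠ 0 := by
    have := hn.pos
    exact_mod_cast this.ne'
  have h : ∀ j, thetaHat n u j ^ 2 = (1 / (n : ℝ)) ^ 2 * ∑ a : Fin n, ∑ b : Fin n,
      u a * u b * (trigBasis j (designPoint n a) * trigBasis j (designPoint n b)) := by
    intro j
    rw [thetaHat_eq, mul_pow, sq (∑ l, _), Finset.sum_mul_sum]
    congr 1
    refine Finset.sum_congr rfl fun a _ => Finset.sum_congr rfl fun b _ => by ring
  rw [Finset.sum_congr rfl fun j _ => h j, ← Finset.mul_sum, Finset.sum_comm]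
  simp_rw [Finset.sum_comm (s := Finset.Icc 1 n), ← Finset.mul_sum,
    sum_trigBasis_designPoint_mul hn]
  simp only [mul_ite, mul_zero, Finset.sum_ite_eq, Finset.mem_univ, if_true]
  rw [← Finset.sum_mul]
  field_simp

/-- The squared empirical norm of a trigonometric polynomial. -/
lemma sum_sq_sum_trigBasis {n : ℕ} (hn : Odd n) (c : ℕ → ℝ) :
    ∑ l : Fin n, (∑ j ∈ Finset.Icc 1 n, c j * trigBasis j (designPoint n l)) ^ 2
      = n * ∑ j ∈ Finset.Icc 1 n, c j ^ 2 := by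
  have h : ∀ l : Fin n, (∑ j ∈ Finset.Icc 1 n, c j * trigBasis j (designPoint n l)) ^ 2
      = ∑ i ∈ Finset.Icc 1 n, ∑ j ∈ Finset.Icc 1 n,
        c i * c j * (trigBasis i (designPoint n l) * trigBasis j (designPoint n l)) := by
    intro l
    rw [sq, Finset.sum_mul_sum]
    refine Finset.sum_congr rfl fun a _ => Finset.sum_congr rfl fun b _ => by ring
  rw [Finset.sum_congr rfl fun l _ => h l, Finset.sum_comm, Finset.mul_sum]
  refine Finset.sum_congr rfl fun i hi => ?_
  rw [Finset.sum_comm]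
  simp_rw [← Finset.mul_sum]
  rw [Finset.sum_congr rfl fun j hj => by rw [sum_trigBasis_mul_trigBasis hn hi hj]]
  simp only [mul_ite, mul_zero, Finset.sum_ite_eq, hi, if_true]
  ring

lemma thetaHat_wlsEstimator {n : ℕ} (hn : Odd n) (lam : ℕ → ℝ) (y : Fin n → ℝ) {j : ℕ}
    (hj : j ∈ Finset.Icc 1 n) :
    thetaHat n (fun l => wlsEstimator n lam y (designPoint n l)) j = lam j * thetaHat n y j := by
  have hn0 : (n : ℝ) ≠ 0 := by
    have := hn.pos
    exact_mod_cast this.ne'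
  rw [thetaHat_eq]
  simp only [wlsEstimator, Finset.sum_mul]
  rw [Finset.sum_comm]
  simp_rw [mul_assoc _ (trigBasis _ _) (trigBasis _ _), ← Finset.mul_sum]
  rw [Finset.sum_congr rfl fun i hi => by rw [sum_trigBasis_mul_trigBasis hn hi hj]]
  simp only [mul_ite, mul_zero, Finset.sum_ite_eq', hj, if_true]
  field_simp

/-- The empirical loss of a weighted least squares estimator in Fourier coordinates. -/
lemma empNormSq_wlsEstimator_sub {n : ℕ} (hn : Odd n) (lam : ℕ → ℝ) (y : Fin n → ℝ)
    (S : ℝ → ℝ) :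
    empNormSq n (fun x => wlsEstimator n lam y x - S x)
      = ∑ j ∈ Finset.Icc 1 n,
        (lam j * thetaHat n y j - thetaHat n (fun l => S (designPoint n l)) j) ^ 2 := by
  have h := sum_thetaHat_sq hn
    (fun l => wlsEstimator n lam y (designPoint n l) - S (designPoint n l))
  have h2 : empNormSq n (fun x => wlsEstimator n lam y x - S x) = (1 / (n : ℝ)) * ∑ l : Fin n,
      (wlsEstimator n lam y (designPoint n l) - S (designPoint n l)) ^ 2 := by
    simp only [empNormSq, empInner, sq]
  rw [h2, ← h]
  refine Finset.sum_congr rfl fun j hj => ?_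
  rw [thetaHat_sub, thetaHat_wlsEstimator hn lam y hj]

/-! ### Discrete Sobolev inequalities -/

lemma intervalIntegrable_of_sq {g : ℝ → ℝ} {a b : ℝ} (hm : Measurable g)
    (h : IntervalIntegrable (fun t => g t ^ 2) volume a b) : IntervalIntegrable g volume a b := by
  have h1 : IntervalIntegrable (fun t => 1 + g t ^ 2) volume a b :=
    (intervalIntegrable_const (c := (1 : ℝ))).add h
  refine h1.mono_fun hm.aestronglyMeasurable (Eventually.of_forall fun t => ?_)
  simp only [Real.norm_eq_abs]
  rw [abs_of_nonneg (by positivity : 0 ≤ 1 + g t ^ 2)]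
  nlinarith [sq_abs (g t), sq_nonneg (|g t| - 1), abs_nonneg (g t)]

lemma sq_integral_le {g : ℝ → ℝ} {a b : ℝ} (hab : a ≤ b) (hg : IntervalIntegrable g volume a b)
    (hg2 : IntervalIntegrable (fun t => g t ^ 2) volume a b) :
    (∫ t in a..b, g t) ^ 2 ≤ (b - a) * ∫ t in a..b, g t ^ 2 := by
  rcases hab.eq_or_lt with rfl | hlt
  · simp
  set c : ℝ := (∫ t in a..b, g t) / (b - a) with hc
  have hba : 0 < b - a := sub_pos.mpr hlt
  have h0 : 0 ≤ ∫ t in a..b, (g t - c) ^ 2 :=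
    intervalIntegral.integral_nonneg hab fun t _ => sq_nonneg _
  have h1 : ∫ t in a..b, (g t - c) ^ 2
      = (∫ t in a..b, g t ^ 2) - 2 * c * (∫ t in a..b, g t) + (b - a) * c ^ 2 := by
    have e : ∀ t, (g t - c) ^ 2 = g t ^ 2 - 2 * c * g t + c ^ 2 := fun t => by ring
    simp_rw [e]
    rw [intervalIntegral.integral_add (hg2.sub (hg.const_mul _)) intervalIntegrable_const,
      intervalIntegral.integral_sub hg2 (hg.const_mul _), intervalIntegral.integral_const_mul,
      intervalIntegral.integral_const, smul_eq_mul]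
  have h2 : ∫ t in a..b, g t = c * (b - a) := by rw [hc]; field_simp
  rw [h1, h2] at h0
  rw [h2]
  nlinarith [mul_nonneg hba.le h0]

/-- The derivative is not assumed continuous: the fundamental theorem of calculus is used for a
function differentiable everywhere with integrable derivative, followed by Cauchy–Schwarz. -/
lemma sq_sub_le_integral_deriv_sq {f : ℝ → ℝ} {a b : ℝ} (hab : a ≤ b) (hf : Differentiable ℝ f)
    (h : IntervalIntegrable (fun t => deriv f t ^ 2) volume a b) :
    (f b - f a) ^ 2 ≤ (b - a) * ∫ t in a..b, deriv f t ^ 2 := by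
  have hi := intervalIntegrable_of_sq (measurable_deriv f) h
  rw [← intervalIntegral.integral_eq_sub_of_hasDerivAt (fun t _ => (hf t).hasDerivAt) hi]
  exact sq_integral_le hab hi h

/-- Measurable `1`-periodic functions, square integrable over a period. -/
structure PerSqInt (g : ℝ → ℝ) : Prop where
  meas : Measurable g
  per : Function.Periodic g 1
  int : IntervalIntegrable (fun t => g t ^ 2) volume 0 1

lemma PerSqInt.intervalIntegrable {g : ℝ → ℝ} (h : PerSqInt g) (a b : ℝ) :
    IntervalIntegrable (fun t => g t ^ 2) volume a b := by
  have hp : Function.Periodic (fun t => g t ^ 2) 1 := fun t => by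
    show g (t + 1) ^ 2 = g t ^ 2
    rw [h.per t]
  exact hp.intervalIntegrable (t := 0) one_ne_zero (by simpa using h.int) a b

lemma PerSqInt.fwdDiff {g : ℝ → ℝ} (h : PerSqInt g) (d : ℝ) : PerSqInt (fwdDiff d g) := by
  have hm : Measurable (_root_.fwdDiff d g) :=
    (h.meas.comp (measurable_id.add_const d)).sub h.meas
  refine ⟨hm, fun t => ?_, ?_⟩
  · simp only [_root_.fwdDiff]
    rw [add_right_comm, h.per, h.per]
  · have h1 : IntervalIntegrable (fun t => g (t + d) ^ 2) volume 0 1 := by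
      have := (h.intervalIntegrable (0 + d) (1 + d)).comp_add_right d
      simpa using this
    have h2 : IntervalIntegrable (fun t => 2 * g (t + d) ^ 2 + 2 * g t ^ 2) volume 0 1 :=
      (h1.const_mul 2).add (h.int.const_mul 2)
    refine h2.mono_fun (hm.pow_const 2).aestronglyMeasurable (Eventually.of_forall fun t => ?_)
    simp only [Real.norm_eq_abs, _root_.fwdDiff]
    rw [abs_of_nonneg (by positivity), abs_of_nonneg (by positivity)]
    nlinarith [sq_nonneg (g (t + d) + g t)]

lemma PerSqInt.fwdDiff_iterate {g : ℝ → ℝ} (h : PerSqInt g) (d : ℝ) (k : ℕ) :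
    PerSqInt ((_root_.fwdDiff d)^[k] g) := by
  induction k with
  | zero => exact h
  | succ k ih => rw [Function.iterate_succ_apply']; exact ih.fwdDiff d

lemma periodic_deriv {f : ℝ → ℝ} {c : ℝ} (h : Function.Periodic f c) :
    Function.Periodic (deriv f) c := fun t => by
  have : (fun x => f (x + c)) = f := funext h
  rw [← deriv_comp_add_const, this]

lemma differentiable_fwdDiff {f : ℝ → ℝ} (hf : Differentiable ℝ f) (d : ℝ) :
    Differentiable ℝ (fwdDiff d f) := by
  unfold fwdDiff; fun_prop

lemma deriv_fwdDiff {f : ℝ → ℝ} (hf : Differentiable ℝ f) (d : ℝ) :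
    deriv (fwdDiff d f) = fwdDiff d (deriv f) := by
  funext t
  unfold fwdDiff
  rw [deriv_fun_sub (by fun_prop) (by fun_prop), deriv_comp_add_const]

lemma fwdDiff_iterate_deriv {f : ℝ → ℝ} (hf : Differentiable ℝ f) (d : ℝ) (k : ℕ) :
    Differentiable ℝ ((fwdDiff d)^[k] f) ∧
      deriv ((fwdDiff d)^[k] f) = (fwdDiff d)^[k] (deriv f) := by
  induction k with
  | zero => exact ⟨hf, rfl⟩
  | succ k ih =>
    rw [Function.iterate_succ_apply', Function.iterate_succ_apply']
    exact ⟨differentiable_fwdDiff ih.1 d, by rw [deriv_fwdDiff ih.1, ih.2]⟩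

/-- The difference operator with step `d` is bounded by `d` times the derivative in `L²`. -/
lemma integral_fwdDiff_sq_le {f : ℝ → ℝ} (hf : Differentiable ℝ f) (h : PerSqInt (deriv f))
    {d : ℝ} (hd : 0 ≤ d) :
    ∫ t in (0 : ℝ)..1, fwdDiff d f t ^ 2 ≤ d ^ 2 * ∫ t in (0 : ℝ)..1, deriv f t ^ 2 := by
  -- The pointwise bound is d (G(t+d) − G(t)). Since G(x+1) = G(x) + G(1), its integral over a
  -- period is exactly d² G(1); the primitive takes the place of Fubini and no constant is lost.
  set G : ℝ → ℝ := fun x => ∫ t in (0 : ℝ)..x, deriv f t ^ 2 with hG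
  have hGc : Continuous G :=
    intervalIntegral.continuous_primitive (fun a b => h.intervalIntegrable a b) 0
  have hGd : ∀ a b, ∫ t in a..b, deriv f t ^ 2 = G b - G a := fun a b => by
    rw [hG]
    exact (intervalIntegral.integral_interval_sub_left (h.intervalIntegrable _ _)
      (h.intervalIntegrable _ _)).symm
  have hp : Function.Periodic (fun t => deriv f t ^ 2) 1 := fun t => by
    show deriv f (t + 1) ^ 2 = deriv f t ^ 2
    rw [h.per t]
  have hper : ∀ x, G (x + 1) = G x + G 1 := fun x => by
    have h1 := hp.intervalIntegral_add_eq x 0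
    rw [hGd, hGd] at h1
    have h0 : G 0 = 0 := by simp [hG]
    simp only [zero_add, h0] at h1
    linarith
  have hfc := hf.continuous
  have step : ∫ t in (0 : ℝ)..1, fwdDiff d f t ^ 2
      ≤ ∫ t in (0 : ℝ)..1, d * (G (t + d) - G t) := by
    refine intervalIntegral.integral_mono_on zero_le_one ?_ ?_ fun t _ => ?_
    · apply Continuous.intervalIntegrable; unfold fwdDiff; fun_prop
    · apply Continuous.intervalIntegrable; fun_prop
    · have := sq_sub_le_integral_deriv_sq (a := t) (b := t + d) (by linarith) hf
        (h.intervalIntegrable _ _)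
      rw [hGd] at this
      simpa [fwdDiff] using this
  have hGi : ∀ a b, IntervalIntegrable G volume a b := fun a b => hGc.intervalIntegrable a b
  have e1 : ∫ t in (0 : ℝ)..1, (G (t + d) - G t) = d * G 1 := by
    rw [intervalIntegral.integral_sub (by apply Continuous.intervalIntegrable; fun_prop) (hGi _ _),
      intervalIntegral.integral_comp_add_right]
    have a1 : (∫ t in (0 + d)..(1 + d), G t) - ∫ t in (0 : ℝ)..1, G t
        = (∫ t in (0 + 1 : ℝ)..(d + 1), G t) - ∫ t in (0 : ℝ)..d, G t := by
      have b1 := intervalIntegral.integral_add_adjacent_intervals (hGi 0 d) (hGi d (1 + d))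
      have b2 := intervalIntegral.integral_add_adjacent_intervals (hGi 0 1) (hGi 1 (1 + d))
      rw [zero_add, zero_add, add_comm d 1]
      linarith
    rw [a1, ← intervalIntegral.integral_comp_add_right]
    simp_rw [hper]
    rw [intervalIntegral.integral_add (hGi _ _) intervalIntegrable_const,
      intervalIntegral.integral_const, smul_eq_mul]
    ring
  rw [intervalIntegral.integral_const_mul, e1] at step
  calc _ ≤ _ := step
    _ = _ := by rw [hG]; ring

lemma designPoint_add_inv {n : ℕ} (l : Fin n) :
    designPoint n l + 1 / n = (((l : ℕ) + 1 : ℕ) + 1 : ℝ) / n := by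
  unfold designPoint; push_cast; ring

lemma sum_integral_designPoint {F : ℝ → ℝ} (hF : ∀ a b, IntervalIntegrable F volume a b) (n : ℕ)
    (s : ℝ) :
    ∑ l : Fin n, ∫ t in ((l : ℕ) + s) / n..((l : ℕ) + 1 + s) / n, F t
      = ∫ t in s / n..(n + s) / n, F t := by
  have := intervalIntegral.sum_integral_adjacent_intervals (f := F) (μ := volume)
    (a := fun i : ℕ => ((i : ℝ) + s) / n) (n := n) (fun k _ => hF _ _)
  rw [Finset.sum_range] at this
  simpa using this

/-- The difference operator with step `1 / n` in the empirical norm. -/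
lemma sum_fwdDiff_sq_le {n : ℕ} (hn : 0 < n) {f : ℝ → ℝ} (hf : Differentiable ℝ f)
    (h : PerSqInt (deriv f)) :
    ∑ l : Fin n, fwdDiff (1 / n : ℝ) f (designPoint n l) ^ 2
      ≤ (1 / n : ℝ) * ∫ t in (0 : ℝ)..1, deriv f t ^ 2 := by
  have hn' : (0 : ℝ) < n := by exact_mod_cast hn
  have h1 : ∀ l : Fin n, fwdDiff (1 / n : ℝ) f (designPoint n l) ^ 2
      ≤ (1 / n : ℝ) * ∫ t in ((l : ℕ) + 1) / n..((l : ℕ) + 1 + 1) / n, deriv f t ^ 2 := by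
    intro l
    have hle : (((l : ℕ) : ℝ) + 1) / n ≤ (((l : ℕ) : ℝ) + 1 + 1) / n := by gcongr; linarith
    have := sq_sub_le_integral_deriv_sq hle hf (h.intervalIntegrable _ _)
    have e : (((l : ℕ) : ℝ) + 1 + 1) / n - (((l : ℕ) : ℝ) + 1) / n = 1 / n := by ring
    rw [e] at this
    refine le_of_eq_of_le ?_ this
    unfold fwdDiff
    rw [designPoint_add_inv]
    unfold designPoint
    push_cast
    rfl
  refine (Finset.sum_le_sum fun l _ => h1 l).trans ?_
  rw [← Finset.mul_sum, sum_integral_designPoint (fun a b => h.intervalIntegrable a b)]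
  have hp : Function.Periodic (fun t => deriv f t ^ 2) 1 := fun t => by
    show deriv f (t + 1) ^ 2 = deriv f t ^ 2
    rw [h.per t]
  -- The design points start at 1/n, so the cells to their right tile a period shifted by 1/n;
  -- periodicity moves it back to [0,1].
  have e : ((n : ℝ) + 1) / n = 1 / n + 1 := by field_simp; ring
  rw [e, hp.intervalIntegral_add_eq (1 / (n : ℝ)) 0, zero_add]

/-- Smoothness of order `k` in the sense of `sobolevClass`, without the bound on the norm. -/
structure SobolevReg (k : ℕ) (f : ℝ → ℝ) : Prop where
  per : Function.Periodic f 1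
  diff : ∀ j < k, Differentiable ℝ (iteratedDeriv j f)
  int : ∀ j ≤ k, IntervalIntegrable (fun t => iteratedDeriv j f t ^ 2) volume 0 1

lemma SobolevReg.deriv {k : ℕ} {f : ℝ → ℝ} (h : SobolevReg (k + 1) f) :
    SobolevReg k (deriv f) := by
  refine ⟨periodic_deriv h.per, fun j hj => ?_, fun j hj => ?_⟩
  · rw [← iteratedDeriv_succ']; exact h.diff _ (by omega)
  · rw [← iteratedDeriv_succ']; exact h.int _ (by omega)

lemma SobolevReg.differentiable {k : ℕ} {f : ℝ → ℝ} (h : SobolevReg (k + 1) f) :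
    Differentiable ℝ f := by
  simpa using h.diff 0 (by omega)

lemma SobolevReg.perSqInt_deriv {k : ℕ} {f : ℝ → ℝ} (h : SobolevReg (k + 1) f) :
    PerSqInt (_root_.deriv f) :=
  ⟨measurable_deriv f, periodic_deriv h.per, by simpa using h.int 1 (by omega)⟩

lemma integral_fwdDiff_iterate_sq_le {d : ℝ} (hd : 0 ≤ d) (k : ℕ) (f : ℝ → ℝ)
    (h : SobolevReg k f) :
    ∫ t in (0 : ℝ)..1, (fwdDiff d)^[k] f t ^ 2
      ≤ (d ^ 2) ^ k * ∫ t in (0 : ℝ)..1, iteratedDeriv k f t ^ 2 := by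
  induction k generalizing f with
  | zero => simp
  | succ k ih =>
    obtain ⟨h1, h2⟩ := fwdDiff_iterate_deriv h.differentiable d k
    rw [Function.iterate_succ_apply']
    refine (integral_fwdDiff_sq_le h1 ?_ hd).trans ?_
    · rw [h2]; exact h.perSqInt_deriv.fwdDiff_iterate d k
    · rw [h2, iteratedDeriv_succ', pow_succ' (d ^ 2), mul_assoc]
      exact mul_le_mul_of_nonneg_left (ih _ h.deriv) (sq_nonneg d)

/-- One difference pays for the passage from the design points to an integral (`sum_fwdDiff_sq_le`),
the other k − 1 are bounded in L² (`integral_fwdDiff_iterate_sq_le`). The constant is exactly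
n^{-2k}, as the sharp risk bound requires. -/
lemma sum_fwdDiff_iterate_sq_le {n : ℕ} (hn : 0 < n) {k : ℕ} (hk : 1 ≤ k) {f : ℝ → ℝ}
    (h : SobolevReg k f) :
    (1 / n : ℝ) * ∑ l : Fin n, (fwdDiff (1 / n : ℝ))^[k] f (designPoint n l) ^ 2
      ≤ ((1 / n : ℝ) ^ 2) ^ k * ∫ t in (0 : ℝ)..1, iteratedDeriv k f t ^ 2 := by
  obtain ⟨k, rfl⟩ : ∃ m, k = m + 1 := ⟨k - 1, by omega⟩
  obtain ⟨h1, h2⟩ := fwdDiff_iterate_deriv h.differentiable (1 / n : ℝ) k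
  have hn' : (0 : ℝ) ≤ 1 / n := by positivity
  rw [Function.iterate_succ_apply']
  have h3 := sum_fwdDiff_sq_le hn h1 (by rw [h2]; exact h.perSqInt_deriv.fwdDiff_iterate _ k)
  rw [h2] at h3
  have h4 := integral_fwdDiff_iterate_sq_le hn' k _ h.deriv
  rw [iteratedDeriv_succ', pow_succ' ((1 / n : ℝ) ^ 2), mul_assoc]
  calc _ ≤ (1 / n : ℝ) * ((1 / n : ℝ) * _) := mul_le_mul_of_nonneg_left h3 hn'
    _ = (1 / n : ℝ) ^ 2 * _ := by ring
    _ ≤ _ := mul_le_mul_of_nonneg_left h4 (sq_nonneg _)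

/-! ### Fourier coefficients of differences -/

lemma sum_designPoint_shift {n : ℕ} (hn : 0 < n) {F : ℝ → ℝ} (hF : Function.Periodic F 1) :
    ∑ l : Fin n, F (designPoint n l + 1 / n) = ∑ l : Fin n, F (designPoint n l) := by
  have hn' : (n : ℝ) ≠ 0 := by exact_mod_cast hn.ne'
  rw [← sub_eq_zero, ← Finset.sum_sub_distrib]
  simp_rw [designPoint_add_inv]
  unfold designPoint
  rw [Fin.sum_univ_eq_sum_range (fun l : ℕ => F (((l + 1 : ℕ) + 1 : ℝ) / n)
      - F ((l + 1 : ℝ) / n)) n,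
    Finset.sum_range_sub (fun l : ℕ => F ((l + 1 : ℝ) / n))]
  have : ((n : ℝ) + 1) / n = (((0 : ℕ) : ℝ) + 1) / n + 1 := by
    push_cast; field_simp; ring
  rw [this, hF, sub_self]

lemma thetaHat_fwdDiff_one {n : ℕ} (hn : 0 < n) {f : ℝ → ℝ} (hf : Function.Periodic f 1) :
    thetaHat n (fun l => fwdDiff (1 / n : ℝ) f (designPoint n l)) 1 = 0 := by
  rw [thetaHat_eq]
  simp only [trigBasis_one, mul_one, fwdDiff, Finset.sum_sub_distrib]
  rw [sum_designPoint_shift hn hf, sub_self, mul_zero]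

lemma sum_shift_mul {n : ℕ} (hn : 0 < n) {f φ : ℝ → ℝ} (hf : Function.Periodic f 1)
    (hφ : Function.Periodic φ 1) :
    ∑ l : Fin n, f (designPoint n l + 1 / n) * φ (designPoint n l)
      = ∑ l : Fin n, f (designPoint n l) * φ (designPoint n l - 1 / n) := by
  have := sum_designPoint_shift hn (F := fun x => f x * φ (x - 1 / n)) (fun x => by
    show f (x + 1) * φ (x + 1 - 1 / n) = f x * φ (x - 1 / n)
    rw [hf, add_sub_right_comm, hφ])
  simpa using this

/-- A shift by 1/n rotates the pair of cosine and sine coefficients at frequency m by the angle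
2πm/n. Subtracting the identity therefore multiplies the length of the pair by |exp(2πim/n) − 1|,
that is by 2|sin(πm/n)|. -/
lemma thetaHat_fwdDiff_pair {n : ℕ} (hn : 0 < n) {f : ℝ → ℝ} (hf : Function.Periodic f 1)
    {m : ℕ} (hm : 1 ≤ m) :
    thetaHat n (fun l => fwdDiff (1 / n : ℝ) f (designPoint n l)) (2 * m) ^ 2
      + thetaHat n (fun l => fwdDiff (1 / n : ℝ) f (designPoint n l)) (2 * m + 1) ^ 2
      = (2 * Real.sin (Real.pi * m / n)) ^ 2
        * (thetaHat n (fun l => f (designPoint n l)) (2 * m) ^ 2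
          + thetaHat n (fun l => f (designPoint n l)) (2 * m + 1) ^ 2) := by
  have hpc : Function.Periodic (fun x => √2 * Real.cos (2 * Real.pi * m * x)) 1 := fun x => by
    show √2 * Real.cos (2 * Real.pi * m * (x + 1)) = √2 * Real.cos (2 * Real.pi * m * x)
    have : 2 * Real.pi * m * (x + 1) = 2 * Real.pi * m * x + m * (2 * Real.pi) := by ring
    rw [this, Real.cos_add_nat_mul_two_pi]
  have hps : Function.Periodic (fun x => √2 * Real.sin (2 * Real.pi * m * x)) 1 := fun x => by
    show √2 * Real.sin (2 * Real.pi * m * (x + 1)) = √2 * Real.sin (2 * Real.pi * m * x)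
    have : 2 * Real.pi * m * (x + 1) = 2 * Real.pi * m * x + m * (2 * Real.pi) := by ring
    rw [this, Real.sin_add_nat_mul_two_pi]
  set c := Real.cos (2 * (Real.pi * m / n)) with hc
  set s := Real.sin (2 * (Real.pi * m / n)) with hs
  set u := thetaHat n (fun l => f (designPoint n l)) (2 * m) with hu
  set v := thetaHat n (fun l => f (designPoint n l)) (2 * m + 1) with hv
  have earg : ∀ x : ℝ, 2 * Real.pi * m * (x - 1 / n)
      = 2 * Real.pi * m * x - 2 * (Real.pi * m / n) := fun x => by ring
  have e1 : thetaHat n (fun l => f (designPoint n l + 1 / n)) (2 * m) = c * u + s * v := by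
    rw [hu, hv, thetaHat_eq, thetaHat_eq, thetaHat_eq]
    simp only [trigBasis_even, trigBasis_odd hm]
    rw [sum_shift_mul hn hf hpc]
    simp only [earg, Real.cos_sub, ← hc, ← hs]
    simp only [Finset.mul_sum]
    rw [← Finset.sum_add_distrib]
    exact Finset.sum_congr rfl fun l _ => by ring
  have e2 : thetaHat n (fun l => f (designPoint n l + 1 / n)) (2 * m + 1) = c * v - s * u := by
    rw [hu, hv, thetaHat_eq, thetaHat_eq, thetaHat_eq]
    simp only [trigBasis_even, trigBasis_odd hm]
    rw [sum_shift_mul hn hf hps]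
    simp only [earg, Real.sin_sub, ← hc, ← hs]
    simp only [Finset.mul_sum]
    rw [← Finset.sum_sub_distrib]
    exact Finset.sum_congr rfl fun l _ => by ring
  unfold fwdDiff
  rw [thetaHat_sub, thetaHat_sub, e1, e2, ← hu, ← hv]
  have h1 : c ^ 2 + s ^ 2 = 1 := Real.cos_sq_add_sin_sq _
  have h2 : c = 1 - 2 * Real.sin (Real.pi * m / n) ^ 2 := by
    rw [hc, Real.cos_two_mul, Real.cos_sq']; ring
  linear_combination (u ^ 2 + v ^ 2) * h1 - 2 * (u ^ 2 + v ^ 2) * h2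

lemma sum_Icc_one_pairs {M : Type*} [AddCommMonoid M] (F : ℕ → M) (q : ℕ) :
    ∑ j ∈ Finset.Icc 1 (2 * q + 1), F j
      = F 1 + ∑ m ∈ Finset.Icc 1 q, (F (2 * m) + F (2 * m + 1)) := by
  induction q with
  | zero => simp
  | succ q ih =>
    rw [show 2 * (q + 1) + 1 = (2 * q + 1) + 1 + 1 by ring,
      Finset.sum_Icc_succ_top (by omega), Finset.sum_Icc_succ_top (by omega), ih,
      Finset.sum_Icc_succ_top (by omega), add_assoc, add_assoc, add_assoc]
    rfl

/-- The shift mixes sine and cosine, so only the energy of a pair is scaled; the multiplier w must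
depend on the frequency j / 2 alone. -/
lemma sum_mul_thetaHat_fwdDiff_sq {n : ℕ} (hn : Odd n) {f : ℝ → ℝ} (hf : Function.Periodic f 1)
    (w : ℕ → ℝ) :
    ∑ j ∈ Finset.Icc 1 n,
        w (j / 2) * thetaHat n (fun l => fwdDiff (1 / n : ℝ) f (designPoint n l)) j ^ 2
      = ∑ j ∈ Finset.Icc 1 n, w (j / 2) * (2 * Real.sin (Real.pi * (j / 2 : ℕ) / n)) ^ 2
        * thetaHat n (fun l => f (designPoint n l)) j ^ 2 := by
  have hn0 := hn.pos
  obtain ⟨q, hq⟩ := hn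
  have hI : Finset.Icc 1 n = Finset.Icc 1 (2 * q + 1) := by rw [hq]
  rw [hI, sum_Icc_one_pairs, sum_Icc_one_pairs, thetaHat_fwdDiff_one hn0 hf]
  congr 1
  · simp
  · refine Finset.sum_congr rfl fun m hm => ?_
    have h1 : 2 * m / 2 = m := by omega
    have h2 : (2 * m + 1) / 2 = m := by omega
    have := thetaHat_fwdDiff_pair hn0 hf (Finset.mem_Icc.mp hm).1
    rw [h1, h2, ← mul_add, this]
    ring

lemma sum_mul_thetaHat_fwdDiff_iterate_sq {n : ℕ} (hn : Odd n) (k : ℕ) (w : ℕ → ℝ) {f : ℝ → ℝ}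
    (hf : Function.Periodic f 1) :
    ∑ j ∈ Finset.Icc 1 n,
        w (j / 2) * thetaHat n (fun l => (fwdDiff (1 / n : ℝ))^[k] f (designPoint n l)) j ^ 2
      = ∑ j ∈ Finset.Icc 1 n, w (j / 2) * ((2 * Real.sin (Real.pi * (j / 2 : ℕ) / n)) ^ 2) ^ k
        * thetaHat n (fun l => f (designPoint n l)) j ^ 2 := by
  induction k generalizing f with
  | zero => simp
  | succ k ih =>
    have hp : Function.Periodic (fwdDiff (1 / n : ℝ) f) 1 := fun t => by
      simp only [fwdDiff]
      rw [add_right_comm, hf, hf]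
    rw [Function.iterate_succ_apply, ih hp]
    have := sum_mul_thetaHat_fwdDiff_sq hn hf
      (fun m => w m * ((2 * Real.sin (Real.pi * (m : ℕ) / n)) ^ 2) ^ k)
    rw [this]
    exact Finset.sum_congr rfl fun j _ => by ring

/-- The discrete Sobolev seminorm of order `k` is at most the continuous one. -/
lemma sum_sobolev_thetaHat_sq_le {n : ℕ} (hn : Odd n) {k : ℕ} (hk : 1 ≤ k) {f : ℝ → ℝ}
    (h : SobolevReg k f) :
    ∑ j ∈ Finset.Icc 1 n, (2 * n * Real.sin (Real.pi * (j / 2 : ℕ) / n)) ^ (2 * k)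
        * thetaHat n (fun l => f (designPoint n l)) j ^ 2
      ≤ ∫ t in (0 : ℝ)..1, iteratedDeriv k f t ^ 2 := by
  have hn0 : (0 : ℝ) < n := by exact_mod_cast hn.pos
  have h1 := sum_fwdDiff_iterate_sq_le hn.pos hk h
  have h2 := sum_thetaHat_sq hn (fun l => (fwdDiff (1 / n : ℝ))^[k] f (designPoint n l))
  have h3 := sum_mul_thetaHat_fwdDiff_iterate_sq hn k (fun _ => 1) h.per
  simp only [one_mul] at h3
  rw [← h2, h3] at h1
  have h4 : ∀ j : ℕ, (2 * n * Real.sin (Real.pi * (j / 2 : ℕ) / n)) ^ (2 * k)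
        * thetaHat n (fun l => f (designPoint n l)) j ^ 2
      = ((n : ℝ) ^ 2) ^ k * (((2 * Real.sin (Real.pi * (j / 2 : ℕ) / n)) ^ 2) ^ k
        * thetaHat n (fun l => f (designPoint n l)) j ^ 2) := fun j => by
    rw [pow_mul, ← mul_assoc, ← mul_pow]; ring
  rw [Finset.sum_congr rfl fun j _ => h4 j, ← Finset.mul_sum]
  calc _ ≤ ((n : ℝ) ^ 2) ^ k * (((1 / n : ℝ) ^ 2) ^ k * _) :=
        mul_le_mul_of_nonneg_left h1 (by positivity)
    _ = _ := by
        rw [← mul_assoc, ← mul_pow]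
        have : (n : ℝ) ^ 2 * (1 / n) ^ 2 = 1 := by field_simp
        rw [this, one_pow, one_mul]

/-! ### Comparison of the empirical norm with the norm of `L²[0,1]` -/

lemma stepExtension_of_mem_Ioc {n : ℕ} (f : ℝ → ℝ) (l : Fin n) {x : ℝ}
    (hx : x ∈ Set.Ioc ((l : ℕ) / n : ℝ) (((l : ℕ) + 1) / n)) :
    stepExtension n f x = f (designPoint n l) := by
  have hn : (0 : ℝ) < n := by exact_mod_cast l.pos
  have hxl : (l : ℕ) < x * n := by have := hx.1; rwa [div_lt_iff₀ hn] at this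
  have hxu : x * n ≤ (l : ℕ) + 1 := by have := hx.2; rwa [le_div_iff₀ hn] at this
  have hmem : ∀ i : ℕ, x ∈ Set.Ioc (((i : ℝ) - 1) / n) ((i : ℝ) / n) ↔ i = (l : ℕ) + 1 := by
    intro i
    rw [Set.mem_Ioc, div_lt_iff₀ hn, le_div_iff₀ hn]
    constructor
    · rintro ⟨h1, h2⟩
      have a1 : (i : ℝ) < ((l : ℕ) + 2 : ℕ) := by push_cast; linarith
      have a2 : (((l : ℕ) : ℕ) : ℝ) < (i : ℝ) := by linarith
      have a3 : i < (l : ℕ) + 2 := by exact_mod_cast a1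
      have a4 : (l : ℕ) < i := by exact_mod_cast a2
      omega
    · rintro rfl
      push_cast
      constructor <;> linarith
  unfold stepExtension
  simp only [Set.indicator_apply, hmem]
  rw [Finset.sum_ite_eq']
  by_cases hl : (l : ℕ) = 0
  · have h1 : x ∈ Set.Icc (0 : ℝ) (1 / n) := by
      rw [hl] at hxl hxu
      push_cast at hxl hxu
      refine ⟨?_, ?_⟩
      · by_contra h
        nlinarith
      · rw [le_div_iff₀ hn]; linarith
    have h2 : ¬ ((l : ℕ) + 1 ∈ Finset.Icc 2 n) := by rw [Finset.mem_Icc]; omega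
    rw [if_pos h1, if_neg h2]
    simp [designPoint, hl]
  · have h1 : ¬ x ∈ Set.Icc (0 : ℝ) (1 / n) := by
      rintro ⟨-, h⟩
      rw [le_div_iff₀ hn] at h
      have : (1 : ℝ) ≤ (l : ℕ) := by exact_mod_cast Nat.one_le_iff_ne_zero.mpr hl
      linarith
    have h2 : (l : ℕ) + 1 ∈ Finset.Icc 2 n := by rw [Finset.mem_Icc]; omega
    rw [if_neg h1, if_pos h2]
    simp [designPoint]

lemma empNormSq_eq (n : ℕ) (f : ℝ → ℝ) :
    empNormSq n f = (1 / (n : ℝ)) * ∑ l : Fin n, f (designPoint n l) ^ 2 := by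
  simp only [empNormSq, empInner, sq]

lemma sum_integral_unit {n : ℕ} (hn : 0 < n) {F : ℝ → ℝ}
    (hF : ∀ l : Fin n, IntervalIntegrable F volume ((l : ℕ) / n) (((l : ℕ) + 1) / n)) :
    ∑ l : Fin n, ∫ t in ((l : ℕ) / n : ℝ)..(((l : ℕ) + 1) / n), F t = ∫ t in (0 : ℝ)..1, F t := by
  have hn' : (n : ℝ) ≠ 0 := by exact_mod_cast hn.ne'
  have := intervalIntegral.sum_integral_adjacent_intervals (f := F) (μ := volume)
    (a := fun i : ℕ => (i : ℝ) / n) (n := n) (fun k hk => by simpa using hF ⟨k, hk⟩)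
  rw [Finset.sum_range] at this
  simpa [hn'] using this

lemma sq_sub_le_of_mem_Icc {f : ℝ → ℝ} (hf : Differentiable ℝ f)
    (h : ∀ a b, IntervalIntegrable (fun t => deriv f t ^ 2) volume a b) {a b t : ℝ}
    (ht : t ∈ Set.Icc a b) :
    (f b - f t) ^ 2 ≤ (b - a) * ∫ s in a..b, deriv f s ^ 2 := by
  refine (sq_sub_le_integral_deriv_sq ht.2 hf (h _ _)).trans ?_
  refine mul_le_mul (by linarith [ht.1]) ?_
    (intervalIntegral.integral_nonneg ht.2 fun _ _ => sq_nonneg _) (by linarith [ht.1, ht.2])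
  exact intervalIntegral.integral_mono_interval ht.1 ht.2 le_rfl
    (Eventually.of_forall fun _ => sq_nonneg _) (h _ _)

lemma sq_add_le_of_pos {δ : ℝ} (hδ : 0 < δ) (a b : ℝ) :
    (a + b) ^ 2 ≤ (1 + δ) * a ^ 2 + (1 + 1 / δ) * b ^ 2 := by
  have h : 0 ≤ (δ * a - b) ^ 2 / δ := by positivity
  have e : (δ * a - b) ^ 2 / δ = δ * a ^ 2 - 2 * a * b + 1 / δ * b ^ 2 := by
    field_simp; ring
  rw [e] at h
  nlinarith

/-- The `L²[0,1]` loss of the step extension of `u` as an estimate of `S`. -/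
lemma normSq_stepExtension_sub_le {n : ℕ} (hn : 0 < n) (u : ℝ → ℝ) {S : ℝ → ℝ}
    (hS : Differentiable ℝ S)
    (h : ∀ a b, IntervalIntegrable (fun t => deriv S t ^ 2) volume a b) {δ : ℝ} (hδ : 0 < δ) :
    normSq (fun x => stepExtension n u x - S x)
      ≤ (1 + δ) * empNormSq n (fun x => u x - S x)
        + (1 + 1 / δ) * ((1 / n) ^ 2 * ∫ t in (0 : ℝ)..1, deriv S t ^ 2) := by
  have hn' : (0 : ℝ) < n := by exact_mod_cast hn
  have hSc := hS.continuous
  have hle : ∀ l : Fin n, ((l : ℕ) / n : ℝ) ≤ ((l : ℕ) + 1) / n := fun l => by gcongr; linarith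
  have hlen : ∀ l : Fin n, ((l : ℕ) + 1 : ℝ) / n - (l : ℕ) / n = 1 / n := fun l => by ring
  have heq : ∀ l : Fin n, ∀ t ∈ Set.uIoc ((l : ℕ) / n : ℝ) (((l : ℕ) + 1) / n),
      (stepExtension n u t - S t) ^ 2 = (u (designPoint n l) - S t) ^ 2 := fun l t ht => by
    rw [Set.uIoc_of_le (hle l)] at ht
    rw [stepExtension_of_mem_Ioc u l ht]
  have hint : ∀ l : Fin n, IntervalIntegrable (fun t => (u (designPoint n l) - S t) ^ 2) volume
      ((l : ℕ) / n : ℝ) (((l : ℕ) + 1) / n) := fun l => by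
    apply Continuous.intervalIntegrable; fun_prop
  have hi : ∀ l : Fin n, IntervalIntegrable (fun t => (stepExtension n u t - S t) ^ 2) volume
      ((l : ℕ) / n : ℝ) (((l : ℕ) + 1) / n) := fun l => by
    refine (hint l).congr ?_
    intro t ht
    exact (heq l t ht).symm
  unfold normSq
  rw [← sum_integral_unit hn hi, ← sum_integral_unit hn (fun l => h _ _), empNormSq_eq,
    Finset.mul_sum, Finset.mul_sum, Finset.mul_sum, Finset.mul_sum, ← Finset.sum_add_distrib]
  refine Finset.sum_le_sum fun l _ => ?_
  rw [intervalIntegral.integral_congr_ae (Eventually.of_forall fun t ht => heq l t ht)]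
  set C := ∫ s in ((l : ℕ) / n : ℝ)..(((l : ℕ) + 1) / n), deriv S s ^ 2 with hC
  have hb : ∀ t ∈ Set.Icc ((l : ℕ) / n : ℝ) (((l : ℕ) + 1) / n),
      (u (designPoint n l) - S t) ^ 2
        ≤ (1 + δ) * (u (designPoint n l) - S (designPoint n l)) ^ 2
          + (1 + 1 / δ) * ((1 / n) * C) := fun t ht => by
    have h1 := sq_add_le_of_pos hδ (u (designPoint n l) - S (designPoint n l))
      (S (designPoint n l) - S t)
    rw [sub_add_sub_cancel] at h1
    have h2 := sq_sub_le_of_mem_Icc hS h ht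
    rw [hlen] at h2
    refine h1.trans ?_
    gcongr
    exact h2
  have := intervalIntegral.integral_mono_on (hle l) (hint l) intervalIntegrable_const hb
  rw [intervalIntegral.integral_const, hlen, smul_eq_mul] at this
  refine this.trans (le_of_eq ?_)
  ring

/-- The bound for step functions, with the zero function as the estimate of f. -/
lemma normSq_le_empNormSq {n : ℕ} (hn : 0 < n) {f : ℝ → ℝ} (hf : Differentiable ℝ f)
    (h : ∀ a b, IntervalIntegrable (fun t => deriv f t ^ 2) volume a b) {δ : ℝ} (hδ : 0 < δ) :
    normSq f ≤ (1 + δ) * empNormSq n f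
        + (1 + 1 / δ) * ((1 / n) ^ 2 * ∫ t in (0 : ℝ)..1, deriv f t ^ 2) := by
  have := normSq_stepExtension_sub_le hn (fun _ => 0) hf h hδ
  have h0 : stepExtension n (fun _ => 0) = fun _ => 0 := by
    funext x; simp [stepExtension]
  have h1 : ∀ g : ℝ → ℝ, normSq (fun x => 0 - g x) = normSq g := fun g => by
    simp [normSq]
  have h2 : ∀ g : ℝ → ℝ, empNormSq n (fun x => 0 - g x) = empNormSq n g := fun g => by
    simp [empNormSq_eq]
  rwa [h0, h1, h2] at this

/-- A crude converse: the factor 2 is harmless because it serves only to bound the empirical energy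
of S. -/
lemma empNormSq_le_normSq {n : ℕ} (hn : 0 < n) {f : ℝ → ℝ} (hf : Differentiable ℝ f)
    (h : ∀ a b, IntervalIntegrable (fun t => deriv f t ^ 2) volume a b) :
    empNormSq n f ≤ 2 * normSq f + 2 * ((1 / n) ^ 2 * ∫ t in (0 : ℝ)..1, deriv f t ^ 2) := by
  have hn' : (0 : ℝ) < n := by exact_mod_cast hn
  have hfc := hf.continuous
  have hle : ∀ l : Fin n, ((l : ℕ) / n : ℝ) ≤ ((l : ℕ) + 1) / n := fun l => by gcongr; linarith
  have hlen : ∀ l : Fin n, ((l : ℕ) + 1 : ℝ) / n - (l : ℕ) / n = 1 / n := fun l => by ring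
  have hi : ∀ l : Fin n, IntervalIntegrable (fun t => f t ^ 2) volume
      ((l : ℕ) / n : ℝ) (((l : ℕ) + 1) / n) := fun l => by
    apply Continuous.intervalIntegrable; fun_prop
  unfold normSq
  rw [← sum_integral_unit hn hi, ← sum_integral_unit hn (fun l => h _ _), empNormSq_eq,
    Finset.mul_sum, Finset.mul_sum, Finset.mul_sum, Finset.mul_sum, ← Finset.sum_add_distrib]
  refine Finset.sum_le_sum fun l _ => ?_
  set C := ∫ s in ((l : ℕ) / n : ℝ)..(((l : ℕ) + 1) / n), deriv f s ^ 2 with hC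
  have hb : ∀ t ∈ Set.Icc ((l : ℕ) / n : ℝ) (((l : ℕ) + 1) / n),
      f (designPoint n l) ^ 2 ≤ 2 * f t ^ 2 + 2 * ((1 / n) * C) := fun t ht => by
    have h2 : (f (designPoint n l) - f t) ^ 2 ≤ 1 / n * C := by
      have := sq_sub_le_of_mem_Icc hf h ht
      rwa [hlen] at this
    nlinarith [sq_nonneg (f (designPoint n l) - 2 * f t)]
  have := intervalIntegral.integral_mono_on (hle l) intervalIntegrable_const
    (((hi l).const_mul 2).add intervalIntegrable_const) hb
  rw [intervalIntegral.integral_add ((hi l).const_mul 2) intervalIntegrable_const,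
    intervalIntegral.integral_const_mul, intervalIntegral.integral_const,
    intervalIntegral.integral_const, hlen, smul_eq_mul, smul_eq_mul] at this
  refine this.trans (le_of_eq ?_)
  ring

/-! ### Moments of linear and quadratic forms of the noise -/

/-- `F` is integrable with mean `v`. -/
structure HasMean {Ω : Type*} [MeasurableSpace Ω] (p : Measure Ω) (F : Ω → ℝ) (v : ℝ) : Prop where
  int : Integrable F p
  eq : ∫ ω, F ω ∂p = v

section HasMean

variable {Ω : Type*} [MeasurableSpace Ω] {p : Measure Ω} {F G : Ω → ℝ} {v w : ℝ}

lemma HasMean.add (hF : HasMean p F v) (hG : HasMean p G w) :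
    HasMean p (fun ω => F ω + G ω) (v + w) :=
  ⟨hF.int.add hG.int, by rw [integral_add hF.int hG.int, hF.eq, hG.eq]⟩

lemma HasMean.sub (hF : HasMean p F v) (hG : HasMean p G w) :
    HasMean p (fun ω => F ω - G ω) (v - w) :=
  ⟨hF.int.sub hG.int, by rw [integral_sub hF.int hG.int, hF.eq, hG.eq]⟩

lemma HasMean.const_mul (hF : HasMean p F v) (a : ℝ) : HasMean p (fun ω => a * F ω) (a * v) :=
  ⟨hF.int.const_mul a, by rw [integral_const_mul, hF.eq]⟩

lemma HasMean.const [IsProbabilityMeasure p] (a : ℝ) : HasMean p (fun _ => a) a :=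
  ⟨integrable_const a, by simp⟩

lemma HasMean.sum {ι : Type*} (s : Finset ι) {F : ι → Ω → ℝ} {v : ι → ℝ}
    (h : ∀ i ∈ s, HasMean p (F i) (v i)) :
    HasMean p (fun ω => ∑ i ∈ s, F i ω) (∑ i ∈ s, v i) :=
  ⟨integrable_finsetSum s fun i hi => (h i hi).int, by
    rw [integral_finsetSum s fun i hi => (h i hi).int]
    exact Finset.sum_congr rfl fun i hi => (h i hi).eq⟩

lemma HasMean.congr (hF : HasMean p F v) (hFG : ∀ ω, G ω = F ω) (hvw : w = v) : HasMean p G w := by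
  rw [hvw, funext hFG]; exact hF

lemma HasMean.mul (hi : IndepFun F G p) (hF : HasMean p F v) (hG : HasMean p G w) :
    HasMean p (fun ω => F ω * G ω) (v * w) :=
  ⟨hi.integrable_mul hF.int hG.int, by
    rw [hi.integral_fun_mul_eq_mul_integral hF.int.aestronglyMeasurable
      hG.int.aestronglyMeasurable, hF.eq, hG.eq]⟩

end HasMean

section Noise

variable {n : ℕ} {c : ℝ} {p : Measure (Fin n → ℝ)}

/-- Dependence of F on the coordinates in s alone is expressed by invariance under setting the
others to zero. This drives the inductions that add one coordinate at a time. -/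
lemma IsNoiseLaw.indepFun_coord (h : IsNoiseLaw n c p) {s : Finset (Fin n)} {a : Fin n}
    (ha : a ∉ s) {u : ℝ → ℝ} (hu : Measurable u) {F : (Fin n → ℝ) → ℝ} (hF : Measurable F)
    (hFs : ∀ ξ, F (fun i => if i ∈ s then ξ i else 0) = F ξ) :
    IndepFun (fun ξ => u (ξ a)) F p := by
  have h1 := h.indep.indepFun_finset {a} s (by simpa using ha) (fun i => measurable_pi_apply i)
  have hφ : Measurable (fun z : ({a} : Finset (Fin n)) → ℝ => u (z ⟨a, by simp⟩)) :=
    hu.comp (measurable_pi_apply _)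
  have hψ : Measurable (fun z : s → ℝ => F (fun i => if hi : i ∈ s then z ⟨i, hi⟩ else 0)) := by
    refine hF.comp (measurable_pi_lambda _ fun i => ?_)
    by_cases hi : i ∈ s
    · simp only [hi, dif_pos]; exact measurable_pi_apply _
    · simp only [hi, dif_neg, not_false_eq_true]; exact measurable_const
  have h2 := h1.comp hφ hψ
  have e : ((fun z : s → ℝ => F (fun i => if hi : i ∈ s then z ⟨i, hi⟩ else 0)) ∘
      fun (ξ : Fin n → ℝ) (i : s) => ξ i) = F := by
    funext ξ
    simp only [Function.comp_apply, dite_eq_ite]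
    exact hFs ξ
  rw [e] at h2
  exact h2

lemma IsNoiseLaw.integrable_pow (h : IsNoiseLaw n c p) (a : Fin n) {m : ℕ} (hm : m ≤ 4) :
    Integrable (fun ξ : Fin n → ℝ => ξ a ^ m) p := by
  have := h.isProb
  have h4 : Integrable (fun ξ : Fin n → ℝ => ξ a ^ 4) p := by
    have := (h.memLp a).integrable_norm_pow (by norm_num)
    simpa [Even.pow_abs (show Even 4 by decide)] using this
  have h1 : Integrable (fun ξ : Fin n → ℝ => 1 + ξ a ^ 4) p := (integrable_const 1).add h4
  refine h1.mono' ((measurable_pi_apply a).pow_const m).aestronglyMeasurable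
    (Eventually.of_forall fun ξ => ?_)
  rw [Real.norm_eq_abs, abs_pow]
  have e : ξ a ^ 4 = |ξ a| ^ 4 := by rw [← abs_pow]; exact (abs_of_nonneg (by positivity)).symm
  rw [e]
  have h0 := abs_nonneg (ξ a)
  rcases le_total |ξ a| 1 with h2 | h2
  · have := pow_le_one₀ h0 h2 (n := m)
    nlinarith [pow_nonneg h0 4]
  · have := pow_le_pow_right₀ h2 hm
    linarith

/-- The linear form with coefficients `b`, restricted to the coordinates in `s`. -/
def linForm (s : Finset (Fin n)) (b : Fin n → ℝ) (ξ : Fin n → ℝ) : ℝ := ∑ l ∈ s, b l * ξ l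

lemma measurable_linForm (s : Finset (Fin n)) (b : Fin n → ℝ) : Measurable (linForm s b) := by
  unfold linForm
  exact Finset.measurable_sum _ fun l _ => (measurable_pi_apply l).const_mul _

lemma linForm_restrict (s : Finset (Fin n)) (b ξ : Fin n → ℝ) :
    linForm s b (fun i => if i ∈ s then ξ i else 0) = linForm s b ξ := by
  unfold linForm
  exact Finset.sum_congr rfl fun l hl => by simp [hl]

lemma IsNoiseLaw.memLp_two_coord (h : IsNoiseLaw n c p) (a : Fin n) :
    MemLp (fun ξ : Fin n → ℝ => ξ a) 2 p :=
  (memLp_two_iff_integrable_sq (measurable_pi_apply a).aestronglyMeasurable).mpr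
    (h.integrable_pow a (by norm_num))

lemma IsNoiseLaw.memLp_linForm (h : IsNoiseLaw n c p) (s : Finset (Fin n)) (b : Fin n → ℝ) :
    MemLp (linForm s b) 2 p := by
  have := memLp_finsetSum s (fun l _ => (h.memLp_two_coord l).const_mul (b l))
  exact this

lemma IsNoiseLaw.integral_linForm (h : IsNoiseLaw n c p) (s : Finset (Fin n)) (b : Fin n → ℝ) :
    ∫ ξ, linForm s b ξ ∂p = 0 := by
  have := h.isProb
  unfold linForm
  rw [integral_finsetSum _ fun l _ =>
    ((h.memLp_two_coord l).integrable (by norm_num)).const_mul (b l)]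
  refine Finset.sum_eq_zero fun l _ => ?_
  rw [integral_const_mul, h.centred, mul_zero]

lemma IsNoiseLaw.integral_linForm_sq (h : IsNoiseLaw n c p) (s : Finset (Fin n))
    (b : Fin n → ℝ) : ∫ ξ, linForm s b ξ ^ 2 ∂p = ∑ l ∈ s, b l ^ 2 := by
  have := h.isProb
  induction s using Finset.induction_on with
  | empty => simp [linForm]
  | insert a s ha ih =>
    have hL := h.memLp_linForm s b
    have hi := h.indepFun_coord ha measurable_id (measurable_linForm s b) (linForm_restrict s b)
    have m1 : HasMean p (fun ξ : Fin n → ℝ => ξ a) 0 :=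
      ⟨(h.memLp_two_coord a).integrable (by norm_num), h.centred a⟩
    have m2 : HasMean p (fun ξ : Fin n → ℝ => ξ a ^ 2) 1 :=
      ⟨h.integrable_pow a (by norm_num), h.unit_variance a⟩
    have mL : HasMean p (linForm s b) 0 := ⟨hL.integrable (by norm_num), h.integral_linForm s b⟩
    have mL2 : HasMean p (fun ξ => linForm s b ξ ^ 2) (∑ l ∈ s, b l ^ 2) := ⟨hL.integrable_sq, ih⟩
    have := ((m2.const_mul (b a ^ 2)).add ((HasMean.mul hi m1 mL).const_mul (2 * b a))).add mL2
    refine (this.congr (w := ∑ l ∈ insert a s, b l ^ 2) (fun ξ => ?_) ?_).eq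
    · unfold linForm
      rw [Finset.sum_insert ha]
      simp only [id]
      ring
    · rw [Finset.sum_insert ha]; ring

/-- The centred quadratic form with matrix `M`, restricted to the coordinates in `s`. -/
def quadForm (s : Finset (Fin n)) (M : Fin n → Fin n → ℝ) (ξ : Fin n → ℝ) : ℝ :=
  ∑ a ∈ s, ∑ b ∈ s, M a b * (ξ a * ξ b) - ∑ a ∈ s, M a a

lemma measurable_quadForm (s : Finset (Fin n)) (M : Fin n → Fin n → ℝ) :
    Measurable (quadForm s M) := by
  unfold quadForm
  refine Measurable.sub_const ?_ _
  exact Finset.measurable_sum _ fun a _ => Finset.measurable_sum _ fun b _ =>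
    ((measurable_pi_apply a).mul (measurable_pi_apply b)).const_mul _

lemma quadForm_restrict (s : Finset (Fin n)) (M : Fin n → Fin n → ℝ) (ξ : Fin n → ℝ) :
    quadForm s M (fun i => if i ∈ s then ξ i else 0) = quadForm s M ξ := by
  unfold quadForm
  congr 1
  exact Finset.sum_congr rfl fun a ha => Finset.sum_congr rfl fun b hb => by simp [ha, hb]

/-- The increment has a martingale structure: both added terms have conditional mean zero given the
coordinates in s. -/
lemma quadForm_insert {s : Finset (Fin n)} {a : Fin n} (ha : a ∉ s) (M : Fin n → Fin n → ℝ)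
    (ξ : Fin n → ℝ) :
    quadForm (insert a s) M ξ
      = quadForm s M ξ + ξ a * linForm s (fun b => M a b + M b a) ξ + M a a * (ξ a ^ 2 - 1) := by
  unfold quadForm linForm
  rw [Finset.sum_insert ha, Finset.sum_insert ha, Finset.sum_insert ha]
  simp_rw [Finset.sum_insert ha]
  rw [Finset.sum_add_distrib, Finset.mul_sum]
  have : ∑ l ∈ s, ξ a * ((M a l + M l a) * ξ l)
      = ∑ l ∈ s, M l a * (ξ l * ξ a) + ∑ l ∈ s, M a l * (ξ a * ξ l) := by
    rw [← Finset.sum_add_distrib]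
    exact Finset.sum_congr rfl fun l _ => by ring
  rw [this]
  ring

/-- In the square of the decomposition `quadForm_insert` all mixed terms have mean zero: ξ_a and
ξ_a² − 1 are centred and independent of Q and L, and the term with ξ_a³ − ξ_a carries the centred
factor L, so third moments play no role. What remains is Σ (M_ab + M_ba)² + M_aa² (E ξ_a⁴ − 1); the
inequality (x + y)² ≤ 2x² + 2y² accounts for the condition 2 ≤ c. -/
lemma IsNoiseLaw.quadForm_moments (h : IsNoiseLaw n c p) (hc : 2 ≤ c) (s : Finset (Fin n))
    (M : Fin n → Fin n → ℝ) :
    MemLp (quadForm s M) 2 p ∧ ∫ ξ, quadForm s M ξ ∂p = 0 ∧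
      ∫ ξ, quadForm s M ξ ^ 2 ∂p ≤ c * ∑ a ∈ s, ∑ b ∈ s, M a b ^ 2 := by
  have := h.isProb
  induction s using Finset.induction_on with
  | empty =>
    have : quadForm (∅ : Finset (Fin n)) M = fun _ => 0 := by funext ξ; simp [quadForm]
    rw [this]
    simp
  | insert a s ha ih =>
    obtain ⟨hQ, hQ0, hQ2⟩ := ih
    set Q := quadForm s M with hQdef
    set L := linForm s (fun b => M a b + M b a) with hLdef
    have hL : MemLp L 2 p := h.memLp_linForm s _
    have mQ : Measurable Q := measurable_quadForm s M
    have mL : Measurable L := measurable_linForm s _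
    have rQ : ∀ ξ, Q (fun i => if i ∈ s then ξ i else 0) = Q ξ := quadForm_restrict s M
    have rL : ∀ ξ, L (fun i => if i ∈ s then ξ i else 0) = L ξ := linForm_restrict s _
    have x1 : HasMean p (fun ξ : Fin n → ℝ => ξ a) 0 :=
      ⟨(h.memLp_two_coord a).integrable (by norm_num), h.centred a⟩
    have x2 : HasMean p (fun ξ : Fin n → ℝ => ξ a ^ 2) 1 :=
      ⟨h.integrable_pow a (by norm_num), h.unit_variance a⟩
    have x3 : HasMean p (fun ξ : Fin n → ℝ => ξ a ^ 3 - ξ a) _ :=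
      HasMean.sub ⟨h.integrable_pow a (by norm_num), rfl⟩ x1
    have x4 : HasMean p (fun ξ : Fin n → ℝ => ξ a ^ 4) _ := ⟨h.integrable_pow a le_rfl, rfl⟩
    have x21 : HasMean p (fun ξ : Fin n → ℝ => ξ a ^ 2 - 1) 0 :=
      (x2.sub (HasMean.const 1)).congr (fun _ => rfl) (by ring)
    have hQm : HasMean p Q 0 := ⟨hQ.integrable (by norm_num), hQ0⟩
    have hLm : HasMean p L 0 := ⟨hL.integrable (by norm_num), h.integral_linForm s _⟩
    have hQL : HasMean p (fun ξ => Q ξ * L ξ) _ := ⟨hQ.integrable_mul hL, rfl⟩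
    have hL2 : HasMean p (fun ξ => L ξ ^ 2) (∑ b ∈ s, (M a b + M b a) ^ 2) :=
      ⟨hL.integrable_sq, h.integral_linForm_sq s _⟩
    have hQQ : HasMean p (fun ξ => Q ξ ^ 2) _ := ⟨hQ.integrable_sq, rfl⟩
    have p1 := HasMean.mul (h.indepFun_coord ha (u := fun x => x) (by fun_prop) mL rL) x1 hLm
    have p2 := HasMean.mul (h.indepFun_coord ha (u := fun x => x ^ 2) (by fun_prop)
      (mL.pow_const 2) (fun ξ => by rw [rL])) x2 hL2
    have p3 := HasMean.mul (h.indepFun_coord ha (u := fun x => x) (by fun_prop)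
      (mQ.mul mL) (fun ξ => by rw [Pi.mul_apply, Pi.mul_apply, rL, rQ])) x1 hQL
    have p4 := HasMean.mul (h.indepFun_coord ha (u := fun x => x ^ 2 - 1) (by fun_prop) mQ rQ)
      x21 hQm
    have p5 := HasMean.mul (h.indepFun_coord ha (u := fun x => x ^ 3 - x) (by fun_prop) mL rL)
      x3 hLm
    have eQ := fun ξ => quadForm_insert ha M ξ
    have hsq := (((((hQQ.add p2).add (((x4.sub (x2.const_mul 2)).add
      (HasMean.const 1)).const_mul (M a a ^ 2))).add (p3.const_mul 2)).add
      (p4.const_mul (2 * M a a))).add (p5.const_mul (2 * M a a))).congr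
      (G := fun ξ => quadForm (insert a s) M ξ ^ 2)
      (w := ∫ ξ, Q ξ ^ 2 ∂p + ∑ b ∈ s, (M a b + M b a) ^ 2
            + M a a ^ 2 * (∫ ξ, ξ a ^ 4 ∂p - 1))
      (fun ξ => by rw [eQ, Pi.mul_apply, ← hQdef, ← hLdef]; ring) (by ring)
    have h1 := ((hQm.add p1).add (x21.const_mul (M a a))).congr
      (G := quadForm (insert a s) M) (w := 0) eQ (by ring)
    refine ⟨?_, h1.eq, ?_⟩
    · rw [memLp_two_iff_integrable_sq (measurable_quadForm _ M).aestronglyMeasurable]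
      exact hsq.int
    · rw [hsq.eq, Finset.sum_insert ha, Finset.sum_insert ha]
      simp_rw [Finset.sum_insert ha]
      rw [Finset.sum_add_distrib]
      have b1 : ∑ b ∈ s, (M a b + M b a) ^ 2
          ≤ c * (∑ b ∈ s, M a b ^ 2 + ∑ b ∈ s, M b a ^ 2) := by
        rw [← Finset.sum_add_distrib, Finset.mul_sum]
        refine Finset.sum_le_sum fun b _ => ?_
        nlinarith [sq_nonneg (M a b - M b a), sq_nonneg (M a b), sq_nonneg (M b a)]
      have b2 : M a a ^ 2 * (∫ ξ, ξ a ^ 4 ∂p - 1) ≤ c * M a a ^ 2 := by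
        nlinarith [h.fourth_moment a, sq_nonneg (M a a)]
      linarith

end Noise

/-! ### Weights -/

/-- Decreasing weights with values in `[0,1]`, supported in `[0, H]`. -/
structure IsWeight (H : ℝ) (lam : ℕ → ℝ) : Prop where
  nonneg : ∀ j, 0 ≤ lam j
  le_one : ∀ j, lam j ≤ 1
  anti : Antitone lam
  zero : ∀ j : ℕ, H < j → lam j = 0

lemma IsWeight.sq {H : ℝ} {lam : ℕ → ℝ} (h : IsWeight H lam) : IsWeight H (fun j => lam j ^ 2) where
  nonneg j := sq_nonneg _
  le_one j := pow_le_one₀ (h.nonneg j) (h.le_one j)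
  anti i j hij := pow_le_pow_left₀ (h.nonneg j) (h.anti hij) 2
  zero j hj := by simp [h.zero j hj]

lemma IsWeight.sum_le {H : ℝ} {lam : ℕ → ℝ} (h : IsWeight H lam) (hH : 0 ≤ H) (n : ℕ) :
    ∑ j ∈ Finset.Icc 1 n, lam j ≤ H := by
  have h1 : ∀ j ∈ Finset.Icc 1 n, lam j ≤ if j ∈ Finset.Icc 1 ⌊H⌋₊ then 1 else 0 := by
    intro j hj
    rw [Finset.mem_Icc] at hj
    split_ifs with hf
    · exact h.le_one j
    · refine (h.zero j ?_).le
      by_contra hlt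
      exact hf (Finset.mem_Icc.mpr ⟨hj.1, Nat.le_floor (not_lt.mp hlt)⟩)
  refine (Finset.sum_le_sum h1).trans ?_
  rw [Finset.sum_ite_mem, Finset.sum_const, nsmul_eq_mul, mul_one]
  have h2 : (Finset.Icc 1 n ∩ Finset.Icc 1 ⌊H⌋₊).card ≤ ⌊H⌋₊ := by
    refine (Finset.card_le_card Finset.inter_subset_right).trans ?_
    simp
  calc ((Finset.Icc 1 n ∩ Finset.Icc 1 ⌊H⌋₊).card : ℝ) ≤ ⌊H⌋₊ := by exact_mod_cast h2
    _ ≤ H := Nat.floor_le hH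

lemma IsWeight.sq_le {H : ℝ} {lam : ℕ → ℝ} (h : IsWeight H lam) (j : ℕ) : lam j ^ 2 ≤ lam j := by
  nlinarith [h.nonneg j, h.le_one j]

/-- The squares of the cosine and the sine of equal frequency add up to 2, so a pair contributes
only (λ(2m) − λ(2m+1)) cos(4πmx). For decreasing weights these differences are dominated by λ(2m−1)
− λ(2m+1), which telescopes; the bound depends neither on `n` nor on `H`. -/
lemma IsWeight.abs_sum_trigBasis_sq_sub_one_le {H : ℝ} {lam : ℕ → ℝ} (h : IsWeight H lam) {n : ℕ}
    (hn : Odd n) (x : ℝ) :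
    |∑ j ∈ Finset.Icc 1 n, lam j * (trigBasis j x ^ 2 - 1)| ≤ 1 := by
  obtain ⟨q, rfl⟩ := hn
  have h2 : √2 ^ 2 = (2 : ℝ) := Real.sq_sqrt (by norm_num)
  have hpair : ∀ m ∈ Finset.Icc 1 q, |lam (2 * m) * (trigBasis (2 * m) x ^ 2 - 1)
      + lam (2 * m + 1) * (trigBasis (2 * m + 1) x ^ 2 - 1)|
      ≤ lam (2 * m - 1) - lam (2 * m + 1) := by
    intro m hm
    have hm1 := (Finset.mem_Icc.mp hm).1
    rw [trigBasis_even, trigBasis_odd hm1, mul_pow, mul_pow, h2]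
    set u := Real.cos (2 * Real.pi * m * x) with hu
    set w := Real.sin (2 * Real.pi * m * x) with hw
    have huw : u ^ 2 + w ^ 2 = 1 := Real.cos_sq_add_sin_sq _
    have e : lam (2 * m) * (2 * u ^ 2 - 1) + lam (2 * m + 1) * (2 * w ^ 2 - 1)
        = (lam (2 * m) - lam (2 * m + 1)) * (2 * u ^ 2 - 1) := by
      linear_combination 2 * lam (2 * m + 1) * huw
    have a1 : 0 ≤ lam (2 * m) - lam (2 * m + 1) := sub_nonneg.mpr (h.anti (by omega))
    have a2 : |2 * u ^ 2 - 1| ≤ 1 := by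
      rw [abs_le]; constructor <;> nlinarith [sq_nonneg u, sq_nonneg w]
    have a3 : lam (2 * m) ≤ lam (2 * m - 1) := h.anti (by omega)
    rw [e, abs_mul, abs_of_nonneg a1]
    calc _ ≤ (lam (2 * m) - lam (2 * m + 1)) * 1 := mul_le_mul_of_nonneg_left a2 a1
      _ ≤ _ := by linarith
  have htel : ∀ q : ℕ, ∑ m ∈ Finset.Icc 1 q, (lam (2 * m - 1) - lam (2 * m + 1))
      = lam 1 - lam (2 * q + 1) := by
    intro q
    induction q with
    | zero => simp
    | succ q ih =>
      rw [Finset.sum_Icc_succ_top (by omega), ih]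
      have : 2 * (q + 1) - 1 = 2 * q + 1 := by omega
      rw [this]; ring
  rw [sum_Icc_one_pairs]
  simp only [trigBasis_one, one_pow, sub_self, mul_zero, zero_add]
  refine (Finset.abs_sum_le_sum_abs _ _).trans ((Finset.sum_le_sum hpair).trans ?_)
  rw [htel]
  linarith [h.le_one 1, h.nonneg (2 * q + 1)]

/-! ### The noise in Fourier coordinates -/

/-- The empirical Fourier coefficients of the noise. -/
noncomputable def noiseCoef (n : ℕ) (σ ξ : Fin n → ℝ) (j : ℕ) : ℝ := thetaHat n (fun l => σ l * ξ l) j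

/-- The variances of the empirical Fourier coefficients of the noise. -/
noncomputable def noiseVar (n : ℕ) (σ : Fin n → ℝ) (j : ℕ) : ℝ :=
  (1 / (n : ℝ)) ^ 2 * ∑ l, σ l ^ 2 * trigBasis j (designPoint n l) ^ 2

/-- The mean of the variances of the empirical Fourier coefficients of the noise. -/
noncomputable def meanVar (n : ℕ) (σ : Fin n → ℝ) : ℝ := (1 / (n : ℝ)) ^ 2 * ∑ l, σ l ^ 2

section Coef

variable {n : ℕ} {c V : ℝ} {p : Measure (Fin n → ℝ)} {σ : Fin n → ℝ}

lemma noiseVar_nonneg (j : ℕ) : 0 ≤ noiseVar n σ j := by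
  unfold noiseVar; positivity

lemma meanVar_nonneg : 0 ≤ meanVar n σ := by
  unfold meanVar; positivity

lemma noiseVar_le (hn : 0 < n) (hσ : ∀ l, σ l ^ 2 ≤ V) (j : ℕ) : noiseVar n σ j ≤ 2 * V / n := by
  have hn' : (0 : ℝ) < n := by exact_mod_cast hn
  have h1 : ∑ l, σ l ^ 2 * trigBasis j (designPoint n l) ^ 2 ≤ ∑ _l : Fin n, V * 2 :=
    Finset.sum_le_sum fun l _ => mul_le_mul (hσ l) (trigBasis_sq_le _ _) (sq_nonneg _)
      ((sq_nonneg _).trans (hσ l))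
  rw [Finset.sum_const, Finset.card_univ, Fintype.card_fin, nsmul_eq_mul] at h1
  unfold noiseVar
  calc _ ≤ (1 / (n : ℝ)) ^ 2 * (n * (V * 2)) := mul_le_mul_of_nonneg_left h1 (sq_nonneg _)
    _ = _ := by field_simp

lemma le_meanVar {v : ℝ} (hn : 0 < n) (hσ : ∀ l, v ≤ σ l ^ 2) : v / n ≤ meanVar n σ := by
  have hn' : (0 : ℝ) < n := by exact_mod_cast hn
  have h1 : ∑ _l : Fin n, v ≤ ∑ l, σ l ^ 2 := Finset.sum_le_sum fun l _ => hσ l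
  rw [Finset.sum_const, Finset.card_univ, Fintype.card_fin, nsmul_eq_mul] at h1
  unfold meanVar
  calc v / n = (1 / (n : ℝ)) ^ 2 * (n * v) := by field_simp
    _ ≤ _ := mul_le_mul_of_nonneg_left h1 (sq_nonneg _)

/-- This handles unequal variances. A single coefficient variance may differ from the mean variance
by order 1/n, but averaging `IsWeight.abs_sum_trigBasis_sq_sub_one_le` over the design with masses
σ_l² shows that a whole weighted sum of these differences is no larger. -/
lemma IsWeight.abs_sum_noiseVar_sub_le {H : ℝ} {lam : ℕ → ℝ} (h : IsWeight H lam) (hn : Odd n)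
    (hσ : ∀ l, σ l ^ 2 ≤ V) :
    |∑ j ∈ Finset.Icc 1 n, lam j * (noiseVar n σ j - meanVar n σ)| ≤ V / n := by
  have hn' : (0 : ℝ) < n := by exact_mod_cast hn.pos
  have e : ∑ j ∈ Finset.Icc 1 n, lam j * (noiseVar n σ j - meanVar n σ)
      = (1 / (n : ℝ)) ^ 2 * ∑ l, σ l ^ 2
        * ∑ j ∈ Finset.Icc 1 n, lam j * (trigBasis j (designPoint n l) ^ 2 - 1) := by
    unfold noiseVar meanVar
    simp_rw [Finset.mul_sum]
    rw [Finset.sum_comm]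
    refine Finset.sum_congr rfl fun j _ => ?_
    rw [← Finset.sum_sub_distrib, Finset.mul_sum]
    exact Finset.sum_congr rfl fun l _ => by ring
  rw [e, abs_mul, abs_of_nonneg (sq_nonneg (1 / (n : ℝ)))]
  have h1 : |∑ l, σ l ^ 2 * ∑ j ∈ Finset.Icc 1 n, lam j * (trigBasis j (designPoint n l) ^ 2 - 1)|
      ≤ ∑ _l : Fin n, V := by
    refine (Finset.abs_sum_le_sum_abs _ _).trans (Finset.sum_le_sum fun l _ => ?_)
    rw [abs_mul, abs_of_nonneg (sq_nonneg _)]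
    calc _ ≤ σ l ^ 2 * 1 := mul_le_mul_of_nonneg_left
          (h.abs_sum_trigBasis_sq_sub_one_le hn _) (sq_nonneg _)
      _ ≤ V := by linarith [hσ l]
  rw [Finset.sum_const, Finset.card_univ, Fintype.card_fin, nsmul_eq_mul] at h1
  calc _ ≤ (1 / (n : ℝ)) ^ 2 * (n * V) := mul_le_mul_of_nonneg_left h1 (sq_nonneg _)
    _ = _ := by field_simp

lemma sum_mul_noiseCoef (s : Finset ℕ) (b : ℕ → ℝ) (ξ : Fin n → ℝ) :
    ∑ j ∈ s, b j * noiseCoef n σ ξ j = linForm Finset.univ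
      (fun l => 1 / (n : ℝ) * (σ l * ∑ j ∈ s, b j * trigBasis j (designPoint n l))) ξ := by
  unfold noiseCoef linForm
  simp_rw [thetaHat_eq, Finset.mul_sum, Finset.sum_mul]
  rw [Finset.sum_comm]
  exact Finset.sum_congr rfl fun l _ => Finset.sum_congr rfl fun j _ => by ring

/-- Linear statistics of the noise coefficients. -/
lemma IsNoiseLaw.noise_linear (h : IsNoiseLaw n c p) (hn : Odd n) (hσ : ∀ l, σ l ^ 2 ≤ V)
    (b : ℕ → ℝ) :
    HasMean p (fun ξ => ∑ j ∈ Finset.Icc 1 n, b j * noiseCoef n σ ξ j) 0 ∧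
      ∃ v ≤ V / n * ∑ j ∈ Finset.Icc 1 n, b j ^ 2,
        HasMean p (fun ξ => (∑ j ∈ Finset.Icc 1 n, b j * noiseCoef n σ ξ j) ^ 2) v := by
  have hn' : (0 : ℝ) < n := by exact_mod_cast hn.pos
  have := h.isProb
  simp_rw [sum_mul_noiseCoef]
  refine ⟨⟨(h.memLp_linForm _ _).integrable (by norm_num), h.integral_linForm _ _⟩, _, ?_,
    ⟨(h.memLp_linForm _ _).integrable_sq, h.integral_linForm_sq _ _⟩⟩
  calc _ ≤ ∑ l : Fin n, (1 / (n : ℝ)) ^ 2 * V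
          * (∑ j ∈ Finset.Icc 1 n, b j * trigBasis j (designPoint n l)) ^ 2 :=
        Finset.sum_le_sum fun l _ => by
          rw [mul_pow, mul_pow, mul_assoc ((1 / (n : ℝ)) ^ 2)]
          gcongr
          exact hσ l
    _ = _ := by
      rw [← Finset.mul_sum, sum_sq_sum_trigBasis hn]
      field_simp

lemma IsNoiseLaw.hasMean_noiseCoef_sq (h : IsNoiseLaw n c p) (j : ℕ) :
    HasMean p (fun ξ => noiseCoef n σ ξ j ^ 2) (noiseVar n σ j) := by
  have := h.isProb
  have e : ∀ ξ, noiseCoef n σ ξ j = linForm Finset.univ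
      (fun l => 1 / (n : ℝ) * (σ l * trigBasis j (designPoint n l))) ξ := fun ξ => by
    unfold noiseCoef linForm
    rw [thetaHat_eq, Finset.mul_sum]
    exact Finset.sum_congr rfl fun l _ => by ring
  simp_rw [e]
  refine ⟨(h.memLp_linForm _ _).integrable_sq, ?_⟩
  rw [h.integral_linForm_sq, noiseVar, Finset.mul_sum]
  exact Finset.sum_congr rfl fun l _ => by ring

lemma sum_mul_noiseCoef_sq_sub (b : ℕ → ℝ) (ξ : Fin n → ℝ) :
    ∑ j ∈ Finset.Icc 1 n, b j * (noiseCoef n σ ξ j ^ 2 - noiseVar n σ j)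
      = quadForm Finset.univ (fun l m => (1 / (n : ℝ)) ^ 2 * (σ l * σ m
        * ∑ j ∈ Finset.Icc 1 n, b j * trigBasis j (designPoint n l)
          * trigBasis j (designPoint n m))) ξ := by
  have e1 : ∀ j, noiseCoef n σ ξ j ^ 2 = ∑ l, ∑ m, (1 / (n : ℝ)) ^ 2 * (σ l * σ m
      * (trigBasis j (designPoint n l) * trigBasis j (designPoint n m)) * (ξ l * ξ m)) := by
    intro j
    unfold noiseCoef
    rw [thetaHat_eq, mul_pow, sq (∑ l, _), Finset.sum_mul_sum, Finset.mul_sum]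
    refine Finset.sum_congr rfl fun l _ => ?_
    rw [Finset.mul_sum]
    exact Finset.sum_congr rfl fun m _ => by ring
  unfold quadForm
  simp_rw [mul_sub, Finset.sum_sub_distrib]
  congr 1
  · simp_rw [e1, Finset.mul_sum, Finset.sum_mul]
    rw [Finset.sum_comm]
    refine Finset.sum_congr rfl fun l _ => ?_
    rw [Finset.sum_comm]
    exact Finset.sum_congr rfl fun m _ => Finset.sum_congr rfl fun j _ => by ring
  · unfold noiseVar
    simp_rw [Finset.mul_sum]
    rw [Finset.sum_comm]
    exact Finset.sum_congr rfl fun m _ => Finset.sum_congr rfl fun j _ => by ring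

/-- Quadratic statistics of the noise coefficients. -/
lemma IsNoiseLaw.noise_quadratic (h : IsNoiseLaw n c p) (hc : 2 ≤ c) (hn : Odd n)
    (hσ : ∀ l, σ l ^ 2 ≤ V) (b : ℕ → ℝ) :
    HasMean p (fun ξ => ∑ j ∈ Finset.Icc 1 n, b j * (noiseCoef n σ ξ j ^ 2 - noiseVar n σ j)) 0 ∧
      ∃ v ≤ c * V ^ 2 / n ^ 2 * ∑ j ∈ Finset.Icc 1 n, b j ^ 2,
        HasMean p (fun ξ =>
          (∑ j ∈ Finset.Icc 1 n, b j * (noiseCoef n σ ξ j ^ 2 - noiseVar n σ j)) ^ 2) v := by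
  have hn' : (0 : ℝ) < n := by exact_mod_cast hn.pos
  have := h.isProb
  simp_rw [sum_mul_noiseCoef_sq_sub]
  obtain ⟨h1, h2, h3⟩ := h.quadForm_moments hc Finset.univ
    (fun l m => (1 / (n : ℝ)) ^ 2 * (σ l * σ m
        * ∑ j ∈ Finset.Icc 1 n, b j * trigBasis j (designPoint n l)
          * trigBasis j (designPoint n m)))
  refine ⟨⟨h1.integrable (by norm_num), h2⟩, _, ?_, ⟨h1.integrable_sq, rfl⟩⟩
  refine h3.trans ?_
  have hV : 0 ≤ V := (sq_nonneg _).trans (hσ ⟨0, hn.pos⟩)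
  have h4 : ∀ l m : Fin n, ((1 / (n : ℝ)) ^ 2 * (σ l * σ m
        * ∑ j ∈ Finset.Icc 1 n, b j * trigBasis j (designPoint n l)
          * trigBasis j (designPoint n m))) ^ 2
      ≤ (1 / (n : ℝ)) ^ 4 * V ^ 2 * (∑ j ∈ Finset.Icc 1 n, b j * trigBasis j (designPoint n l)
          * trigBasis j (designPoint n m)) ^ 2 := fun l m => by
    have : σ l ^ 2 * σ m ^ 2 ≤ V ^ 2 := by
      rw [sq V]; exact mul_le_mul (hσ l) (hσ m) (sq_nonneg _) hV
    calc _ = (1 / (n : ℝ)) ^ 4 * (σ l ^ 2 * σ m ^ 2) * (∑ j ∈ Finset.Icc 1 n,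
          b j * trigBasis j (designPoint n l) * trigBasis j (designPoint n m)) ^ 2 := by ring
      _ ≤ _ := by gcongr
  -- Orthogonality is used twice, over m for fixed l and then over l for fixed j; it reduces the
  -- Frobenius norm to n² Σ b_j².
  calc _ ≤ c * ∑ l : Fin n, ∑ m : Fin n, (1 / (n : ℝ)) ^ 4 * V ^ 2 * (∑ j ∈ Finset.Icc 1 n,
          b j * trigBasis j (designPoint n l) * trigBasis j (designPoint n m)) ^ 2 := by
        gcongr
        exact h4 _ _
    _ = c * ((1 / (n : ℝ)) ^ 4 * V ^ 2 * ∑ l : Fin n, n * ∑ j ∈ Finset.Icc 1 n,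
          (b j * trigBasis j (designPoint n l)) ^ 2) := by
        simp_rw [← Finset.mul_sum]
        congr 2
        rw [Finset.mul_sum]
        exact Finset.sum_congr rfl fun l _ => sum_sq_sum_trigBasis hn _
    _ = c * ((1 / (n : ℝ)) ^ 4 * V ^ 2 * (n * (n * ∑ j ∈ Finset.Icc 1 n, b j ^ 2))) := by
        rw [← Finset.mul_sum, Finset.sum_comm]
        congr 3
        rw [Finset.mul_sum]
        refine Finset.sum_congr rfl fun j hj => ?_
        simp_rw [mul_pow, ← Finset.mul_sum]
        have := sum_trigBasis_mul_trigBasis hn hj hj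
        simp only [← sq, if_true] at this
        rw [this]; ring
    _ = _ := by field_simp

end Coef

/-! ### A pathwise oracle inequality -/

/-- The arithmetic–geometric mean inequality without square roots. Afterwards q is absorbed on the
left of the oracle inequality and U/δ goes into the remainder. -/
lemma two_mul_abs_le_of_sq_le {T U q δ : ℝ} (hδ : 0 < δ) (hU : 0 ≤ U) (hq : 0 ≤ q)
    (h : T ^ 2 ≤ U * q) : 2 * |T| ≤ δ * q + U / δ := by
  have h1 : 0 ≤ δ * q + U / δ := by positivity
  have h2 : (2 * |T|) ^ 2 ≤ (δ * q + U / δ) ^ 2 := by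
    have e : (δ * q + U / δ) ^ 2 = (δ * q - U / δ) ^ 2 + 4 * (U * q) := by field_simp; ring
    rw [mul_pow, sq_abs, e]
    nlinarith only [sq_nonneg (δ * q - U / δ), h]
  exact (abs_le_of_sq_le_sq' h2 h1).2

/-- The loss of the weights `lam` in Fourier coordinates. -/
def coordLoss (I : Finset ℕ) (θ η lam : ℕ → ℝ) : ℝ :=
  ∑ j ∈ I, (lam j * (θ j + η j) - θ j) ^ 2

/-- The penalised cost of the weights `lam` in Fourier coordinates. -/
def coordCost (I : Finset ℕ) (θ η : ℕ → ℝ) (z ρ : ℝ) (lam : ℕ → ℝ) : ℝ :=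
  ∑ j ∈ I, lam j ^ 2 * (θ j + η j) ^ 2 - 2 * ∑ j ∈ I, lam j * ((θ j + η j) ^ 2 - z)
    + ρ * (z * ∑ j ∈ I, lam j ^ 2)

section Pathwise

variable {I : Finset ℕ} {θ η v lam lam₀ : ℕ → ℝ} {z z₀ ρ : ℝ}

/-- The identity holds for every value of z. Subtracting it for two weight vectors cancels Σ θ_j²,
and comparing costs becomes comparing losses up to statistics linear in the weights and the penalty.
-/
lemma coordLoss_eq : coordLoss I θ η lam = coordCost I θ η z ρ lam
    + 2 * ∑ j ∈ I, lam j * (θ j * η j + η j ^ 2 - z) + ∑ j ∈ I, θ j ^ 2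
    - ρ * (z * ∑ j ∈ I, lam j ^ 2) := by
  unfold coordLoss coordCost
  have : ∑ j ∈ I, (lam j * (θ j + η j) - θ j) ^ 2
      = ∑ j ∈ I, lam j ^ 2 * (θ j + η j) ^ 2 - 2 * ∑ j ∈ I, lam j * ((θ j + η j) ^ 2 - z)
        + 2 * ∑ j ∈ I, lam j * (θ j * η j + η j ^ 2 - z) + ∑ j ∈ I, θ j ^ 2 := by
    rw [Finset.mul_sum, Finset.mul_sum, ← Finset.sum_sub_distrib, ← Finset.sum_add_distrib,
      ← Finset.sum_add_distrib]
    exact Finset.sum_congr rfl fun j _ => by ring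
  rw [this]; ring

/-- The error in coordinate j is λη − (1 − λ)θ. Bounding the bias by the random loss itself, rather
than by its mean, lets the quadratic form of the cross term be absorbed pathwise. -/
lemma sum_one_sub_sq_mul_le : ∑ j ∈ I, ((1 - lam j) * θ j) ^ 2
    ≤ 2 * coordLoss I θ η lam + 2 * ∑ j ∈ I, lam j ^ 2 * η j ^ 2 := by
  unfold coordLoss
  rw [Finset.mul_sum, Finset.mul_sum, ← Finset.sum_add_distrib]
  refine Finset.sum_le_sum fun j _ => ?_
  nlinarith only [sq_nonneg ((lam j * (θ j + η j) - θ j) + lam j * η j)]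

/-- The centred part is bounded by `two_mul_abs_le_of_sq_le` with δ = 1/N, the same order as the
variances v, so both parts become multiples of (Σ λ²)/N, which the penalty can absorb. -/
lemma sum_sq_mul_sq_le {N V U : ℝ} (hN : 0 < N) (hU : 0 ≤ U)
    (hv : ∀ j ∈ I, v j ≤ 2 * V / N)
    (h01 : ∀ j, 0 ≤ lam j ∧ lam j ≤ 1)
    (hT : (∑ j ∈ I, lam j ^ 2 * (η j ^ 2 - v j)) ^ 2 ≤ U * ∑ j ∈ I, (lam j ^ 2) ^ 2) :
    ∑ j ∈ I, lam j ^ 2 * η j ^ 2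
      ≤ (1 / 2 + 2 * V) / N * ∑ j ∈ I, lam j ^ 2 + N * U / 2 := by
  have h1 : ∑ j ∈ I, (lam j ^ 2) ^ 2 ≤ ∑ j ∈ I, lam j ^ 2 := Finset.sum_le_sum fun j _ => by
    have := pow_le_one₀ (n := 2) (h01 j).1 (h01 j).2
    nlinarith only [sq_nonneg (lam j), this]
  have h2 := two_mul_abs_le_of_sq_le (δ := 1 / N) (by positivity) hU
    (Finset.sum_nonneg fun j _ => sq_nonneg _) (hT.trans (mul_le_mul_of_nonneg_left h1 hU))
  have h3 := le_abs_self (∑ j ∈ I, lam j ^ 2 * (η j ^ 2 - v j))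
  have h4 : ∑ j ∈ I, lam j ^ 2 * v j ≤ ∑ j ∈ I, lam j ^ 2 * (2 * V / N) :=
    Finset.sum_le_sum fun j hj => mul_le_mul_of_nonneg_left (hv j hj) (sq_nonneg _)
  rw [← Finset.sum_mul] at h4
  have h5 : ∑ j ∈ I, lam j ^ 2 * η j ^ 2
      = ∑ j ∈ I, lam j ^ 2 * (η j ^ 2 - v j) + ∑ j ∈ I, lam j ^ 2 * v j := by
    rw [← Finset.sum_add_distrib]
    exact Finset.sum_congr rfl fun j _ => by ring
  rw [h5]
  have e : U / (1 / N) = N * U := by field_simp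
  have e2 : (1 / 2 + 2 * V) / N * ∑ j ∈ I, lam j ^ 2
      = (1 / N * ∑ j ∈ I, lam j ^ 2) / 2 + (∑ j ∈ I, lam j ^ 2) * (2 * V / N) := by ring
  rw [e] at h2
  rw [e2]
  linarith

/-- A pathwise oracle inequality for a minimiser of the penalised cost. -/
lemma coordLoss_oracle {N V v₀ H δ K U₁ U₂ U₃ D : ℝ} (hN : 0 < N)
    (hJ : coordCost I θ η z ρ lam ≤ coordCost I θ η z ρ lam₀)
    (h01 : ∀ j, 0 ≤ lam j ∧ lam j ≤ 1) (h01' : ∀ j, 0 ≤ lam₀ j ∧ lam₀ j ≤ 1)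
    (hH : ∑ j ∈ I, lam j ≤ H) (hH' : ∑ j ∈ I, lam₀ j ≤ H)
    (hv : ∀ j ∈ I, v j ≤ 2 * V / N)
    (hK : |∑ j ∈ I, lam j * (v j - z₀)| ≤ K) (hK' : |∑ j ∈ I, lam₀ j * (v j - z₀)| ≤ K)
    (hρ : 0 ≤ ρ) (hρ1 : ρ ≤ 1) (hδ : 0 < δ) (hδρ : δ * (4 + 8 * V) ≤ ρ * v₀) (hz₀ : v₀ / N ≤ z₀)
    (hD : |z - z₀| ≤ D) (hU₁ : 0 ≤ U₁) (hU₂ : 0 ≤ U₂) (hU₃ : 0 ≤ U₃)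
    (hT₁ : (∑ j ∈ I, (lam j - lam₀ j) * θ j * η j) ^ 2
      ≤ U₁ * ∑ j ∈ I, ((lam j - lam₀ j) * θ j) ^ 2)
    (hT₂ : (∑ j ∈ I, (lam j - lam₀ j) * (η j ^ 2 - v j)) ^ 2
      ≤ U₂ * ∑ j ∈ I, (lam j - lam₀ j) ^ 2)
    (hT₃ : (∑ j ∈ I, lam j ^ 2 * (η j ^ 2 - v j)) ^ 2 ≤ U₃ * ∑ j ∈ I, (lam j ^ 2) ^ 2)
    (hT₃' : (∑ j ∈ I, lam₀ j ^ 2 * (η j ^ 2 - v j)) ^ 2 ≤ U₃ * ∑ j ∈ I, (lam₀ j ^ 2) ^ 2) :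
    (1 - 4 * δ) * coordLoss I θ η lam ≤ (1 + 4 * δ) * coordLoss I θ η lam₀
      + (U₁ / δ + N * U₂ / δ + 4 * δ * (N * U₃) + 4 * K + 4 * H * D
        + 2 * ρ * (z₀ * ∑ j ∈ I, lam₀ j ^ 2)) := by
  have e1 := coordLoss_eq (I := I) (θ := θ) (η := η) (lam := lam) (z := z) (ρ := ρ)
  have e0 := coordLoss_eq (I := I) (θ := θ) (η := η) (lam := lam₀) (z := z) (ρ := ρ)
  set E := coordLoss I θ η lam with hE
  set E₀ := coordLoss I θ η lam₀ with hE₀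
  set A := ∑ j ∈ I, lam j ^ 2 with hA
  set A₀ := ∑ j ∈ I, lam₀ j ^ 2 with hA₀
  have A0 : 0 ≤ A := Finset.sum_nonneg fun j _ => sq_nonneg _
  have A00 : 0 ≤ A₀ := Finset.sum_nonneg fun j _ => sq_nonneg _
  have AH : A ≤ H := (Finset.sum_le_sum fun j _ => by
    nlinarith only [(h01 j).1, (h01 j).2]).trans hH
  have AH' : A₀ ≤ H := (Finset.sum_le_sum fun j _ => by
    nlinarith only [(h01' j).1, (h01' j).2]).trans hH'
  have D0 : 0 ≤ D := (abs_nonneg _).trans hD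
  have hsplit : ∑ j ∈ I, lam j * (θ j * η j + η j ^ 2 - z)
      - ∑ j ∈ I, lam₀ j * (θ j * η j + η j ^ 2 - z)
      = ∑ j ∈ I, (lam j - lam₀ j) * θ j * η j + ∑ j ∈ I, (lam j - lam₀ j) * (η j ^ 2 - v j)
        + (∑ j ∈ I, lam j * (v j - z₀) - ∑ j ∈ I, lam₀ j * (v j - z₀))
        + (z₀ - z) * (∑ j ∈ I, lam j - ∑ j ∈ I, lam₀ j) := by
    rw [← Finset.sum_sub_distrib, ← Finset.sum_sub_distrib, ← Finset.sum_sub_distrib,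
      Finset.mul_sum, ← Finset.sum_add_distrib, ← Finset.sum_add_distrib, ← Finset.sum_add_distrib]
    exact Finset.sum_congr rfl fun j _ => by ring
  -- The cross term is split with parameter δ because its quadratic form is comparable with the
  -- losses plus noise terms; the centred squares are split with δ/N because theirs must be absorbed
  -- by the penalty, which is of order ρ/N times Σ λ².
  have b1 := two_mul_abs_le_of_sq_le hδ hU₁ (Finset.sum_nonneg fun j _ => sq_nonneg _) hT₁
  have b2 := two_mul_abs_le_of_sq_le (div_pos hδ hN) hU₂
    (Finset.sum_nonneg fun j _ => sq_nonneg _) hT₂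
  have w1 := sum_sq_mul_sq_le hN hU₃ hv h01 hT₃
  have w0 := sum_sq_mul_sq_le hN hU₃ hv h01' hT₃'
  have s1 := sum_one_sub_sq_mul_le (I := I) (θ := θ) (η := η) (lam := lam)
  have s0 := sum_one_sub_sq_mul_le (I := I) (θ := θ) (η := η) (lam := lam₀)
  have hx : ∑ j ∈ I, ((lam j - lam₀ j) * θ j) ^ 2
      ≤ 2 * ∑ j ∈ I, ((1 - lam j) * θ j) ^ 2 + 2 * ∑ j ∈ I, ((1 - lam₀ j) * θ j) ^ 2 := by
    rw [Finset.mul_sum, Finset.mul_sum, ← Finset.sum_add_distrib]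
    refine Finset.sum_le_sum fun j _ => ?_
    nlinarith only [sq_nonneg ((1 - lam j) * θ j + (1 - lam₀ j) * θ j)]
  have hx2 : ∑ j ∈ I, (lam j - lam₀ j) ^ 2 ≤ 2 * A + 2 * A₀ := by
    rw [hA, hA₀, Finset.mul_sum, Finset.mul_sum, ← Finset.sum_add_distrib]
    refine Finset.sum_le_sum fun j _ => ?_
    nlinarith only [sq_nonneg (lam j + lam₀ j)]
  have hsum : |∑ j ∈ I, lam j - ∑ j ∈ I, lam₀ j| ≤ H := by
    have p1 : 0 ≤ ∑ j ∈ I, lam j := Finset.sum_nonneg fun j _ => (h01 j).1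
    have p2 : 0 ≤ ∑ j ∈ I, lam₀ j := Finset.sum_nonneg fun j _ => (h01' j).1
    rw [abs_le]; constructor <;> linarith only [p1, p2, hH, hH']
  have H0 : 0 ≤ H := (abs_nonneg _).trans hsum
  have b3 : (z₀ - z) * (∑ j ∈ I, lam j - ∑ j ∈ I, lam₀ j) ≤ D * H := by
    refine (le_abs_self _).trans ?_
    rw [abs_mul, abs_sub_comm]
    exact mul_le_mul hD hsum (abs_nonneg _) D0
  set X := ∑ j ∈ I, ((lam j - lam₀ j) * θ j) ^ 2 with hX
  have hX2 : X ≤ 4 * E + 4 * E₀ + 4 * ((1 / 2 + 2 * V) / N * A + N * U₃ / 2)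
      + 4 * ((1 / 2 + 2 * V) / N * A₀ + N * U₃ / 2) := by
    linarith only [hx, s1, s0, w1, w0]
  have hδX := mul_le_mul_of_nonneg_left hX2 hδ.le
  have hδX2 := mul_le_mul_of_nonneg_left hx2 (div_pos hδ hN).le
  have eU : U₂ / (δ / N) = N * U₂ / δ := by field_simp
  rw [eU] at b2
  -- Origin of 4 + 8V: the cross term contributes 4(1/2 + 2V) through `hX2` and the centred squares
  -- contribute 2 through `hx2`. For the selected weights the total is cancelled by the penalty; for
  -- λ₀ it joins the penalty in the remainder.
  have pen : δ * (4 + 8 * V) / N * (A + A₀) ≤ ρ * z₀ * (A + A₀) := by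
    refine mul_le_mul_of_nonneg_right ?_ (by linarith)
    calc δ * (4 + 8 * V) / N ≤ ρ * v₀ / N := by gcongr
      _ = ρ * (v₀ / N) := by ring
      _ ≤ _ := mul_le_mul_of_nonneg_left hz₀ hρ
  have z1 : ρ * ((z₀ - z) * A) ≤ D * H := by
    have : (z₀ - z) * A ≤ D * H := by
      refine mul_le_mul ?_ AH A0 D0
      linarith [(abs_le.mp hD).1]
    have h5 := mul_le_mul_of_nonneg_left this hρ
    nlinarith only [mul_nonneg D0 H0, h5, hρ1]
  have z2 : ρ * ((z - z₀) * A₀) ≤ D * H := by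
    have : (z - z₀) * A₀ ≤ D * H := by
      refine mul_le_mul ?_ AH' A00 D0
      linarith [(abs_le.mp hD).2]
    have h5 := mul_le_mul_of_nonneg_left this hρ
    nlinarith only [mul_nonneg D0 H0, h5, hρ1]
  have t1 := le_abs_self (∑ j ∈ I, (lam j - lam₀ j) * θ j * η j)
  have t2 := le_abs_self (∑ j ∈ I, (lam j - lam₀ j) * (η j ^ 2 - v j))
  have k1 := (abs_le.mp hK).2
  have k0 := (abs_le.mp hK').1
  have epen : δ * (4 + 8 * V) / N * (A + A₀)
      = δ * (4 * ((1 / 2 + 2 * V) / N * A) + 4 * ((1 / 2 + 2 * V) / N * A₀))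
        + δ / N * (2 * A + 2 * A₀) := by field_simp; ring
  rw [epen] at pen
  have hmain : E - E₀ ≤ 2 * (∑ j ∈ I, lam j * (θ j * η j + η j ^ 2 - z)
      - ∑ j ∈ I, lam₀ j * (θ j * η j + η j ^ 2 - z)) - ρ * (z * A) + ρ * (z * A₀) := by
    rw [e1, e0]; linarith
  rw [hsplit] at hmain
  linarith

end Pathwise

/-! ### The weight family -/

lemma IsWeight.mono {H H' : ℝ} {lam : ℕ → ℝ} (h : IsWeight H lam) (hH : H ≤ H') :
    IsWeight H' lam :=
  ⟨h.nonneg, h.le_one, h.anti, fun j hj => h.zero j (hH.trans_lt hj)⟩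

lemma isWeight_indicator (m : ℕ) : IsWeight m (fun j => if j ≤ m then 1 else 0) where
  nonneg j := by split_ifs <;> norm_num
  le_one j := by split_ifs <;> norm_num
  anti i j hij := by
    show (if j ≤ m then (1 : ℝ) else 0) ≤ if i ≤ m then 1 else 0
    split_ifs <;> first | omega | norm_num
  zero j hj := by
    have : m < j := by exact_mod_cast hj
    rw [if_neg (by omega)]

lemma isWeight_weight {P : Tuning} {n : ℕ} {α : ℕ × ℕ} (hω : 0 < omega P n α)
    (hε : P.eps n ≤ 1) : IsWeight (omega P n α) (weight P n α) := by
  have hfl : ∀ j : ℕ, j ≤ ⌊omega P n α * P.eps n⌋₊ → (j : ℝ) ≤ omega P n α := by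
    intro j hj
    have h1 : ⌊omega P n α * P.eps n⌋₊ ≤ ⌊omega P n α⌋₊ :=
      Nat.floor_le_floor (by nlinarith)
    calc (j : ℝ) ≤ ⌊omega P n α⌋₊ := by exact_mod_cast hj.trans h1
      _ ≤ _ := Nat.floor_le hω.le
  have hnn : ∀ j : ℕ, (j : ℝ) ≤ omega P n α → ((j : ℝ) / omega P n α) ^ α.1 ≤ 1 := fun j hj =>
    pow_le_one₀ (by positivity) ((div_le_one hω).mpr hj)
  refine ⟨fun j => ?_, fun j => ?_, fun i j hij => ?_, fun j hj => ?_⟩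
  · unfold weight
    split_ifs with h1 h2
    · norm_num
    · linarith [hnn j h2]
    · exact le_rfl
  · unfold weight
    split_ifs with h1 h2
    · exact le_rfl
    · have : 0 ≤ ((j : ℝ) / omega P n α) ^ α.1 := by positivity
      linarith
    · norm_num
  · have hij' : (i : ℝ) ≤ j := by exact_mod_cast hij
    unfold weight
    split_ifs with h1 h2 h3 h4 h5 h6
    · exact le_rfl
    · omega
    · omega
    · have : 0 ≤ ((j : ℝ) / omega P n α) ^ α.1 := by positivity
      linarith
    · have : ((i : ℝ) / omega P n α) ^ α.1 ≤ ((j : ℝ) / omega P n α) ^ α.1 := by gcongr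
      linarith
    · linarith
    · norm_num
    · linarith [hnn i (by assumption)]
    · exact le_rfl
  · unfold weight
    rw [if_neg (fun h => absurd (hfl j h) (not_le.mpr hj)), if_neg (not_le.mpr hj)]

lemma coefA_pos {β : ℕ} (hβ : 1 ≤ β) : 0 < coefA β := by
  unfold coefA
  have : (0 : ℝ) < β := by exact_mod_cast hβ
  positivity

/-- Because π² > 9 the exponential π^{2β} beats the polynomial factors. Uniformity in β matters
since β ranges up to a bound that grows with `n`. -/
lemma coefA_le_one {β : ℕ} (hβ : 1 ≤ β) : coefA β ≤ 1 := by
  have hβ' : (1 : ℝ) ≤ β := by exact_mod_cast hβ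
  have h9 : ∀ b : ℕ, 1 ≤ b → 2 * (2 * (b : ℝ) + 1) ≤ 9 ^ b := by
    intro b hb
    induction b, hb using Nat.le_induction with
    | base => norm_num
    | succ b hb ih =>
      push_cast
      rw [pow_succ]
      have : (1 : ℝ) ≤ b := by exact_mod_cast hb
      linarith
  have hπ : (9 : ℝ) ^ β ≤ Real.pi ^ (2 * β) := by
    rw [pow_mul]
    refine pow_le_pow_left₀ (by norm_num) ?_ β
    nlinarith [Real.pi_gt_three]
  unfold coefA
  rw [div_le_one (by positivity)]
  have := h9 β hβ
  calc ((β : ℝ) + 1) * (2 * β + 1) ≤ (2 * β) * (2 * β + 1) := by nlinarith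
    _ = β * (2 * (2 * β + 1)) := by ring
    _ ≤ _ := by gcongr; linarith

lemma omega_pos {P : Tuning} {n : ℕ} {α : ℕ × ℕ} (hn : 0 < n) (hε : 0 < P.eps n)
    (hω : 0 ≤ P.omegaBar) (h1 : 1 ≤ α.1) (h2 : 1 ≤ α.2) : 0 < omega P n α := by
  unfold omega
  have := coefA_pos h1
  have h2' : (0 : ℝ) < α.2 := by exact_mod_cast h2
  have hn' : (0 : ℝ) < n := by exact_mod_cast hn
  positivity

/-- An upper bound for `ω(α)` over the index set. -/
noncomputable def maxFreq (P : Tuning) (n : ℕ) : ℝ := P.omegaBar + (n / P.eps n) ^ (1 / 3 : ℝ)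

/-- The worst case is β = 1: the base is at most n/ε, which is at least 1, and the exponent 1/(2β+1)
is at most 1/3. -/
lemma omega_le_maxFreq {P : Tuning} {n : ℕ} {α : ℕ × ℕ} (hn : 0 < n) (hε : 0 < P.eps n)
    (hε1 : P.eps n ≤ 1) (hα : α ∈ indexSet P n) : omega P n α ≤ maxFreq P n := by
  obtain ⟨h1, -, -, h2⟩ := hα
  have hn' : (1 : ℝ) ≤ n := by exact_mod_cast hn
  have hA := coefA_pos h1
  have h1' : (1 : ℝ) ≤ α.1 := by exact_mod_cast h1
  unfold omega maxFreq
  gcongr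
  rw [← Real.mul_rpow (by positivity) (by positivity)]
  have hi : (α.2 : ℝ) ≤ 1 / P.eps n ^ 2 :=
    (Nat.le_floor_iff (by positivity)).mp h2
  have hb : coefA α.1 * (α.2 * P.eps n) * n ≤ n / P.eps n := by
    have e1 : (α.2 : ℝ) * P.eps n ≤ 1 / P.eps n := by
      calc (α.2 : ℝ) * P.eps n ≤ 1 / P.eps n ^ 2 * P.eps n := by gcongr
        _ = 1 / P.eps n := by field_simp
    calc coefA α.1 * (α.2 * P.eps n) * n ≤ 1 * (1 / P.eps n) * n := by
          gcongr; exact coefA_le_one h1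
      _ = _ := by ring
  refine (Real.rpow_le_rpow (by positivity) hb (by positivity)).trans ?_
  refine Real.rpow_le_rpow_of_exponent_le ?_ ?_
  · rw [le_div_iff₀ hε]; linarith
  · exact one_div_le_one_div_of_le (by norm_num) (by linarith)

/-- The index set as a finite set. -/
noncomputable def indexFinset (P : Tuning) (n : ℕ) : Finset (ℕ × ℕ) :=
  Finset.Icc 1 ⌊P.kstar n⌋₊ ×ˢ Finset.Icc 1 ⌊1 / P.eps n ^ 2⌋₊

lemma mem_indexFinset {P : Tuning} {n : ℕ} (hk : 0 ≤ P.kstar n) {α : ℕ × ℕ} :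
    α ∈ indexFinset P n ↔ α ∈ indexSet P n := by
  simp only [indexFinset, indexSet, Finset.mem_product, Finset.mem_Icc, Set.mem_ofPred_eq,
    Nat.le_floor_iff hk]
  tauto

lemma card_indexFinset_le {P : Tuning} {n : ℕ} (hk : 0 ≤ P.kstar n) :
    ((indexFinset P n).card : ℝ) ≤ P.kstar n * (1 / P.eps n ^ 2) := by
  simp only [indexFinset, Finset.card_product, Nat.card_Icc, Nat.add_sub_cancel, Nat.cast_mul]
  exact mul_le_mul (Nat.floor_le hk) (Nat.floor_le (by positivity)) (by positivity) hk

/-! ### Uniform bounds over the weight family -/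

/-- The supremum of X_i²/q_i over the family is replaced by the sum, so moments are enough and the
price is the cardinality, subpolynomial in the application. Indices with q_i = 0 drop out through
the convention 0⁻¹ = 0, and there X_i vanishes anyway. -/
lemma exists_uniform_sq_bound {ι Ω : Type*} [MeasurableSpace Ω] {p : Measure Ω} (s : Finset ι)
    (X : ι → Ω → ℝ) (q : ι → ℝ) (C : ℝ) (hq : ∀ i, 0 ≤ q i) (hC : 0 ≤ C)
    (h : ∀ i ∈ s, ∃ v ≤ C * q i, HasMean p (fun ω => X i ω ^ 2) v)
    (h0 : ∀ i ∈ s, q i = 0 → ∀ ω, X i ω = 0) :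
    ∃ U : Ω → ℝ, (∀ ω, 0 ≤ U ω) ∧ (∃ u ≤ s.card * C, HasMean p U u) ∧
      ∀ i ∈ s, ∀ ω, X i ω ^ 2 ≤ U ω * q i := by
  choose! v hv hm using h
  refine ⟨fun ω => ∑ i ∈ s, (q i)⁻¹ * X i ω ^ 2, fun ω => Finset.sum_nonneg fun i _ =>
    mul_nonneg (inv_nonneg.mpr (hq i)) (sq_nonneg _), ⟨∑ i ∈ s, (q i)⁻¹ * v i, ?_,
    HasMean.sum s fun i hi => (hm i hi).const_mul _⟩, fun i hi ω => ?_⟩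
  · rw [← nsmul_eq_mul]
    refine Finset.sum_le_card_nsmul s _ C fun i hi => ?_
    rcases (hq i).eq_or_lt with h | h
    · rw [← h, inv_zero, zero_mul]; exact hC
    · rw [inv_mul_le_iff₀ h, mul_comm]; exact hv i hi
  · rcases (hq i).eq_or_lt with h | h
    · rw [h0 i hi h.symm ω, ← h]; simp
    · have : (q i)⁻¹ * X i ω ^ 2 ≤ ∑ i ∈ s, (q i)⁻¹ * X i ω ^ 2 :=
        Finset.single_le_sum (f := fun i => (q i)⁻¹ * X i ω ^ 2)
          (fun i _ => mul_nonneg (inv_nonneg.mpr (hq i)) (sq_nonneg _)) hi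
      calc X i ω ^ 2 = (q i)⁻¹ * X i ω ^ 2 * q i := by field_simp
        _ ≤ _ := by gcongr

/-! ### The variance estimator -/

section Var

variable {n : ℕ} {c V : ℝ} {p : Measure (Fin n → ℝ)} {σ s : Fin n → ℝ}

lemma two_mul_abs_le_add_sq_div {a : ℝ} (ha : 0 < a) (x : ℝ) : 2 * |x| ≤ a + x ^ 2 / a := by
  have h : 0 ≤ (|x| - a) ^ 2 / a := by positivity
  have e : (|x| - a) ^ 2 / a = x ^ 2 / a - 2 * |x| + a := by
    field_simp; rw [← sq_abs x]; ring
  rw [e] at h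
  linarith

/-- The cut-off frequency of the variance estimator. -/
noncomputable def varCut (n : ℕ) : ℕ := ⌊(n : ℝ) ^ (1 / 3 : ℝ) + 1⌋₊

lemma varHat_eq (y : Fin n → ℝ) :
    varHat n y = ∑ j ∈ Finset.Icc 1 n,
      (1 - if j ≤ varCut n then (1 : ℝ) else 0) * thetaHat n y j ^ 2 := by
  have e : Finset.Icc (varCut n + 1) n = {j ∈ Finset.Icc 1 n | ¬ j ≤ varCut n} := by
    ext j
    simp only [Finset.mem_Icc, Finset.mem_filter]
    omega
  unfold varHat
  change ∑ j ∈ Finset.Icc (varCut n + 1) n, _ = _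
  rw [e, Finset.sum_filter]
  refine Finset.sum_congr rfl fun j _ => ?_
  split_ifs <;> simp_all

/-- The sum of squares above the cut-off splits into the energy of the signal there (at most τ), a
cross term, a centred quadratic form, and the coefficient variances. The two random terms are
bounded in mean with the free parameter `a`; the variances omitted below the cut-off cost 2V/n each.
-/
lemma IsNoiseLaw.varHat_error (h : IsNoiseLaw n c p) (hc : 2 ≤ c) (hn : Odd n)
    (hσ : ∀ l, σ l ^ 2 ≤ V) {Θ τ a : ℝ} (ha : 0 < a)
    (hΘ : ∑ j ∈ Finset.Icc 1 n, thetaHat n s j ^ 2 ≤ Θ)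
    (hτ : ∑ j ∈ Finset.Icc 1 n, (1 - if j ≤ varCut n then (1 : ℝ) else 0) * thetaHat n s j ^ 2
      ≤ τ) :
    ∃ D : (Fin n → ℝ) → ℝ,
      (∀ ξ, |1 / n * varHat n (fun l => s l + σ l * ξ l) - meanVar n σ| ≤ D ξ) ∧
      ∃ d ≤ 1 / n * (τ + 2 * a + V / n * Θ / a + c * V ^ 2 / n / a + V / n + 2 * V / n * varCut n),
        HasMean p D d := by
  have := h.isProb
  have hn' : (0 : ℝ) < n := by exact_mod_cast hn.pos
  have hV : 0 ≤ V := (sq_nonneg _).trans (hσ ⟨0, hn.pos⟩)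
  set w : ℕ → ℝ := fun j => 1 - if j ≤ varCut n then (1 : ℝ) else 0 with hw
  have hw0 : ∀ j, 0 ≤ w j := fun j => by simp only [hw]; split_ifs <;> norm_num
  have hw1 : ∀ j, w j ≤ 1 := fun j => by simp only [hw]; split_ifs <;> norm_num
  set θ := thetaHat n s with hθ
  set X : (Fin n → ℝ) → ℝ := fun ξ => ∑ j ∈ Finset.Icc 1 n, (w j * θ j) * noiseCoef n σ ξ j with hX
  set Y : (Fin n → ℝ) → ℝ := fun ξ =>
    ∑ j ∈ Finset.Icc 1 n, w j * (noiseCoef n σ ξ j ^ 2 - noiseVar n σ j) with hY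
  obtain ⟨-, vx, hvx, hXm⟩ := h.noise_linear hn hσ (fun j => w j * θ j)
  obtain ⟨-, vy, hvy, hYm⟩ := h.noise_quadratic hc hn hσ w
  have hτ0 : 0 ≤ ∑ j ∈ Finset.Icc 1 n, w j * θ j ^ 2 :=
    Finset.sum_nonneg fun j _ => mul_nonneg (hw0 j) (sq_nonneg _)
  have hbias : |∑ j ∈ Finset.Icc 1 n, w j * noiseVar n σ j - n * meanVar n σ|
      ≤ V / n + 2 * V / n * varCut n := by
    -- The constant weight 1 on the full range: the variances add up to n times their mean, up to
    -- V/n.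
    have i1 := (isWeight_indicator n).abs_sum_noiseVar_sub_le hn hσ
    have i2 := (isWeight_indicator (varCut n)).sum_le (by positivity) n
    have e1 : ∑ j ∈ Finset.Icc 1 n, (if j ≤ n then (1 : ℝ) else 0)
        * (noiseVar n σ j - meanVar n σ)
        = ∑ j ∈ Finset.Icc 1 n, noiseVar n σ j - n * meanVar n σ := by
      rw [Finset.sum_congr rfl fun j hj => by
        rw [if_pos (Finset.mem_Icc.mp hj).2, one_mul], Finset.sum_sub_distrib]
      simp
    rw [e1] at i1
    have e2 : ∑ j ∈ Finset.Icc 1 n, w j * noiseVar n σ j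
        = ∑ j ∈ Finset.Icc 1 n, noiseVar n σ j
          - ∑ j ∈ Finset.Icc 1 n, (if j ≤ varCut n then (1 : ℝ) else 0) * noiseVar n σ j := by
      rw [← Finset.sum_sub_distrib]
      exact Finset.sum_congr rfl fun j _ => by simp only [hw]; ring
    have i3 : ∑ j ∈ Finset.Icc 1 n, (if j ≤ varCut n then (1 : ℝ) else 0) * noiseVar n σ j
        ≤ 2 * V / n * varCut n := by
      calc _ ≤ ∑ j ∈ Finset.Icc 1 n, (if j ≤ varCut n then (1 : ℝ) else 0) * (2 * V / n) :=
            Finset.sum_le_sum fun j _ => mul_le_mul_of_nonneg_left (noiseVar_le hn.pos hσ j)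
              (by split_ifs <;> norm_num)
        _ ≤ _ := by
            rw [← Finset.sum_mul, mul_comm]
            gcongr
    have i4 : 0 ≤ ∑ j ∈ Finset.Icc 1 n, (if j ≤ varCut n then (1 : ℝ) else 0) * noiseVar n σ j :=
      Finset.sum_nonneg fun j _ => mul_nonneg (by split_ifs <;> norm_num) (noiseVar_nonneg j)
    rw [e2, abs_le]
    rw [abs_le] at i1
    constructor <;> linarith [i1.1, i1.2]
  refine ⟨fun ξ => 1 / n * (τ + (a + a⁻¹ * X ξ ^ 2) + (a + a⁻¹ * Y ξ ^ 2)
    + (V / n + 2 * V / n * varCut n)), fun ξ => ?_, _, ?_, ((((HasMean.const τ).add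
      ((HasMean.const a).add (hXm.const_mul a⁻¹))).add
      ((HasMean.const a).add (hYm.const_mul a⁻¹))).add (HasMean.const _)).const_mul (1 / n : ℝ)⟩
  · have e : varHat n (fun l => s l + σ l * ξ l) = ∑ j ∈ Finset.Icc 1 n, w j * θ j ^ 2
        + 2 * X ξ + Y ξ + ∑ j ∈ Finset.Icc 1 n, w j * noiseVar n σ j := by
      rw [varHat_eq, hX, hY, Finset.mul_sum, ← Finset.sum_add_distrib, ← Finset.sum_add_distrib,
        ← Finset.sum_add_distrib]
      refine Finset.sum_congr rfl fun j _ => ?_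
      rw [thetaHat_add]
      simp only [noiseCoef]
      ring
    have e2 : 1 / (n : ℝ) * varHat n (fun l => s l + σ l * ξ l) - meanVar n σ
        = 1 / n * (∑ j ∈ Finset.Icc 1 n, w j * θ j ^ 2 + 2 * X ξ + Y ξ
          + (∑ j ∈ Finset.Icc 1 n, w j * noiseVar n σ j - n * meanVar n σ)) := by
      rw [e]; field_simp; ring
    rw [e2, abs_mul, abs_of_nonneg (by positivity : 0 ≤ 1 / (n : ℝ))]
    refine mul_le_mul_of_nonneg_left ?_ (by positivity)
    have x1 := two_mul_abs_le_add_sq_div ha (X ξ)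
    have y1 := two_mul_abs_le_add_sq_div ha (Y ξ)
    rw [div_eq_inv_mul] at x1 y1
    have x2 := abs_nonneg (X ξ)
    have y2 := abs_nonneg (Y ξ)
    have x3 := le_abs_self (X ξ)
    have y3 := le_abs_self (Y ξ)
    have x4 := neg_abs_le (X ξ)
    have y4 := neg_abs_le (Y ξ)
    rw [abs_le] at hbias ⊢
    constructor <;> linarith [hbias.1, hbias.2]
  · refine mul_le_mul_of_nonneg_left ?_ (by positivity)
    have k1 : ∑ j ∈ Finset.Icc 1 n, (w j * θ j) ^ 2 ≤ Θ := by
      refine (Finset.sum_le_sum fun j _ => ?_).trans hΘ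
      rw [mul_pow]
      exact mul_le_of_le_one_left (sq_nonneg _) (pow_le_one₀ (hw0 j) (hw1 j))
    have k2 : ∑ j ∈ Finset.Icc 1 n, w j ^ 2 ≤ n := by
      refine (Finset.sum_le_sum fun j _ => pow_le_one₀ (hw0 j) (hw1 j)).trans ?_
      simp
    have k3 : a⁻¹ * vx ≤ V / n * Θ / a := by
      rw [div_eq_inv_mul (V / n * Θ)]
      gcongr
      exact hvx.trans (by gcongr)
    have k4 : a⁻¹ * vy ≤ c * V ^ 2 / n / a := by
      rw [div_eq_inv_mul (c * V ^ 2 / n)]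
      gcongr
      calc vy ≤ c * V ^ 2 / n ^ 2 * ∑ j ∈ Finset.Icc 1 n, w j ^ 2 := hvy
        _ ≤ c * V ^ 2 / n ^ 2 * n := by gcongr
        _ = _ := by field_simp
    linarith

end Var

/-! ### The oracle inequality for the risk -/

section Oracle

variable {P : Tuning} {n : ℕ} {c V v₀ : ℝ} {p : Measure (Fin n → ℝ)} {σ s : Fin n → ℝ}

lemma sum_mul_eq_zero_of_sum_sq_eq_zero {I : Finset ℕ} {b : ℕ → ℝ} (h : ∑ j ∈ I, b j ^ 2 = 0)
    (x : ℕ → ℝ) : ∑ j ∈ I, b j * x j = 0 := by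
  rw [Finset.sum_eq_zero_iff_of_nonneg fun j _ => sq_nonneg _] at h
  exact Finset.sum_eq_zero fun j hj => by rw [pow_eq_zero_iff (two_ne_zero) |>.mp (h j hj), zero_mul]

lemma cost_eq_coordCost (lam : ℕ → ℝ) (ξ : Fin n → ℝ) :
    cost P n lam (fun l => s l + σ l * ξ l)
      = coordCost (Finset.Icc 1 n) (thetaHat n s) (noiseCoef n σ ξ)
          (1 / n * varHat n (fun l => s l + σ l * ξ l)) (1 / (3 + P.L n)) lam := by
  unfold cost coordCost penalty thetaTilde
  simp only [thetaHat_add, noiseCoef]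
  congr 2
  ring

/-- The weight of the penalty. -/
noncomputable def penCoef (P : Tuning) (n : ℕ) : ℝ := 1 / (3 + P.L n)

/-- The relative error in the oracle inequality. -/
noncomputable def oracleSlack (P : Tuning) (n : ℕ) (v₀ V : ℝ) : ℝ :=
  penCoef P n * v₀ / (4 + 8 * V)

/-- A bound for `n` times the mean error of the variance estimator divided by `n`. -/
noncomputable def varErr (n : ℕ) (c V Θ τ a : ℝ) : ℝ :=
  τ + 2 * a + V / n * Θ / a + c * V ^ 2 / n / a + V / n + 2 * V / n * varCut n

/-- The remainder term in the oracle inequality. -/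
noncomputable def oracleRem (P : Tuning) (n : ℕ) (c v₀ V Θ τ a : ℝ) : ℝ :=
  (indexFinset P n).card * (V / n) / oracleSlack P n v₀ V
    + n * ((indexFinset P n).card * (c * V ^ 2 / n ^ 2)) / oracleSlack P n v₀ V
    + 4 * oracleSlack P n v₀ V * (n * ((indexFinset P n).card * (c * V ^ 2 / n ^ 2)))
    + 6 * (V / n) + 4 * maxFreq P n * (1 / n * varErr n c V Θ τ a)

/-- The loss of a fixed weight vector, averaged. -/
lemma IsNoiseLaw.hasMean_coordLoss (h : IsNoiseLaw n c p) (hn : Odd n) (hσ : ∀ l, σ l ^ 2 ≤ V)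
    (lam : ℕ → ℝ) :
    HasMean p (fun ξ => coordLoss (Finset.Icc 1 n) (thetaHat n s) (noiseCoef n σ ξ) lam)
      (∑ j ∈ Finset.Icc 1 n, ((1 - lam j) * thetaHat n s j) ^ 2
        + ∑ j ∈ Finset.Icc 1 n, lam j ^ 2 * noiseVar n σ j) := by
  have := h.isProb
  obtain ⟨h1, -⟩ := h.noise_linear hn hσ (fun j => 2 * ((lam j - 1) * thetaHat n s j * lam j))
  have h2 := HasMean.sum (Finset.Icc 1 n) fun j _ =>
    (h.hasMean_noiseCoef_sq (σ := σ) j).const_mul (lam j ^ 2)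
  refine (((HasMean.const (p := p)
    (∑ j ∈ Finset.Icc 1 n, ((1 - lam j) * thetaHat n s j) ^ 2)).add h1).add h2).congr
    (fun ξ => ?_) (by ring)
  unfold coordLoss
  rw [← Finset.sum_add_distrib, ← Finset.sum_add_distrib]
  exact Finset.sum_congr rfl fun j _ => by ring

/-- The mean of the right-hand side of `coordLoss_oracle`. The loss of the selected weights is
dominated pointwise by a variable of known mean, so it need not be integrated itself. The oracle
index is fixed and may depend on the unknown signal. -/
lemma oracle_risk (hP : P.Admissible) (hn3 : 3 ≤ n) (hn : Odd n) {sel : (Fin n → ℝ) → ℕ × ℕ}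
    (hsel : IsCostMinimiser P n sel) (hc : 2 ≤ c) (h : IsNoiseLaw n c p) (hv₀ : 0 < v₀)
    (hσ₀ : ∀ l, v₀ ≤ σ l ^ 2) (hσ : ∀ l, σ l ^ 2 ≤ V) {Θ τ a : ℝ} (ha : 0 < a)
    (hΘ : ∑ j ∈ Finset.Icc 1 n, thetaHat n s j ^ 2 ≤ Θ)
    (hτ : ∑ j ∈ Finset.Icc 1 n, (1 - if j ≤ varCut n then (1 : ℝ) else 0) * thetaHat n s j ^ 2
      ≤ τ) {α₀ : ℕ × ℕ} (hα₀ : α₀ ∈ indexSet P n) :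
    ∃ F : (Fin n → ℝ) → ℝ,
      (∀ ξ, coordLoss (Finset.Icc 1 n) (thetaHat n s) (noiseCoef n σ ξ)
        (weight P n (sel fun l => s l + σ l * ξ l)) ≤ F ξ) ∧
      ∃ f ≤ (1 - 4 * oracleSlack P n v₀ V)⁻¹ *
          ((1 + 4 * oracleSlack P n v₀ V + 2 * penCoef P n) *
            (∑ j ∈ Finset.Icc 1 n, ((1 - weight P n α₀ j) * thetaHat n s j) ^ 2
              + meanVar n σ * ∑ j ∈ Finset.Icc 1 n, weight P n α₀ j ^ 2)
            + oracleRem P n c v₀ V Θ τ a),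
        HasMean p F f := by
  have := h.isProb
  have hn0 : 0 < n := hn.pos
  have hn' : (0 : ℝ) < n := by exact_mod_cast hn0
  have hε := hP.eps_pos n hn3 hn
  have hε1 := hP.eps_le_one n hn3 hn
  have hk1 := hP.one_le_kstar n hn3 hn
  have hL := hP.L_nonneg n hn3 hn
  have hvV : v₀ ≤ V := (hσ₀ ⟨0, hn0⟩).trans (hσ ⟨0, hn0⟩)
  have hV : 0 < V := hv₀.trans_le hvV
  set ρ := penCoef P n with hρ
  set δ := oracleSlack P n v₀ V with hδ
  have hρ0 : 0 < ρ := by rw [hρ, penCoef]; positivity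
  have hρ3 : ρ ≤ 1 / 3 := by
    rw [hρ, penCoef]; exact one_div_le_one_div_of_le (by norm_num) (by linarith)
  have hδ0 : 0 < δ := by rw [hδ, oracleSlack]; positivity
  -- The slack is the largest δ for which the penalty absorbs the quadratic terms of
  -- `coordLoss_oracle`; since v₀ ≤ V it is at most ρ/8, which keeps 1 − 4δ positive.
  have hδeq : δ * (4 + 8 * V) = ρ * v₀ := by rw [hδ, oracleSlack, ← hρ]; field_simp
  have hδ8 : 8 * δ ≤ ρ := by
    have : 8 * δ * V ≤ ρ * V := by
      calc 8 * δ * V ≤ δ * (4 + 8 * V) := by nlinarith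
        _ = ρ * v₀ := hδeq
        _ ≤ ρ * V := by gcongr
    exact le_of_mul_le_mul_right this hV
  have h4δ : 0 < 1 - 4 * δ := by linarith
  have hwt : ∀ α ∈ indexSet P n, IsWeight (maxFreq P n) (weight P n α) := fun α hα =>
    (isWeight_weight (omega_pos hn0 hε hP.omegaBar_nonneg hα.1 hα.2.2.1) hε1).mono
      (omega_le_maxFreq hn0 hε hε1 hα)
  have hH0 : 0 ≤ maxFreq P n := by
    unfold maxFreq
    have := hP.omegaBar_nonneg
    positivity
  set I := Finset.Icc 1 n with hI
  set θ := thetaHat n s with hθ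
  set lam₀ := weight P n α₀ with hlam₀
  have hw₀ := hwt α₀ hα₀
  -- uniform bounds for the three noise statistics
  obtain ⟨U₁, hU₁0, ⟨u₁, hu₁, hU₁m⟩, hU₁⟩ := exists_uniform_sq_bound (p := p) (indexFinset P n)
    (fun α ξ => ∑ j ∈ I, ((weight P n α j - lam₀ j) * θ j) * noiseCoef n σ ξ j)
    (fun α => ∑ j ∈ I, ((weight P n α j - lam₀ j) * θ j) ^ 2) (V / n)
    (fun _ => Finset.sum_nonneg fun _ _ => sq_nonneg _) (by positivity)
    (fun α _ => (h.noise_linear hn hσ _).2)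
    (fun α _ h0 ξ => sum_mul_eq_zero_of_sum_sq_eq_zero h0 _)
  obtain ⟨U₂, hU₂0, ⟨u₂, hu₂, hU₂m⟩, hU₂⟩ := exists_uniform_sq_bound (p := p) (indexFinset P n)
    (fun α ξ => ∑ j ∈ I, (weight P n α j - lam₀ j) * (noiseCoef n σ ξ j ^ 2 - noiseVar n σ j))
    (fun α => ∑ j ∈ I, (weight P n α j - lam₀ j) ^ 2) (c * V ^ 2 / n ^ 2)
    (fun _ => Finset.sum_nonneg fun _ _ => sq_nonneg _) (by positivity)
    (fun α _ => (h.noise_quadratic hc hn hσ _).2)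
    (fun α _ h0 ξ => sum_mul_eq_zero_of_sum_sq_eq_zero h0 _)
  obtain ⟨U₃, hU₃0, ⟨u₃, hu₃, hU₃m⟩, hU₃⟩ := exists_uniform_sq_bound (p := p) (indexFinset P n)
    (fun α ξ => ∑ j ∈ I, weight P n α j ^ 2 * (noiseCoef n σ ξ j ^ 2 - noiseVar n σ j))
    (fun α => ∑ j ∈ I, (weight P n α j ^ 2) ^ 2) (c * V ^ 2 / n ^ 2)
    (fun _ => Finset.sum_nonneg fun _ _ => sq_nonneg _) (by positivity)
    (fun α _ => (h.noise_quadratic hc hn hσ _).2)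
    (fun α _ h0 ξ => sum_mul_eq_zero_of_sum_sq_eq_zero h0 _)
  obtain ⟨D, hD, d, hd, hDm⟩ := h.varHat_error hc hn hσ ha hΘ hτ
  have hE₀ := h.hasMean_coordLoss (s := s) hn hσ lam₀
  have hmean := ((hE₀.const_mul (1 + 4 * δ)).add
    (((((hU₁m.const_mul δ⁻¹).add (hU₂m.const_mul (n * δ⁻¹))).add
      (hU₃m.const_mul (4 * δ * n))).add (HasMean.const (4 * (V / n)))).add
      (hDm.const_mul (4 * maxFreq P n)) |>.add
      (HasMean.const (2 * ρ * (meanVar n σ * ∑ j ∈ I, lam₀ j ^ 2))))).const_mul (1 - 4 * δ)⁻¹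
  refine ⟨_, fun ξ => ?_, _, ?_, hmean⟩
  · have hαs := hsel.mem (fun l => s l + σ l * ξ l)
    have hw := hwt _ hαs
    have hmem := (mem_indexFinset (by linarith)).mpr hαs
    have hmem₀ := (mem_indexFinset (by linarith)).mpr hα₀
    have hJ := hsel.le (fun l => s l + σ l * ξ l) α₀ hα₀
    rw [cost_eq_coordCost, cost_eq_coordCost] at hJ
    have := coordLoss_oracle hn' hJ (fun j => ⟨hw.nonneg j, hw.le_one j⟩)
      (fun j => ⟨hw₀.nonneg j, hw₀.le_one j⟩) (hw.sum_le hH0 n) (hw₀.sum_le hH0 n)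
      (fun j _ => noiseVar_le hn0 hσ j) (hw.abs_sum_noiseVar_sub_le hn hσ)
      (hw₀.abs_sum_noiseVar_sub_le hn hσ) hρ0.le (by linarith : ρ ≤ 1) hδ0 hδeq.le
      (le_meanVar hn0 hσ₀) (hD ξ) (hU₁0 ξ) (hU₂0 ξ) (hU₃0 ξ) (hU₁ _ hmem ξ) (hU₂ _ hmem ξ)
      (hU₃ _ hmem ξ) (hU₃ _ hmem₀ ξ)
    rw [inv_mul_eq_div, le_div_iff₀ h4δ, mul_comm]
    refine this.trans (le_of_eq ?_)
    rw [← hI, ← hθ, ← hlam₀, hρ, penCoef]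
    ring
  · refine mul_le_mul_of_nonneg_left ?_ (inv_nonneg.mpr h4δ.le)
    have k0 := (abs_le.mp (hw₀.sq.abs_sum_noiseVar_sub_le hn hσ)).2
    have k1 : ∑ j ∈ I, lam₀ j ^ 2 * noiseVar n σ j
        ≤ meanVar n σ * ∑ j ∈ I, lam₀ j ^ 2 + V / n := by
      have e : ∑ j ∈ I, lam₀ j ^ 2 * (noiseVar n σ j - meanVar n σ)
          = ∑ j ∈ I, lam₀ j ^ 2 * noiseVar n σ j - meanVar n σ * ∑ j ∈ I, lam₀ j ^ 2 := by
        rw [Finset.mul_sum, ← Finset.sum_sub_distrib]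
        exact Finset.sum_congr rfl fun j _ => by ring
      rw [e] at k0
      linarith
    set B := ∑ j ∈ I, ((1 - lam₀ j) * θ j) ^ 2 with hB
    set A := meanVar n σ * ∑ j ∈ I, lam₀ j ^ 2 with hA
    have hB0 : 0 ≤ B := Finset.sum_nonneg fun _ _ => sq_nonneg _
    have q1 : δ⁻¹ * u₁ ≤ (indexFinset P n).card * (V / n) / δ := by
      rw [div_eq_inv_mul]; gcongr
    have q2 : n * δ⁻¹ * u₂ ≤ n * ((indexFinset P n).card * (c * V ^ 2 / n ^ 2)) / δ := by
      rw [div_eq_inv_mul, mul_comm (n : ℝ), mul_assoc]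
      gcongr
    have q3 : 4 * δ * n * u₃ ≤ 4 * δ * (n * ((indexFinset P n).card * (c * V ^ 2 / n ^ 2))) := by
      rw [mul_assoc (4 * δ)]
      gcongr
    have q4 : 4 * maxFreq P n * d ≤ 4 * maxFreq P n * (1 / n * varErr n c V Θ τ a) := by
      gcongr
      exact hd
    have q5 : (1 + 4 * δ) * (B + ∑ j ∈ I, lam₀ j ^ 2 * noiseVar n σ j)
        ≤ (1 + 4 * δ) * (B + (A + V / n)) := by gcongr
    have q6 : 4 * δ * (V / n) ≤ V / n :=
      mul_le_of_le_one_left (by positivity) (by linarith)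
    have q7 : 0 ≤ ρ * B := by positivity
    unfold oracleRem
    rw [← hδ]
    -- The six copies of V/n: four from the variance bias of the two weight vectors, and 1 + 4δ ≤ 2
    -- from replacing individual variances by their mean in the oracle risk.
    nlinarith only [q1, q2, q3, q4, q5, q6, q7]

end Oracle

/-! ### Sequences of subpolynomial growth -/

/-- Sequences that are negligible with respect to every positive power of `n`. -/
def IsSubpoly (a : ℕ → ℝ) : Prop :=
  ∀ ν : ℝ, 0 < ν → Tendsto (fun n : ℕ => a n / (n : ℝ) ^ ν) oddAtTop (𝓝 0)

lemma oddAtTop_le : oddAtTop ≤ atTop := inf_le_left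

lemma eventually_odd : ∀ᶠ n in oddAtTop, Odd n :=
  mem_inf_of_right (mem_principal_self _)

lemma eventually_three_le : ∀ᶠ n in oddAtTop, 3 ≤ n :=
  oddAtTop_le (eventually_ge_atTop 3)

lemma tendsto_natCast_oddAtTop : Tendsto (fun n : ℕ => (n : ℝ)) oddAtTop atTop :=
  tendsto_natCast_atTop_atTop.mono_left oddAtTop_le

lemma tendsto_rpow_oddAtTop {ν : ℝ} (hν : 0 < ν) :
    Tendsto (fun n : ℕ => (n : ℝ) ^ ν) oddAtTop atTop :=
  (tendsto_rpow_atTop hν).comp tendsto_natCast_oddAtTop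

lemma IsSubpoly.add {a b : ℕ → ℝ} (ha : IsSubpoly a) (hb : IsSubpoly b) :
    IsSubpoly (fun n => a n + b n) := fun ν hν => by
  simpa [add_div] using (ha ν hν).add (hb ν hν)

lemma IsSubpoly.mul {a b : ℕ → ℝ} (ha : IsSubpoly a) (hb : IsSubpoly b) :
    IsSubpoly (fun n => a n * b n) := fun ν hν => by
  have h := (ha (ν / 2) (half_pos hν)).mul (hb (ν / 2) (half_pos hν))
  rw [mul_zero] at h
  refine h.congr fun n => ?_
  rw [div_mul_div_comm, ← Real.rpow_add_of_nonneg (Nat.cast_nonneg n) (half_pos hν).le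
    (half_pos hν).le, add_halves]

lemma IsSubpoly.const (C : ℝ) : IsSubpoly (fun _ => C) := fun _ hν =>
  (tendsto_rpow_oddAtTop hν).const_div_atTop C

lemma IsSubpoly.pow {a : ℕ → ℝ} (ha : IsSubpoly a) (m : ℕ) : IsSubpoly (fun n => a n ^ m) := by
  induction m with
  | zero => simpa using IsSubpoly.const 1
  | succ m ih => simpa [pow_succ] using ih.mul ha

lemma Tuning.Admissible.subpoly_kstar {P : Tuning} (hP : P.Admissible) : IsSubpoly P.kstar :=
  fun ν hν => by
    have h1 : Tendsto (fun n : ℕ => Real.log n / (n : ℝ) ^ ν) oddAtTop (𝓝 0) :=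
      ((isLittleO_log_rpow_atTop hν).tendsto_div_nhds_zero).comp tendsto_natCast_oddAtTop
    have h := hP.tendsto_kstar_div_log.mul h1
    rw [mul_zero] at h
    refine h.congr' ?_
    filter_upwards [eventually_three_le] with n hn
    have : Real.log n ≠ 0 := by
      have h3 : (3 : ℝ) ≤ n := by exact_mod_cast hn
      exact (Real.log_pos (by linarith)).ne'
    field_simp

lemma Tuning.Admissible.subpoly_inv_eps {P : Tuning} (hP : P.Admissible) :
    IsSubpoly (fun n => 1 / P.eps n) := fun ν hν => by
  refine (hP.tendsto_pow_mul_eps ν hν).inv_tendsto_atTop.congr fun n => ?_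
  simp only [Pi.inv_apply, mul_inv]
  ring

/-- Used with ν = 1/(2k+1), so that 1 − ν is the exponent 2k/(2k+1) of the rate. -/
lemma eventually_div_le_of_isSubpoly {a : ℕ → ℝ} (ha : IsSubpoly a) {ν : ℝ} (hν : 0 < ν) {η : ℝ}
    (hη : 0 < η) : ∀ᶠ n : ℕ in oddAtTop, (n : ℝ) ^ (1 - ν) * (a n / n) ≤ η := by
  filter_upwards [(ha ν hν).eventually_le_const hη, eventually_three_le] with n h1 h2
  have hn : (0 : ℝ) < n := by exact_mod_cast (by omega : 0 < n)
  refine le_of_eq_of_le ?_ h1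
  rw [Real.rpow_sub hn, Real.rpow_one]
  field_simp

/-! ### The size of the remainder -/

/-- A bound for `n` times the remainder term. -/
noncomputable def remBound (P : Tuning) (n : ℕ) (c v₀ V Θ τ : ℝ) : ℝ :=
  P.kstar n * (1 / P.eps n) ^ 2 * (V * (1 + c * V) * ((4 + 8 * V) / v₀ * (3 + P.L n)))
    + P.kstar n * (1 / P.eps n) ^ 2 * (c * V ^ 2) + 6 * V
    + 4 * (P.omegaBar + 1 / P.eps n) * (τ + 2 + V * Θ + c * V ^ 2 + 5 * V)

lemma maxFreq_le {P : Tuning} {n : ℕ} (hn : 0 < n) (hε : 0 < P.eps n) (hε1 : P.eps n ≤ 1)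
    (hω : 0 ≤ P.omegaBar) :
    maxFreq P n ≤ (n : ℝ) ^ (1 / 3 : ℝ) * (P.omegaBar + 1 / P.eps n) := by
  have hn' : (1 : ℝ) ≤ n := by exact_mod_cast hn
  have h1 : (1 : ℝ) ≤ (n : ℝ) ^ (1 / 3 : ℝ) := Real.one_le_rpow hn' (by norm_num)
  have h2 : (1 / P.eps n) ^ (1 / 3 : ℝ) ≤ 1 / P.eps n :=
    Real.rpow_le_self_of_one_le ((one_le_div hε).mpr hε1) (by norm_num)
  have e : (n / P.eps n : ℝ) = n * (1 / P.eps n) := by ring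
  unfold maxFreq
  rw [e, Real.mul_rpow (by positivity) (by positivity), mul_add]
  gcongr
  exact le_mul_of_one_le_left hω h1

/-- With b = n^{-1/3} every term is a power of b, since 1/n = b³ and the cut-off is at most 2/b. The
largest is 2a = 2b, and this factor n^{-1/3} is just what cancels the n^{1/3} in `maxFreq` in the
remainder. -/
lemma varErr_le {n : ℕ} {c V Θ τ : ℝ} (hn : 0 < n) (hc : 0 ≤ c) (hV : 0 ≤ V) (hΘ : 0 ≤ Θ)
    (hτ : 0 ≤ τ) :
    varErr n c V Θ (τ * (n : ℝ) ^ (-(2 / 3) : ℝ)) ((n : ℝ) ^ (-(1 / 3) : ℝ))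
      ≤ (n : ℝ) ^ (-(1 / 3) : ℝ) * (τ + 2 + V * Θ + c * V ^ 2 + 5 * V) := by
  have hn' : (1 : ℝ) ≤ n := by exact_mod_cast hn
  have hn0 : (0 : ℝ) < n := by linarith
  set b := (n : ℝ) ^ (-(1 / 3) : ℝ) with hb
  have hb0 : 0 < b := Real.rpow_pos_of_pos hn0 _
  have hb1 : b ≤ 1 := Real.rpow_le_one_of_one_le_of_nonpos hn' (by norm_num)
  have h23 : (n : ℝ) ^ (-(2 / 3) : ℝ) = b ^ 2 := by
    rw [hb, ← Real.rpow_natCast, ← Real.rpow_mul hn0.le]; norm_num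
  have hinv : 1 / (n : ℝ) = b ^ 3 := by
    rw [hb, ← Real.rpow_natCast, ← Real.rpow_mul hn0.le, one_div, ← Real.rpow_neg_one]; norm_num
  have hcut : (varCut n : ℝ) ≤ 2 / b := by
    have h13 : (n : ℝ) ^ (1 / 3 : ℝ) = 1 / b := by
      rw [hb, Real.rpow_neg hn0.le, one_div, one_div, inv_inv]
    unfold varCut
    refine (Nat.floor_le (by positivity)).trans ?_
    rw [h13, show 2 / b = 1 / b + 1 / b by ring]
    gcongr
    rw [le_div_iff₀ hb0]; linarith
  have hbb : b ^ 2 ≤ b := by nlinarith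
  have hbbb : b ^ 3 ≤ b := by nlinarith
  have e1 : V / n * Θ / b = b ^ 2 * (V * Θ) := by
    rw [div_eq_mul_one_div V, hinv]; field_simp
  have e2 : c * V ^ 2 / n / b = b ^ 2 * (c * V ^ 2) := by
    rw [div_eq_mul_one_div (c * V ^ 2), hinv]; field_simp
  have e3 : V / n = b ^ 3 * V := by rw [div_eq_mul_one_div V, hinv]; ring
  have e4 : 2 * V / n * varCut n ≤ b ^ 2 * (4 * V) := by
    calc 2 * V / n * varCut n ≤ 2 * V / n * (2 / b) := by gcongr
      _ = _ := by rw [div_eq_mul_one_div (2 * V), hinv]; field_simp; ring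
  unfold varErr
  rw [h23, e1, e2]
  have f1 : τ * b ^ 2 ≤ τ * b := by gcongr
  have f2 : b ^ 2 * (V * Θ) ≤ b * (V * Θ) := by gcongr
  have f3 : b ^ 2 * (c * V ^ 2) ≤ b * (c * V ^ 2) := by gcongr
  have f4 : b ^ 2 * (4 * V) ≤ b * (4 * V) := by gcongr
  have f5 : b ^ 3 * V ≤ b * V := by gcongr
  linarith

lemma oracleRem_le {P : Tuning} (hP : P.Admissible) {n : ℕ} (hn3 : 3 ≤ n) (hn : Odd n)
    {c v₀ V Θ τ : ℝ} (hc : 0 ≤ c) (hv₀ : 0 < v₀) (hvV : v₀ ≤ V) (hΘ : 0 ≤ Θ) (hτ : 0 ≤ τ) :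
    oracleRem P n c v₀ V Θ (τ * (n : ℝ) ^ (-(2 / 3) : ℝ)) ((n : ℝ) ^ (-(1 / 3) : ℝ))
      ≤ remBound P n c v₀ V Θ τ / n := by
  have hn0 : 0 < n := hn.pos
  have hn' : (0 : ℝ) < n := by exact_mod_cast hn0
  have hε := hP.eps_pos n hn3 hn
  have hε1 := hP.eps_le_one n hn3 hn
  have hk1 := hP.one_le_kstar n hn3 hn
  have hL := hP.L_nonneg n hn3 hn
  have hω := hP.omegaBar_nonneg
  have hV : 0 < V := hv₀.trans_le hvV
  have hN := card_indexFinset_le (P := P) (n := n) (by linarith)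
  rw [← one_div_pow] at hN
  set N : ℝ := ((indexFinset P n).card : ℝ) with hNdef
  set N' := P.kstar n * (1 / P.eps n) ^ 2 with hN'
  have hN0 : 0 ≤ N := Nat.cast_nonneg _
  set δ := oracleSlack P n v₀ V with hδ
  have hδinv : δ⁻¹ = (4 + 8 * V) / v₀ * (3 + P.L n) := by
    rw [hδ, oracleSlack, penCoef]; field_simp
  have hδ0 : 0 < δ := by rw [hδ, oracleSlack, penCoef]; positivity
  have hδ1 : 4 * δ ≤ 1 := by
    have h1 : δ * (4 + 8 * V) = v₀ / (3 + P.L n) := by rw [hδ, oracleSlack, penCoef]; field_simp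
    have h2 : v₀ / (3 + P.L n) ≤ V := by
      rw [div_le_iff₀ (by positivity)]; nlinarith
    have h3 : 4 * δ * V ≤ 1 * V := by nlinarith
    exact le_of_mul_le_mul_right h3 hV
  have hH := maxFreq_le hn0 hε hε1 hω
  have hE := varErr_le (n := n) hn0 hc hV.le hΘ hτ
  have hH0 : 0 ≤ maxFreq P n := by unfold maxFreq; positivity
  have hpow : (n : ℝ) ^ (1 / 3 : ℝ) * (n : ℝ) ^ (-(1 / 3) : ℝ) = 1 := by
    rw [← Real.rpow_add hn']; norm_num
  have g1 : maxFreq P n * varErr n c V Θ (τ * (n : ℝ) ^ (-(2 / 3) : ℝ)) ((n : ℝ) ^ (-(1 / 3) : ℝ))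
      ≤ (P.omegaBar + 1 / P.eps n) * (τ + 2 + V * Θ + c * V ^ 2 + 5 * V) := by
    calc _ ≤ maxFreq P n * ((n : ℝ) ^ (-(1 / 3) : ℝ) * (τ + 2 + V * Θ + c * V ^ 2 + 5 * V)) := by
          gcongr
      _ ≤ (n : ℝ) ^ (1 / 3 : ℝ) * (P.omegaBar + 1 / P.eps n)
          * ((n : ℝ) ^ (-(1 / 3) : ℝ) * (τ + 2 + V * Θ + c * V ^ 2 + 5 * V)) := by gcongr
      _ = ((n : ℝ) ^ (1 / 3 : ℝ) * (n : ℝ) ^ (-(1 / 3) : ℝ)) * (P.omegaBar + 1 / P.eps n)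
          * (τ + 2 + V * Θ + c * V ^ 2 + 5 * V) := by ring
      _ = _ := by rw [hpow, one_mul]
  rw [le_div_iff₀ hn']
  unfold oracleRem remBound
  rw [← hNdef, ← hδ, ← hN', ← hδinv]
  have g2 : N * (V * (1 + c * V) * δ⁻¹) ≤ N' * (V * (1 + c * V) * δ⁻¹) := by gcongr
  have g3 : 4 * δ * (N * (c * V ^ 2)) ≤ N' * (c * V ^ 2) := by
    calc 4 * δ * (N * (c * V ^ 2)) ≤ 1 * (N * (c * V ^ 2)) := by gcongr
      _ ≤ _ := by rw [one_mul]; gcongr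
  have e : ∀ X : ℝ, (N * (V / n) / δ + n * (N * (c * V ^ 2 / n ^ 2)) / δ
      + 4 * δ * (n * (N * (c * V ^ 2 / n ^ 2))) + 6 * (V / n)
      + 4 * maxFreq P n * (1 / n * X)) * n
      = N * (V * (1 + c * V) * δ⁻¹) + 4 * δ * (N * (c * V ^ 2)) + 6 * V
        + 4 * (maxFreq P n * X) := fun X => by
    field_simp
  rw [e]
  linarith

lemma isSubpoly_remBound {P : Tuning} (hP : P.Admissible) {lstar : ℕ → ℝ}
    (hl : IsSlowlyIncreasing lstar) (v₀ V Θ τ : ℝ) :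
    IsSubpoly (fun n => remBound P n (lstar n) v₀ V Θ τ) := by
  have hk := hP.subpoly_kstar
  have he := hP.subpoly_inv_eps
  have hL : IsSubpoly P.L := hP.L_slow.2
  have hc : IsSubpoly lstar := hl.2
  have C := IsSubpoly.const
  unfold remBound
  exact ((((hk.mul (he.pow 2)).mul (((C V).mul ((C 1).add (hc.mul (C V)))).mul
    ((C _).mul ((C 3).add hL)))).add ((hk.mul (he.pow 2)).mul (hc.mul (C _)))).add (C _)).add
    (((C 4).mul ((C _).add he)).mul (((C _).add (hc.mul (C _))).add (C _)))

/-! ### The sharp bound for the oracle weights -/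

lemma sobolevClass_reg {k : ℕ} {r : ℝ} {S : ℝ → ℝ} (hS : S ∈ sobolevClass k r) : SobolevReg k S :=
  ⟨hS.1, hS.2.1, hS.2.2.1⟩

lemma sobolevClass_integral_le {k : ℕ} {r : ℝ} {S : ℝ → ℝ} (hS : S ∈ sobolevClass k r) {j : ℕ}
    (hj : j ≤ k) : ∫ t in (0 : ℝ)..1, iteratedDeriv j S t ^ 2 ≤ r :=
  (Finset.single_le_sum (f := fun j => ∫ t in (0 : ℝ)..1, iteratedDeriv j S t ^ 2)
    (fun _ _ => intervalIntegral.integral_nonneg zero_le_one fun _ _ => sq_nonneg _)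
    (Finset.mem_range.mpr (by omega))).trans hS.2.2.2

lemma SobolevReg.one {k : ℕ} (hk : 1 ≤ k) {f : ℝ → ℝ} (h : SobolevReg k f) : SobolevReg 1 f :=
  ⟨h.per, fun j hj => h.diff j (by omega), fun j hj => h.int j (by omega)⟩

lemma pi_mul_div_mem {n j : ℕ} (hj : j ∈ Finset.Icc 1 n) :
    0 ≤ Real.pi * (j / 2 : ℕ) / n ∧ Real.pi * (j / 2 : ℕ) / n ≤ Real.pi / 2 := by
  rw [Finset.mem_Icc] at hj
  have hn : (0 : ℝ) < n := by exact_mod_cast (by omega : 0 < n)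
  have h1 : ((j / 2 : ℕ) : ℝ) ≤ n / 2 := by
    rw [le_div_iff₀ (by norm_num)]
    exact_mod_cast (by omega : j / 2 * 2 ≤ n)
  refine ⟨by positivity, ?_⟩
  rw [div_le_iff₀ hn]
  calc Real.pi * ((j / 2 : ℕ) : ℝ) ≤ Real.pi * (n / 2) := by gcongr
    _ = _ := by ring

lemma four_mul_le_sin {n j : ℕ} (hj : j ∈ Finset.Icc 1 n) :
    4 * ((j / 2 : ℕ) : ℝ) ≤ 2 * n * Real.sin (Real.pi * (j / 2 : ℕ) / n) := by
  obtain ⟨h1, h2⟩ := pi_mul_div_mem hj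
  have hn : (0 : ℝ) < n := by
    rw [Finset.mem_Icc] at hj; exact_mod_cast (by omega : 0 < n)
  have h3 := Real.mul_le_sin h1 h2
  calc 4 * ((j / 2 : ℕ) : ℝ) = 2 * n * (2 / Real.pi * (Real.pi * (j / 2 : ℕ) / n)) := by
        field_simp; ring
    _ ≤ _ := by gcongr

/-- The frequencies above `l` carry little energy. -/
lemma sum_thetaHat_tail_le {n k : ℕ} (hn : Odd n) (hk : 1 ≤ k) {r : ℝ} {S : ℝ → ℝ}
    (hS : S ∈ sobolevClass k r) {l : ℕ} (hl : 1 ≤ l) :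
    ∑ j ∈ Finset.Icc 1 n, (1 - if j ≤ l then (1 : ℝ) else 0)
      * thetaHat n (fun i => S (designPoint n i)) j ^ 2 ≤ r / l ^ 2 := by
  have hl' : (0 : ℝ) < l := by exact_mod_cast hl
  have h1 := sum_sobolev_thetaHat_sq_le hn le_rfl ((sobolevClass_reg hS).one hk)
  have h2 := h1.trans (sobolevClass_integral_le hS hk)
  rw [le_div_iff₀ (by positivity), Finset.sum_mul]
  refine (Finset.sum_le_sum fun j hj => ?_).trans h2
  split_ifs with hjl
  · rw [sub_self, zero_mul, zero_mul]
    have : 0 ≤ 2 * (n : ℝ) * Real.sin (Real.pi * (j / 2 : ℕ) / n) :=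
      le_trans (by positivity) (four_mul_le_sin hj)
    positivity
  · rw [sub_zero, one_mul, mul_comm]
    refine mul_le_mul_of_nonneg_right ?_ (sq_nonneg _)
    refine pow_le_pow_left₀ hl'.le (le_trans ?_ (four_mul_le_sin hj)) _
    -- The condition 1 ≤ l excludes j = 1, whose frequency is zero.
    exact_mod_cast (by omega : l ≤ 4 * (j / 2))

lemma empNormSq_le_of_mem_sobolevClass {n k : ℕ} (hn : 0 < n) (hk : 1 ≤ k) {r : ℝ} {S : ℝ → ℝ}
    (hS : S ∈ sobolevClass k r) : empNormSq n S ≤ 4 * r := by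
  obtain ⟨k, rfl⟩ : ∃ m, k = m + 1 := ⟨k - 1, by omega⟩
  have hreg := sobolevClass_reg hS
  have h1 := empNormSq_le_normSq hn hreg.differentiable
    (fun a b => hreg.perSqInt_deriv.intervalIntegrable a b)
  have h2 := sobolevClass_integral_le hS (j := 0) (by omega)
  have h3 := sobolevClass_integral_le hS (j := 1) (by omega)
  simp only [iteratedDeriv_zero, iteratedDeriv_one] at h2 h3
  have hn' : (1 : ℝ) ≤ n := by exact_mod_cast hn
  have h4 : (1 / n : ℝ) ^ 2 ≤ 1 :=
    pow_le_one₀ (by positivity) ((div_le_one (by positivity)).mpr hn')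
  have h5 : 0 ≤ ∫ t in (0 : ℝ)..1, deriv S t ^ 2 :=
    intervalIntegral.integral_nonneg zero_le_one fun _ _ => sq_nonneg _
  have h6 : (1 / n : ℝ) ^ 2 * ∫ t in (0 : ℝ)..1, deriv S t ^ 2 ≤ r :=
    (mul_le_of_le_one_left h5 h4).trans h3
  unfold normSq at h1
  linarith

/-- A sharp lower bound for the discrete symbol. -/
lemma min_le_sin {n j : ℕ} {w κ : ℝ} (hj : j ∈ Finset.Icc 1 n) (hκ : 0 < κ) (hκ1 : κ ≤ 1 / 2)
    (hjκ : 1 ≤ κ * j) (hw0 : 0 < w) (hw : Real.pi ^ 2 * w ≤ 4 * n * κ) :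
    Real.pi * min (j : ℝ) w * (1 - 2 * κ) ≤ 2 * n * Real.sin (Real.pi * (j / 2 : ℕ) / n) := by
  obtain ⟨h1, h2⟩ := pi_mul_div_mem hj
  have hn : (0 : ℝ) < n := by
    rw [Finset.mem_Icc] at hj; exact_mod_cast (by omega : 0 < n)
  have hπ := Real.pi_pos
  set x := Real.pi * (j / 2 : ℕ) / n with hx
  have hj0 : (0 : ℝ) ≤ j := Nat.cast_nonneg j
  have hκ2 : 0 ≤ 1 - 2 * κ := by linarith
  have hκ3 : 0 ≤ 1 - κ := by linarith
  have hmin : 0 ≤ min (j : ℝ) w := le_min hj0 hw0.le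
  -- For x ≤ κ the cubic lower bound for the sine loses a factor 1 − κ, and rounding j to 2[j/2]
  -- loses another because 1 ≤ κj. For larger x Jordan's inequality gives only 4nκ/π, which still
  -- exceeds πw; this is why the minimum with w appears.
  rcases le_total x κ with h | h
  · have hs : x * (1 - κ) ≤ Real.sin x := by
      rcases h1.eq_or_lt with h0 | h0
      · rw [← h0]; simp
      · have h3 := Real.sin_gt_sub_cube h0
        have h4 : x ^ 2 ≤ κ := by nlinarith
        have h5 : x ^ 3 ≤ x * κ := by rw [pow_succ', mul_comm x κ, mul_comm x]; gcongr
        have h6 : 0 ≤ x ^ 3 := by positivity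
        nlinarith
    have hm : (j : ℝ) - 1 ≤ 2 * ((j / 2 : ℕ) : ℝ) := by
      rw [sub_le_iff_le_add]
      exact_mod_cast (by omega : j ≤ 2 * (j / 2) + 1)
    have hjm : (j : ℝ) * (1 - κ) ≤ 2 * ((j / 2 : ℕ) : ℝ) := by linarith
    calc Real.pi * min (j : ℝ) w * (1 - 2 * κ) ≤ Real.pi * j * (1 - 2 * κ) := by
          gcongr; exact min_le_left _ _
      _ ≤ Real.pi * j * ((1 - κ) * (1 - κ)) := by gcongr; nlinarith
      _ = Real.pi * (j * (1 - κ)) * (1 - κ) := by ring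
      _ ≤ Real.pi * (2 * ((j / 2 : ℕ) : ℝ)) * (1 - κ) := by gcongr
      _ = 2 * n * (x * (1 - κ)) := by rw [hx]; field_simp
      _ ≤ _ := by gcongr
  · have h3 := Real.mul_le_sin h1 h2
    calc Real.pi * min (j : ℝ) w * (1 - 2 * κ) ≤ Real.pi * w * 1 := by
          gcongr
          · exact min_le_right _ _
          · linarith
      _ = Real.pi ^ 2 * w / Real.pi := by field_simp
      _ ≤ 4 * n * κ / Real.pi := by gcongr
      _ = 2 * n * (2 / Real.pi * κ) := by ring
      _ ≤ 2 * n * (2 / Real.pi * x) := by gcongr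
      _ ≤ _ := by gcongr

/-- One bound for all three ranges of j, in the form that `min_le_sin` can meet: above the bandwidth
both sides are frozen at their value there. -/
lemma one_sub_weight_le {P : Tuning} {n : ℕ} {α : ℕ × ℕ} (hω : 0 < omega P n α) (j : ℕ) :
    1 - weight P n α j ≤ (min (j : ℝ) (omega P n α) / omega P n α) ^ α.1 := by
  have hmin : 0 ≤ min (j : ℝ) (omega P n α) := le_min (Nat.cast_nonneg j) hω.le
  unfold weight
  split_ifs with h1 h2
  · rw [sub_self]; positivity
  · rw [min_eq_left h2]; linarith
  · rw [min_eq_right (not_le.mp h2).le, div_self hω.ne', one_pow, sub_zero]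

/-- The bias of the oracle weights. -/
lemma oracle_bias_le {P : Tuning} {n k i : ℕ} (hn : Odd n) (hk : 1 ≤ k) {r : ℝ} {S : ℝ → ℝ}
    (hS : S ∈ sobolevClass k r) {κ : ℝ} (hκ : 0 < κ) (hκ1 : κ < 1 / 2)
    (hω : 0 < omega P n (k, i)) (hε : P.eps n ≤ 1) (hωε : 1 ≤ κ * (omega P n (k, i) * P.eps n))
    (hωn : Real.pi ^ 2 * omega P n (k, i) ≤ 4 * n * κ) :
    ∑ j ∈ Finset.Icc 1 n, ((1 - weight P n (k, i) j)
        * thetaHat n (fun l => S (designPoint n l)) j) ^ 2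
      ≤ r / (Real.pi * omega P n (k, i) * (1 - 2 * κ)) ^ (2 * k) := by
  have hκ2 : 0 < 1 - 2 * κ := by linarith
  have hπ := Real.pi_pos
  have hw := isWeight_weight hω hε
  have h2 := (sum_sobolev_thetaHat_sq_le hn hk (sobolevClass_reg hS)).trans
    (sobolevClass_integral_le hS le_rfl)
  rw [le_div_iff₀ (by positivity), Finset.sum_mul]
  refine (Finset.sum_le_sum fun j hj => ?_).trans h2
  have hsin : 0 ≤ 2 * (n : ℝ) * Real.sin (Real.pi * (j / 2 : ℕ) / n) :=
    le_trans (by positivity) (four_mul_le_sin hj)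
  -- On the plateau the bias vanishes. Beyond it j exceeds ωε, hence 1 ≤ κj, and the discrete symbol
  -- is already close to πj.
  by_cases hj0 : j ≤ ⌊omega P n (k, i) * P.eps n⌋₊
  · have : weight P n (k, i) j = 1 := by unfold weight; rw [if_pos hj0]
    rw [this, sub_self, zero_mul, zero_pow two_ne_zero, zero_mul]
    positivity
  · have hjκ : 1 ≤ κ * j := by
      refine hωε.trans (mul_le_mul_of_nonneg_left ?_ hκ.le)
      exact (Nat.lt_of_floor_lt (not_le.mp hj0)).le
    have h3 := min_le_sin hj hκ hκ1.le hjκ hω hωn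
    have h4 := one_sub_weight_le (P := P) (α := (k, i)) hω j
    have h5 : 0 ≤ 1 - weight P n (k, i) j := by linarith [hw.le_one j]
    have hmin : 0 ≤ min (j : ℝ) (omega P n (k, i)) := le_min (Nat.cast_nonneg j) hω.le
    have h6 : (1 - weight P n (k, i) j) * (Real.pi * omega P n (k, i) * (1 - 2 * κ)) ^ k
        ≤ (2 * (n : ℝ) * Real.sin (Real.pi * (j / 2 : ℕ) / n)) ^ k := by
      calc _ ≤ (min (j : ℝ) (omega P n (k, i)) / omega P n (k, i)) ^ k
            * (Real.pi * omega P n (k, i) * (1 - 2 * κ)) ^ k := by gcongr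
        _ = (Real.pi * min (j : ℝ) (omega P n (k, i)) * (1 - 2 * κ)) ^ k := by
            rw [← mul_pow]; congr 1; field_simp
        _ ≤ _ := by gcongr
    have h7 := pow_le_pow_left₀ (by positivity) h6 2
    calc _ = ((1 - weight P n (k, i) j) * (Real.pi * omega P n (k, i) * (1 - 2 * κ)) ^ k) ^ 2
          * thetaHat n (fun l => S (designPoint n l)) j ^ 2 := by ring
      _ ≤ ((2 * (n : ℝ) * Real.sin (Real.pi * (j / 2 : ℕ) / n)) ^ k) ^ 2
          * thetaHat n (fun l => S (designPoint n l)) j ^ 2 := by gcongr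
      _ = _ := by rw [← pow_mul, mul_comm k 2]

/-- The value of `∫₀¹ (1 - u^k)² du`. -/
noncomputable def weightConst (k : ℕ) : ℝ := 2 * (k : ℝ) ^ 2 / ((k + 1) * (2 * k + 1))

lemma integral_one_sub_pow_sq {w : ℝ} (hw : 0 < w) (k : ℕ) :
    ∫ x in (0 : ℝ)..w, (1 - (x / w) ^ k) ^ 2 = w * weightConst k := by
  have e : ∀ x : ℝ, (1 - (x / w) ^ k) ^ 2
      = 1 - 2 / w ^ k * x ^ k + 1 / w ^ (2 * k) * x ^ (2 * k) := fun x => by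
    rw [div_pow]; ring
  have hw' : w ≠ 0 := hw.ne'
  simp_rw [e]
  rw [intervalIntegral.integral_add (by apply Continuous.intervalIntegrable; fun_prop)
      (by apply Continuous.intervalIntegrable; fun_prop),
    intervalIntegral.integral_sub (by apply Continuous.intervalIntegrable; fun_prop)
      (by apply Continuous.intervalIntegrable; fun_prop),
    intervalIntegral.integral_const_mul, intervalIntegral.integral_const_mul, integral_pow,
    integral_pow, intervalIntegral.integral_const]
  have h1 : (k : ℝ) + 1 ≠ 0 := by positivity
  have h2 : 2 * (k : ℝ) + 1 ≠ 0 := by positivity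
  simp only [smul_eq_mul, weightConst, zero_pow (Nat.succ_ne_zero _), sub_zero, pow_succ]
  push_cast
  field_simp
  ring

/-- The squared Euclidean norm of the oracle weights. -/
lemma sum_weight_sq_le {P : Tuning} {n k i : ℕ} (hk : 1 ≤ k) (hω : 0 < omega P n (k, i))
    (hε0 : 0 ≤ P.eps n) (hε : P.eps n ≤ 1) :
    ∑ j ∈ Finset.Icc 1 n, weight P n (k, i) j ^ 2
      ≤ omega P n (k, i) * (weightConst k + 2 * P.eps n ^ 2) := by
  set w := omega P n (k, i) with hw
  set f : ℝ → ℝ := fun x => (1 - (x / w) ^ k) ^ 2 with hf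
  -- On the plateau j/ω ≤ ε, so raising the weight from 1 − (j/ω)^k to 1 costs at most 2ε in the
  -- square. There are at most ωε such indices, whence the term 2ωε².
  have hpt : ∀ j ∈ Finset.Icc 1 n, weight P n (k, i) j ^ 2
      ≤ (if j ∈ Finset.Icc 1 ⌊w⌋₊ then f j else 0)
        + (if j ∈ Finset.Icc 1 ⌊w * P.eps n⌋₊ then 2 * P.eps n else 0) := by
    intro j hj
    have hj1 := (Finset.mem_Icc.mp hj).1
    have hf0 : 0 ≤ f j := sq_nonneg _
    unfold weight
    rw [← hw]
    by_cases h1 : j ≤ ⌊w * P.eps n⌋₊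
    · have h10 : ⌊w * P.eps n⌋₊ ≤ ⌊w⌋₊ := Nat.floor_le_floor (by nlinarith)
      have h11 : (j : ℝ) ≤ w * P.eps n := (Nat.le_floor_iff (by positivity)).mp h1
      have h12 : (j : ℝ) / w ≤ P.eps n := by rw [div_le_iff₀ hω]; linarith
      have h13 : ((j : ℝ) / w) ^ k ≤ P.eps n :=
        (pow_le_of_le_one (by positivity) (h12.trans hε) (by omega)).trans h12
      rw [if_pos h1, if_pos (Finset.mem_Icc.mpr ⟨hj1, h1.trans h10⟩),
        if_pos (Finset.mem_Icc.mpr ⟨hj1, h1⟩)]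
      simp only [hf]
      nlinarith [sq_nonneg (((j : ℝ) / w) ^ k)]
    · rw [if_neg h1, if_neg (fun h => h1 (Finset.mem_Icc.mp h).2), add_zero]
      by_cases h2 : (j : ℝ) ≤ w
      · rw [if_pos h2, if_pos (Finset.mem_Icc.mpr ⟨hj1, Nat.le_floor h2⟩)]
      · rw [if_neg h2, zero_pow two_ne_zero]
        split_ifs
        · exact hf0
        · exact le_rfl
  refine (Finset.sum_le_sum hpt).trans ?_
  rw [Finset.sum_add_distrib, mul_add]
  refine add_le_add ?_ ?_
  · rw [Finset.sum_ite_mem]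
    calc _ ≤ ∑ j ∈ Finset.Icc 1 ⌊w⌋₊, f j :=
          Finset.sum_le_sum_of_subset_of_nonneg Finset.inter_subset_right
            fun _ _ _ => sq_nonneg _
      _ = ∑ j ∈ Finset.range ⌊w⌋₊, f (0 + (j + 1 : ℕ)) := by
          rw [sum_Icc_one_eq_sum_fin, Fin.sum_univ_eq_sum_range (fun j => f (j + 1 : ℕ))]
          simp
      _ ≤ ∫ x in (0 : ℝ)..(0 + ⌊w⌋₊), f x := by
          refine AntitoneOn.sum_le_integral fun x hx y hy hxy => ?_
          have hyw : y ≤ w := by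
            have := Nat.floor_le hω.le
            linarith [hy.2]
          have hyw' : (y / w) ^ k ≤ 1 :=
            pow_le_one₀ (div_nonneg hy.1 hω.le) ((div_le_one hω).mpr hyw)
          have hxy' : (x / w) ^ k ≤ (y / w) ^ k := by
            have := hx.1
            gcongr
          simp only [hf]
          exact pow_le_pow_left₀ (by linarith) (by linarith) 2
      _ ≤ ∫ x in (0 : ℝ)..w, f x := by
          refine intervalIntegral.integral_mono_interval le_rfl (by positivity) ?_
            (Eventually.of_forall fun _ => sq_nonneg _) ?_
          · rw [zero_add]; exact Nat.floor_le hω.le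
          · apply Continuous.intervalIntegrable; simp only [hf]; fun_prop
      _ = _ := integral_one_sub_pow_sq hω k
  · rw [Finset.sum_ite_mem, Finset.sum_const, nsmul_eq_mul]
    have h1 : ((Finset.Icc 1 n ∩ Finset.Icc 1 ⌊w * P.eps n⌋₊).card : ℝ) ≤ w * P.eps n := by
      have h2 : (Finset.Icc 1 n ∩ Finset.Icc 1 ⌊w * P.eps n⌋₊).card ≤ ⌊w * P.eps n⌋₊ := by
        refine (Finset.card_le_card Finset.inter_subset_right).trans ?_
        simp
      calc _ ≤ (⌊w * P.eps n⌋₊ : ℝ) := by exact_mod_cast h2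
        _ ≤ _ := Nat.floor_le (by positivity)
    calc _ ≤ w * P.eps n * (2 * P.eps n) := by gcongr
      _ = _ := by ring

/-! ### Asymptotics of the oracle risk -/

/-- The ideal bandwidth. -/
noncomputable def idealFreq (k : ℕ) (q x : ℝ) : ℝ := (coefA k * q * x) ^ (1 / (2 * (k : ℝ) + 1))

lemma weightConst_pos {k : ℕ} (hk : 1 ≤ k) : 0 < weightConst k := by
  have : (0 : ℝ) < k := by exact_mod_cast hk
  unfold weightConst; positivity

/-- The powers of k/(k+1) combine because the exponents 1/(2k+1) and 2k/(2k+1) add up to 1, and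
π^{2k} to the power 1/(2k+1) is the power of π in the Pinsker constant. -/
lemma coefA_rpow_mul {k : ℕ} (hk : 1 ≤ k) :
    coefA k ^ (1 / (2 * (k : ℝ) + 1)) * ((k : ℝ) / (k + 1)) = pinskerConst k := by
  have hk0 : (0 : ℝ) < k := by exact_mod_cast hk
  have hπ := Real.pi_pos
  set e := 1 / (2 * (k : ℝ) + 1) with he
  set f := 2 * (k : ℝ) / (2 * k + 1) with hf
  have hef : e + f = 1 := by rw [he, hf]; field_simp; ring
  have h2ke : 2 * (k : ℝ) * e = f := by rw [he, hf]; ring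
  set q := (k : ℝ) / (k + 1) with hq
  have hq0 : 0 < q := by positivity
  have hA : coefA k = (2 * (k : ℝ) + 1) * (q⁻¹ * (Real.pi ^ (2 * k))⁻¹) := by
    rw [coefA, hq]; field_simp
  have hπe : (Real.pi ^ (2 * k)) ^ e = Real.pi ^ f := by
    rw [← Real.rpow_natCast_mul hπ.le, ← h2ke]; push_cast; ring_nf
  have hpc : pinskerConst k = (2 * (k : ℝ) + 1) ^ e * (q / Real.pi) ^ f := by
    unfold pinskerConst
    congr 2
    rw [hq]; field_simp
  rw [hpc, hA, Real.mul_rpow (by positivity) (by positivity),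
    Real.mul_rpow (by positivity) (by positivity), Real.inv_rpow hq0.le,
    Real.inv_rpow (by positivity), hπe, Real.div_rpow hq0.le hπ.le]
  have hqq : q ^ e * q ^ f = q := by rw [← Real.rpow_add hq0, hef, Real.rpow_one]
  have h1 : 0 < q ^ e := Real.rpow_pos_of_pos hq0 _
  have h2 : 0 < Real.pi ^ f := Real.rpow_pos_of_pos hπ _
  field_simp
  linarith

/-- The ideal bandwidth balances bias and variance, with the Pinsker constant as the result. -/
lemma ideal_risk_eq {k : ℕ} (hk : 1 ≤ k) {r ς x : ℝ} (hr : 0 < r) (hς : 0 < ς) (hx : 0 < x) :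
    x ^ (2 * (k : ℝ) / (2 * k + 1)) * (r / (Real.pi * idealFreq k (r / ς) x) ^ (2 * k)
        + ς / x * (idealFreq k (r / ς) x * weightConst k))
      = pinskerConst k * r ^ (1 / (2 * (k : ℝ) + 1)) * ς ^ (2 * (k : ℝ) / (2 * k + 1)) := by
  have hk0 : (0 : ℝ) < k := by exact_mod_cast hk
  have hπ := Real.pi_pos
  have hA := coefA_pos hk
  rw [← coefA_rpow_mul hk]
  set w := idealFreq k (r / ς) x with hw
  set e := 1 / (2 * (k : ℝ) + 1) with he
  set f := 2 * (k : ℝ) / (2 * k + 1) with hf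
  have hef : f = 1 - e := by rw [he, hf]; field_simp; ring
  have hw0 : 0 < w := by rw [hw, idealFreq]; positivity
  have hpow : w ^ (2 * k) * w = coefA k * (r / ς) * x := by
    rw [← pow_succ, hw, idealFreq, ← Real.rpow_natCast, ← Real.rpow_mul (by positivity)]
    have : 1 / (2 * (k : ℝ) + 1) * ((2 * k + 1 : ℕ) : ℝ) = 1 := by
      push_cast; field_simp
    rw [this, Real.rpow_one]
  -- By the defining equation w^{2k+1} = A_k (r/ς) x the bias is the multiple k/((k+1)(2k+1)) of
  -- ςw/x. The variance is the multiple `weightConst k`, and the two multiples add up to k/(k+1).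
  have h1 : r / (Real.pi * w) ^ (2 * k)
      = ς / x * (w * (k / ((k + 1) * (2 * k + 1)))) := by
    have h2 : r = w ^ (2 * k) * w * ς / (coefA k * x) := by
      rw [hpow]; field_simp
    rw [mul_pow, div_eq_iff (by positivity)]
    conv_lhs => rw [h2]
    rw [coefA]
    field_simp
  have h3 : (k : ℝ) / ((k + 1) * (2 * k + 1)) + weightConst k = k / (k + 1) := by
    rw [weightConst]; field_simp; ring
  have h4 : w = coefA k ^ e * (r ^ e / ς ^ e) * x ^ e := by
    rw [hw, idealFreq, Real.mul_rpow (by positivity) hx.le, Real.mul_rpow hA.le (by positivity),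
      Real.div_rpow hr.le hς.le]
  rw [h1, ← mul_add, ← mul_add, h3, h4, hef, Real.rpow_sub hx, Real.rpow_sub hς, Real.rpow_one,
    Real.rpow_one]
  have a1 : 0 < x ^ e := Real.rpow_pos_of_pos hx _
  have a2 : 0 < ς ^ e := Real.rpow_pos_of_pos hς _
  field_simp

/-- The bounds for g² pass to ς(S) by integration. All later thresholds depend on S only through
these two constants, which gives uniformity over the class. -/
lemma ScaleCondition.exists_bounds {k : ℕ} {r : ℝ} {g : ℝ → (ℝ → ℝ) → ℝ}
    (hg : ScaleCondition k r g) :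
    ∃ c₀ C₀ : ℝ, 0 < c₀ ∧ c₀ ≤ C₀ ∧ (∀ x ∈ Set.Icc (0 : ℝ) 1, ∀ S ∈ sobolevClass k r,
      c₀ ≤ g x S ^ 2 ∧ g x S ^ 2 ≤ C₀) ∧
      ∀ S ∈ sobolevClass k r, c₀ ≤ intVar g S ∧ intVar g S ≤ C₀ := by
  obtain ⟨c₀, hc₀, h1⟩ := hg.bounded_below
  obtain ⟨C₁, h2⟩ := hg.bounded_above
  refine ⟨c₀, max c₀ C₁, hc₀, le_max_left _ _, fun x hx S hS =>
    ⟨h1 x hx S hS, (h2 x hx S hS).trans (le_max_right _ _)⟩, fun S hS => ?_⟩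
  have hi : IntervalIntegrable (fun x => g x S ^ 2) volume 0 1 := by
    rw [intervalIntegrable_iff_integrableOn_Icc_of_le zero_le_one]
    exact (hg.square_integrable S hS).integrable_sq
  constructor
  · have := intervalIntegral.integral_mono_on zero_le_one intervalIntegrable_const hi
      (fun x hx => h1 x hx S hS)
    simpa [intVar] using this
  · have := intervalIntegral.integral_mono_on zero_le_one hi intervalIntegrable_const
      (fun x hx => (h2 x hx S hS).trans (le_max_right c₀ C₁))
    simpa [intVar] using this

lemma designPoint_mem_Icc {n : ℕ} (l : Fin n) : designPoint n l ∈ Set.Icc (0 : ℝ) 1 := by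
  have hn : (0 : ℝ) < n := by exact_mod_cast l.pos
  unfold designPoint
  refine ⟨by positivity, ?_⟩
  rw [div_le_one hn]
  exact_mod_cast l.isLt

/-- The bandwidth of the oracle weights is close to the ideal one. -/
lemma omega_near_idealFreq {P : Tuning} {n k : ℕ} (hk : 1 ≤ k) (hn : 0 < n) {q κ : ℝ}
    (hq : 0 < q) (hκ : 0 < κ) (hκ1 : κ < 1) (hε : 0 < P.eps n) (hεq : P.eps n ≤ κ * q)
    (hω : 0 ≤ P.omegaBar) (hωκ : P.omegaBar ≤ κ * idealFreq k q n) :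
    (1 - κ) * idealFreq k q n ≤ omega P n (k, ⌊q / P.eps n⌋₊) ∧
      omega P n (k, ⌊q / P.eps n⌋₊) ≤ (1 + κ) * idealFreq k q n := by
  have hn' : (0 : ℝ) < n := by exact_mod_cast hn
  have hA := coefA_pos hk
  have hk0 : (0 : ℝ) < k := by exact_mod_cast hk
  set t := (⌊q / P.eps n⌋₊ : ℝ) * P.eps n with ht
  have ht1 : t ≤ q := by
    have := Nat.floor_le (a := q / P.eps n) (by positivity)
    rwa [le_div_iff₀ hε] at this
  have ht2 : (1 - κ) * q ≤ t := by
    -- The grid of step ε misses q by at most ε ≤ κq.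
    have := Nat.lt_floor_add_one (q / P.eps n)
    rw [div_lt_iff₀ hε, add_mul] at this
    linarith
  have hκ0 : 0 < 1 - κ := by linarith
  set e := 1 / (2 * (k : ℝ) + 1) with he
  have he0 : 0 ≤ e := by positivity
  have he1 : e ≤ 1 := by
    rw [he, div_le_one (by positivity)]; linarith
  have hform : omega P n (k, ⌊q / P.eps n⌋₊) = P.omegaBar + (coefA k * t * n) ^ e := by
    unfold omega
    rw [Real.mul_rpow (by positivity) hn'.le]
  have hw0 : 0 ≤ idealFreq k q n := by unfold idealFreq; positivity
  rw [hform]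
  constructor
  · have h1 : (1 - κ) * idealFreq k q n ≤ (coefA k * t * n) ^ e := by
      calc (1 - κ) * idealFreq k q n ≤ (1 - κ) ^ e * idealFreq k q n := by
            gcongr
            exact Real.self_le_rpow_of_le_one hκ0.le (by linarith) he1
        _ = ((1 - κ) * (coefA k * q * n)) ^ e := by
            rw [Real.mul_rpow hκ0.le (by positivity)]; rfl
        _ ≤ (coefA k * t * n) ^ e := by
            refine Real.rpow_le_rpow (by positivity) ?_ he0
            calc (1 - κ) * (coefA k * q * n) = coefA k * ((1 - κ) * q) * n := by ring
              _ ≤ _ := by gcongr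
    linarith
  · have h1 : (coefA k * t * n) ^ e ≤ idealFreq k q n := by
      unfold idealFreq
      gcongr
    linarith

/-- Continuity at κ = 0. The first factor collects the losses in the bias; the cube collects those
in the variance: mean variance, bandwidth and norm of the weights. -/
lemma exists_small_factor (k : ℕ) {η : ℝ} (hη : 0 < η) :
    ∃ κ : ℝ, 0 < κ ∧ κ < 1 / 2 ∧
      (((1 - κ) * (1 - 2 * κ)) ^ (2 * k))⁻¹ * (1 + κ) ^ 3 ≤ 1 + η := by
  have hc : ContinuousAt (fun κ : ℝ => (((1 - κ) * (1 - 2 * κ)) ^ (2 * k))⁻¹ * (1 + κ) ^ 3) 0 := by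
    refine ContinuousAt.mul (ContinuousAt.inv₀ (by fun_prop) (by simp)) (by fun_prop)
  have h1 : ∀ᶠ κ : ℝ in 𝓝 0, (((1 - κ) * (1 - 2 * κ)) ^ (2 * k))⁻¹ * (1 + κ) ^ 3 < 1 + η :=
    hc.eventually_lt continuousAt_const (by simpa using hη)
  have h2 : ∀ᶠ κ : ℝ in 𝓝 0, κ < 1 / 2 := eventually_lt_nhds (by norm_num)
  obtain ⟨κ, ⟨h3, h4⟩, h5⟩ :=
    (((h1.and h2).filter_mono nhdsWithin_le_nhds).and (self_mem_nhdsWithin (s := Set.Ioi 0))).exists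
  exact ⟨κ, h5, h4, h3.le⟩

/-- The oracle weights attain the Pinsker bound, uniformly over the Sobolev class. -/
lemma eventually_oracle_sharp {P : Tuning} (hP : P.Admissible) {k : ℕ} (hk : 1 ≤ k) {r : ℝ}
    (hr : 0 < r) {g : ℝ → (ℝ → ℝ) → ℝ} (hg : ScaleCondition k r g) {η : ℝ} (hη : 0 < η) :
    ∀ᶠ n : ℕ in oddAtTop, ∀ S ∈ sobolevClass k r, ∃ α ∈ indexSet P n,
      (n : ℝ) ^ (2 * (k : ℝ) / (2 * k + 1)) *
        (∑ j ∈ Finset.Icc 1 n, ((1 - weight P n α j)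
            * thetaHat n (fun l => S (designPoint n l)) j) ^ 2
          + meanVar n (fun l => g (designPoint n l) S)
            * ∑ j ∈ Finset.Icc 1 n, weight P n α j ^ 2) ≤ (1 + η) * gammaK k r g S := by
  obtain ⟨c₀, C₀, hc₀, hcC, hgb, hvb⟩ := hg.exists_bounds
  obtain ⟨κ, hκ, hκ2, hκη⟩ := exists_small_factor k hη
  have hC₀ : 0 < C₀ := hc₀.trans_le hcC
  have hk0 : (0 : ℝ) < k := by exact_mod_cast hk
  have hA := coefA_pos hk
  have hwc := weightConst_pos hk
  have hπ := Real.pi_pos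
  set e := 1 / (2 * (k : ℝ) + 1) with he
  have he0 : 0 < e := by positivity
  have he1 : e < 1 := by rw [he, div_lt_one (by positivity)]; linarith
  set c₁ := (coefA k * (r / C₀)) ^ e with hc₁
  set c₂ := (coefA k * (r / c₀)) ^ e with hc₂
  have hc₁0 : 0 < c₁ := by positivity
  have hc₂0 : 0 < c₂ := by positivity
  have E2 := Metric.tendstoUniformlyOn_iff.mp hg.riemann_sums (κ * c₀) (by positivity)
  have E3 := hP.tendsto_kstar.eventually_ge_atTop (k : ℝ)
  -- The three bounds on ε ensure that the grid is fine enough near r/ς, that the index [q/ε] stays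
  -- within the range [1/ε²], and that the plateau adds little to the norm of the weights. Next,
  -- `E5` makes the additive constant in the bandwidth negligible, `E6` places the end of the
  -- plateau beyond 1/κ, and `E7` supplies the condition on w in `min_le_sin`.
  have E4 : ∀ᶠ n in oddAtTop, P.eps n ≤ min (κ * (r / C₀)) (min (c₀ / r) (κ * weightConst k / 2)) :=
    hP.tendsto_eps.eventually_le_const (by positivity)
  have E5 := (tendsto_rpow_oddAtTop he0).eventually_ge_atTop (P.omegaBar / (κ * c₁))
  have E6 := (hP.tendsto_pow_mul_eps e he0).eventually_ge_atTop (1 / (κ * ((1 - κ) * c₁)))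
  have E7 := (tendsto_rpow_oddAtTop (ν := 1 - e) (by linarith)).eventually_ge_atTop
    (Real.pi ^ 2 * ((1 + κ) * c₂) / (4 * κ))
  filter_upwards [E2, E3, E4, E5, E6, E7, eventually_odd, eventually_three_le]
    with n E2 E3 E4 E5 E6 E7 hn hn3 S hS
  have hn0 : 0 < n := hn.pos
  have hn' : (0 : ℝ) < n := by exact_mod_cast hn0
  have hε := hP.eps_pos n hn3 hn
  have hε1 := hP.eps_le_one n hn3 hn
  obtain ⟨E4a, E4'⟩ := le_min_iff.mp E4
  obtain ⟨E4b, E4c⟩ := le_min_iff.mp E4'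
  obtain ⟨hς1, hς2⟩ := hvb S hS
  set ς := intVar g S with hςdef
  have hς : 0 < ς := hc₀.trans_le hς1
  set q := r / ς with hq
  have hq0 : 0 < q := by positivity
  have hqC : r / C₀ ≤ q := by rw [hq]; gcongr
  have hqc : q ≤ r / c₀ := by rw [hq]; gcongr
  set W := idealFreq k q n with hW
  have hW0 : 0 < W := by rw [hW, idealFreq]; positivity
  set u := (n : ℝ) ^ e with hu
  have hu0 : 0 < u := Real.rpow_pos_of_pos hn' _
  have hW1 : c₁ * u ≤ W := by
    rw [hc₁, hu, ← Real.mul_rpow (by positivity) hn'.le, hW, idealFreq]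
    gcongr
  have hW2 : W ≤ c₂ * u := by
    rw [hc₂, hu, ← Real.mul_rpow (by positivity) hn'.le, hW, idealFreq]
    gcongr
  have hεq : P.eps n ≤ κ * q := E4a.trans (by gcongr)
  have hωκ : P.omegaBar ≤ κ * W := by
    rw [div_le_iff₀ (by positivity)] at E5
    calc P.omegaBar ≤ u * (κ * c₁) := E5
      _ = κ * (c₁ * u) := by ring
      _ ≤ _ := by gcongr
  obtain ⟨hω1, hω2⟩ := omega_near_idealFreq hk hn0 hq0 hκ (by linarith) hε hεq
    hP.omegaBar_nonneg hωκ
  rw [← hW] at hω1 hω2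
  set i := ⌊q / P.eps n⌋₊ with hi
  set w := omega P n (k, i) with hw
  have hκ0 : 0 < 1 - κ := by linarith
  have hκ3 : 0 < 1 - 2 * κ := by linarith
  have hw0 : 0 < w := lt_of_lt_of_le (by positivity) hω1
  refine ⟨(k, i), ⟨hk, E3, ?_, ?_⟩, ?_⟩
  · rw [hi, Nat.one_le_floor_iff, one_le_div hε]
    exact hεq.trans (mul_le_of_le_one_left hq0.le (by linarith))
  · refine Nat.floor_le_floor ?_
    rw [div_le_div_iff₀ hε (by positivity)]
    have h1 : P.eps n * q ≤ 1 := by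
      calc P.eps n * q ≤ c₀ / r * (r / c₀) := by gcongr
        _ = 1 := by field_simp
    calc q * P.eps n ^ 2 = P.eps n * q * P.eps n := by ring
      _ ≤ 1 * P.eps n := by gcongr
  · have hωε : 1 ≤ κ * (w * P.eps n) := by
      rw [div_le_iff₀ (by positivity)] at E6
      calc 1 ≤ u * P.eps n * (κ * ((1 - κ) * c₁)) := E6
        _ = κ * ((1 - κ) * (c₁ * u) * P.eps n) := by ring
        _ ≤ κ * ((1 - κ) * W * P.eps n) := by gcongr
        _ ≤ _ := by gcongr
    have hωn : Real.pi ^ 2 * w ≤ 4 * n * κ := by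
      rw [div_le_iff₀ (by positivity)] at E7
      have hun : u * (n : ℝ) ^ (1 - e) = n := by
        rw [hu, ← Real.rpow_add hn']; simp
      calc Real.pi ^ 2 * w ≤ Real.pi ^ 2 * ((1 + κ) * (c₂ * u)) := by
            have := hω2.trans (mul_le_mul_of_nonneg_left hW2 (by positivity : 0 ≤ 1 + κ))
            gcongr
        _ = Real.pi ^ 2 * ((1 + κ) * c₂) * u := by ring
        _ ≤ (n : ℝ) ^ (1 - e) * (4 * κ) * u := by gcongr
        _ = 4 * (u * (n : ℝ) ^ (1 - e)) * κ := by ring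
        _ = _ := by rw [hun]
    have hbias := oracle_bias_le (P := P) (i := i) hn hk hS hκ hκ2 hw0 hε1 hωε hωn
    have hvar := sum_weight_sq_le (P := P) (n := n) (i := i) hk hw0 hε.le hε1
    rw [← hw] at hbias hvar
    have hmv : meanVar n (fun l => g (designPoint n l) S) ≤ (1 + κ) * (ς / n) := by
      have h1 := E2 S hS
      rw [Real.dist_eq, abs_lt] at h1
      have h2 : 1 / (n : ℝ) * ∑ l, g (designPoint n l) S ^ 2 ≤ (1 + κ) * ς := by
        nlinarith only [h1.1, mul_le_mul_of_nonneg_left hς1 hκ.le]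
      unfold meanVar
      calc _ = 1 / (n : ℝ) * (1 / (n : ℝ) * ∑ l, g (designPoint n l) S ^ 2) := by ring
        _ ≤ 1 / (n : ℝ) * ((1 + κ) * ς) := by gcongr
        _ = _ := by ring
    set M := (((1 - κ) * (1 - 2 * κ)) ^ (2 * k))⁻¹ * (1 + κ) ^ 3 with hM
    have hM1 : (((1 - κ) * (1 - 2 * κ)) ^ (2 * k))⁻¹ ≤ M := by
      rw [hM]
      exact le_mul_of_one_le_right (by positivity) (one_le_pow₀ (by linarith))
    have hM2 : (1 + κ) ^ 3 ≤ M := by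
      rw [hM]
      refine le_mul_of_one_le_left (by positivity) ?_
      rw [one_le_inv₀ (by positivity)]
      exact pow_le_one₀ (by positivity) (mul_le_one₀ (by linarith) hκ3.le (by linarith))
    have hbias2 : r / (Real.pi * w * (1 - 2 * κ)) ^ (2 * k) ≤ M * (r / (Real.pi * W) ^ (2 * k)) := by
      calc r / (Real.pi * w * (1 - 2 * κ)) ^ (2 * k)
          ≤ r / (Real.pi * ((1 - κ) * W) * (1 - 2 * κ)) ^ (2 * k) := by gcongr
        _ = (((1 - κ) * (1 - 2 * κ)) ^ (2 * k))⁻¹ * (r / (Real.pi * W) ^ (2 * k)) := by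
            rw [show Real.pi * ((1 - κ) * W) * (1 - 2 * κ)
              = (1 - κ) * (1 - 2 * κ) * (Real.pi * W) by ring, mul_pow]
            field_simp
        _ ≤ _ := by gcongr
    have hvar2 : meanVar n (fun l => g (designPoint n l) S)
        * ∑ j ∈ Finset.Icc 1 n, weight P n (k, i) j ^ 2 ≤ M * (ς / n * (W * weightConst k)) := by
      have h1 : weightConst k + 2 * P.eps n ^ 2 ≤ (1 + κ) * weightConst k := by
        nlinarith only [E4c, hε1, hε]
      calc _ ≤ (1 + κ) * (ς / n) * ((1 + κ) * W * ((1 + κ) * weightConst k)) := by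
            refine mul_le_mul hmv (hvar.trans ?_) (Finset.sum_nonneg fun _ _ => sq_nonneg _)
              (by positivity)
            exact mul_le_mul hω2 h1 (by positivity) (by positivity)
        _ = (1 + κ) ^ 3 * (ς / n * (W * weightConst k)) := by ring
        _ ≤ _ := by gcongr
    have hid := ideal_risk_eq hk hr hς hn'
    rw [← hq, ← hW, ← he] at hid
    have hγ : gammaK k r g S = pinskerConst k * r ^ e * ς ^ (2 * (k : ℝ) / (2 * k + 1)) := rfl
    rw [hγ, ← hid]
    calc _ ≤ (n : ℝ) ^ (2 * (k : ℝ) / (2 * k + 1)) * (M * (r / (Real.pi * W) ^ (2 * k))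
          + M * (ς / n * (W * weightConst k))) := by
          gcongr
          exact hbias.trans hbias2
      _ = M * ((n : ℝ) ^ (2 * (k : ℝ) / (2 * k + 1)) * (r / (Real.pi * W) ^ (2 * k)
          + ς / n * (W * weightConst k))) := by ring
      _ ≤ _ := by gcongr

/-! ### Regularity of the estimator -/

lemma contDiff_trigBasis (j : ℕ) : ContDiff ℝ 1 (trigBasis j) := by
  unfold trigBasis
  split_ifs <;> fun_prop

lemma deriv_trigBasis_sq_le (j : ℕ) (x : ℝ) :
    deriv (trigBasis j) x ^ 2 ≤ 2 * Real.pi ^ 2 * (j : ℝ) ^ 2 := by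
  have h2 : √2 ^ 2 = (2 : ℝ) := Real.sq_sqrt (by norm_num)
  have hj : 2 * ((j / 2 : ℕ) : ℝ) ≤ j := by exact_mod_cast (by omega : 2 * (j / 2) ≤ j)
  have hb : ∀ u : ℝ, u ^ 2 ≤ 1 →
      (√2 * (u * (2 * Real.pi * ((j / 2 : ℕ) : ℝ)))) ^ 2 ≤ 2 * Real.pi ^ 2 * (j : ℝ) ^ 2 := by
    intro u hu
    calc _ = 2 * Real.pi ^ 2 * (u ^ 2 * (2 * ((j / 2 : ℕ) : ℝ)) ^ 2) := by
          rw [mul_pow, h2]; ring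
      _ ≤ 2 * Real.pi ^ 2 * (1 * (j : ℝ) ^ 2) := by gcongr
      _ = _ := by ring
  by_cases h1 : j = 1
  · have : trigBasis j = fun _ => 1 := by funext y; simp [trigBasis, h1]
    rw [this, deriv_const, zero_pow two_ne_zero]
    positivity
  · have hlin : HasDerivAt (fun y : ℝ => 2 * Real.pi * ((j / 2 : ℕ) : ℝ) * y)
        (2 * Real.pi * ((j / 2 : ℕ) : ℝ)) x := by
      simpa using (hasDerivAt_id x).const_mul (2 * Real.pi * ((j / 2 : ℕ) : ℝ))
    by_cases he : Even j
    · have : trigBasis j = fun y => √2 * Real.cos (2 * Real.pi * ((j / 2 : ℕ) : ℝ) * y) := by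
        funext y; simp only [trigBasis, if_neg h1, if_pos he]
      rw [this, (hlin.cos.const_mul √2).deriv]
      exact hb _ (by rw [neg_sq]; exact Real.sin_sq_le_one _)
    · have : trigBasis j = fun y => √2 * Real.sin (2 * Real.pi * ((j / 2 : ℕ) : ℝ) * y) := by
        funext y; simp only [trigBasis, if_neg h1, if_neg he]
      rw [this, (hlin.sin.const_mul √2).deriv]
      exact hb _ (Real.cos_sq_le_one _)

lemma contDiff_wlsEstimator (n : ℕ) (lam : ℕ → ℝ) (y : Fin n → ℝ) :
    ContDiff ℝ 1 (wlsEstimator n lam y) := by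
  unfold wlsEstimator
  exact ContDiff.sum fun j _ => contDiff_const.mul (contDiff_trigBasis j)

/-- Cauchy–Schwarz: differentiation costs H² on the support of the weights, and the sum of the
weights contributes one more factor H. -/
lemma deriv_wlsEstimator_sq_le {n : ℕ} {lam : ℕ → ℝ} {H : ℝ} (h : IsWeight H lam) (hH : 0 ≤ H)
    (y : Fin n → ℝ) (x : ℝ) :
    deriv (wlsEstimator n lam y) x ^ 2
      ≤ 2 * Real.pi ^ 2 * H ^ 3 * ∑ j ∈ Finset.Icc 1 n, thetaHat n y j ^ 2 := by
  have hd : deriv (wlsEstimator n lam y) x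
      = ∑ j ∈ Finset.Icc 1 n, thetaHat n y j * (lam j * deriv (trigBasis j) x) := by
    have h1 : HasDerivAt (wlsEstimator n lam y)
        (∑ j ∈ Finset.Icc 1 n, lam j * thetaHat n y j * deriv (trigBasis j) x) x := by
      unfold wlsEstimator
      exact HasDerivAt.fun_sum fun j _ =>
        (((contDiff_trigBasis j).differentiable (by norm_num)) x).hasDerivAt.const_mul _
    rw [h1.deriv]
    exact Finset.sum_congr rfl fun j _ => by ring
  rw [hd]
  refine (Finset.sum_mul_sq_le_sq_mul_sq _ _ _).trans ?_
  rw [mul_comm]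
  refine mul_le_mul_of_nonneg_right ?_ (Finset.sum_nonneg fun _ _ => sq_nonneg _)
  have hpt : ∀ j ∈ Finset.Icc 1 n, (lam j * deriv (trigBasis j) x) ^ 2
      ≤ 2 * Real.pi ^ 2 * H ^ 2 * lam j := by
    intro j _
    rw [mul_pow]
    rcases le_or_gt (j : ℝ) H with hj | hj
    · calc lam j ^ 2 * deriv (trigBasis j) x ^ 2 ≤ lam j * (2 * Real.pi ^ 2 * (j : ℝ) ^ 2) :=
            mul_le_mul (h.sq_le j) (deriv_trigBasis_sq_le j x) (sq_nonneg _) (h.nonneg j)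
        _ ≤ lam j * (2 * Real.pi ^ 2 * H ^ 2) := by
            have := h.nonneg j
            gcongr
        _ = _ := by ring
    · rw [h.zero j hj]; simp
  refine (Finset.sum_le_sum hpt).trans ?_
  rw [← Finset.mul_sum]
  calc _ ≤ 2 * Real.pi ^ 2 * H ^ 2 * H := by
        gcongr; exact h.sum_le hH n
    _ = _ := by ring

/-- The `L²[0,1]` loss of a weighted least squares estimator. -/
lemma normSq_wlsEstimator_sub_le {n : ℕ} (hn : 0 < n) {lam : ℕ → ℝ} {H : ℝ} (h : IsWeight H lam)
    (hH : 0 ≤ H) (y : Fin n → ℝ) {k : ℕ} (hk : 1 ≤ k) {r : ℝ} {S : ℝ → ℝ}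
    (hS : S ∈ sobolevClass k r) {δ : ℝ} (hδ : 0 < δ) :
    normSq (fun x => wlsEstimator n lam y x - S x)
      ≤ (1 + δ) * empNormSq n (fun x => wlsEstimator n lam y x - S x)
        + (1 + 1 / δ) * ((1 / n) ^ 2 *
          (4 * Real.pi ^ 2 * H ^ 3 * ∑ j ∈ Finset.Icc 1 n, thetaHat n y j ^ 2 + 2 * r)) := by
  obtain ⟨k, rfl⟩ : ∃ m, k = m + 1 := ⟨k - 1, by omega⟩
  have hreg := sobolevClass_reg hS
  have hSd := hreg.differentiable
  have hS2 : ∀ a b, IntervalIntegrable (fun t => deriv S t ^ 2) volume a b :=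
    fun a b => hreg.perSqInt_deriv.intervalIntegrable a b
  have hS1 := sobolevClass_integral_le hS (j := 1) (by omega)
  rw [iteratedDeriv_one] at hS1
  have hE := contDiff_wlsEstimator n lam y
  have hEd : Differentiable ℝ (wlsEstimator n lam y) := hE.differentiable (by norm_num)
  set B := 2 * Real.pi ^ 2 * H ^ 3 * ∑ j ∈ Finset.Icc 1 n, thetaHat n y j ^ 2 with hB
  have hB0 : 0 ≤ B := by
    have : 0 ≤ ∑ j ∈ Finset.Icc 1 n, thetaHat n y j ^ 2 := Finset.sum_nonneg fun _ _ => sq_nonneg _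
    positivity
  set f : ℝ → ℝ := fun x => wlsEstimator n lam y x - S x with hf
  have hfd : Differentiable ℝ f := hEd.sub hSd
  have hdf : ∀ t, deriv f t ^ 2 ≤ 2 * B + 2 * deriv S t ^ 2 := fun t => by
    have e : deriv f t = deriv (wlsEstimator n lam y) t - deriv S t :=
      deriv_fun_sub (hEd t) (hSd t)
    have := deriv_wlsEstimator_sq_le h hH y t
    rw [e]
    nlinarith only [this, sq_nonneg (deriv (wlsEstimator n lam y) t + deriv S t)]
  have hdom : ∀ a b, IntervalIntegrable (fun t => 2 * B + 2 * deriv S t ^ 2) volume a b :=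
    fun a b => intervalIntegrable_const.add ((hS2 a b).const_mul 2)
  have hint : ∀ a b, IntervalIntegrable (fun t => deriv f t ^ 2) volume a b := fun a b => by
    refine (hdom a b).mono_fun ((measurable_deriv f).pow_const 2).aestronglyMeasurable
      (Eventually.of_forall fun t => ?_)
    simp only [Real.norm_eq_abs]
    rw [abs_of_nonneg (sq_nonneg _), abs_of_nonneg (by positivity)]
    exact hdf t
  refine (normSq_le_empNormSq hn hfd hint hδ).trans ?_
  have h3 : ∫ t in (0 : ℝ)..1, deriv f t ^ 2 ≤ 2 * B + 2 * r := by
    refine (intervalIntegral.integral_mono_on zero_le_one (hint 0 1) (hdom 0 1)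
      fun t _ => hdf t).trans ?_
    have e1 : ∫ t in (0 : ℝ)..1, 2 * deriv S t ^ 2 = 2 * ∫ t in (0 : ℝ)..1, deriv S t ^ 2 :=
      intervalIntegral.integral_const_mul _ _
    rw [intervalIntegral.integral_add intervalIntegrable_const ((hS2 0 1).const_mul 2), e1,
      intervalIntegral.integral_const]
    simp only [smul_eq_mul]
    linarith
  have e : 4 * Real.pi ^ 2 * H ^ 3 * ∑ j ∈ Finset.Icc 1 n, thetaHat n y j ^ 2 = 2 * B := by
    rw [hB]; ring
  rw [e]
  gcongr

/-! ### From mean losses to normalised risks -/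

lemma pinskerConst_pos {k : ℕ} (hk : 1 ≤ k) : 0 < pinskerConst k := by
  have : (0 : ℝ) < k := by exact_mod_cast hk
  have := Real.pi_pos
  unfold pinskerConst; positivity

lemma gammaK_pos {k : ℕ} (hk : 1 ≤ k) {r : ℝ} (hr : 0 < r) {g : ℝ → (ℝ → ℝ) → ℝ} {S : ℝ → ℝ}
    (hς : 0 < intVar g S) : 0 < gammaK k r g S := by
  have := pinskerConst_pos hk
  unfold gammaK; positivity

/-- It suffices to dominate the loss by variables with small mean: monotonicity of the lower
Lebesgue integral gives the bound for every noise law, and γ_k(S) > 0 permits the division. -/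
lemma limsup_normalisedRisk_le_one {k : ℕ} (hk : 1 ≤ k) {r : ℝ} (hr : 0 < r)
    {g : ℝ → (ℝ → ℝ) → ℝ} (hg : ScaleCondition k r g) (c : ℕ → ℝ)
    (loss : ℕ → (ℝ → ℝ) → ℝ) (hloss : ∀ n f, 0 ≤ loss n f) (est : ∀ n, (Fin n → ℝ) → ℝ → ℝ)
    (h : ∀ η > 0, ∀ᶠ n : ℕ in oddAtTop, ∀ S ∈ sobolevClass k r, ∀ p : Measure (Fin n → ℝ),
      IsNoiseLaw n (c n) p → ∃ (F : (Fin n → ℝ) → ℝ) (f : ℝ),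
        (∀ ξ, loss n (fun x => est n (observation n g S ξ) x - S x) ≤ F ξ) ∧ HasMean p F f ∧
          (n : ℝ) ^ (2 * (k : ℝ) / (2 * k + 1)) * f ≤ (1 + η) * gammaK k r g S) :
    limsup (normalisedRisk k r g fun n S => robustRisk n (c n) g (loss n) (est n) S) oddAtTop
      ≤ 1 := by
  obtain ⟨c₀, C₀, hc₀, hcC, -, hvb⟩ := hg.exists_bounds
  refine ENNReal.le_of_forall_pos_le_add fun ε hε _ => ?_
  refine limsup_le_of_le (by isBoundedDefault) ?_
  filter_upwards [h ε (by exact_mod_cast hε), eventually_three_le] with n hn hn3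
  have hn' : (0 : ℝ) < n := by exact_mod_cast (by omega : 0 < n)
  have hN : 0 < (n : ℝ) ^ (2 * (k : ℝ) / (2 * k + 1)) := Real.rpow_pos_of_pos hn' _
  unfold normalisedRisk
  rw [ENNReal.mul_iSup]
  refine iSup_le fun S => ?_
  rw [ENNReal.mul_iSup]
  refine iSup_le fun hS => ?_
  have hγ := gammaK_pos hk hr (hc₀.trans_le (hvb S hS).1)
  have hR : robustRisk n (c n) g (loss n) (est n) S
      ≤ ENNReal.ofReal ((1 + ε) * gammaK k r g S / (n : ℝ) ^ (2 * (k : ℝ) / (2 * k + 1))) := by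
    refine iSup_le fun p => iSup_le fun hp => ?_
    obtain ⟨F, f, hF, hm, hf⟩ := hn S hS p hp
    calc _ ≤ ∫⁻ ξ, ENNReal.ofReal (F ξ) ∂p :=
          lintegral_mono fun ξ => ENNReal.ofReal_le_ofReal (hF ξ)
      _ = ENNReal.ofReal f := by
          rw [← hm.eq, ofReal_integral_eq_lintegral_ofReal hm.int
            (Eventually.of_forall fun ξ => (hloss n _).trans (hF ξ))]
      _ ≤ _ := by
          refine ENNReal.ofReal_le_ofReal ?_
          rw [le_div_iff₀ hN, mul_comm]
          exact hf
  calc _ ≤ ENNReal.ofReal ((n : ℝ) ^ (2 * (k : ℝ) / (2 * k + 1))) *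
        (ENNReal.ofReal ((1 + ε) * gammaK k r g S / (n : ℝ) ^ (2 * (k : ℝ) / (2 * k + 1)))
          / ENNReal.ofReal (gammaK k r g S)) := by gcongr
    _ = ENNReal.ofReal (1 + ε) := by
        rw [← ENNReal.ofReal_div_of_pos hγ, ← ENNReal.ofReal_mul hN.le]
        congr 1
        field_simp
    _ = 1 + ε := by
        rw [ENNReal.ofReal_add zero_le_one ε.coe_nonneg, ENNReal.ofReal_one, ENNReal.ofReal_coe_nnreal]

/-! ### The three risks of the selected estimator -/

lemma eight_mul_oracleSlack_le {P : Tuning} {n : ℕ} {v₀ V : ℝ} (hρ : 0 ≤ penCoef P n)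
    (hv₀ : 0 < v₀) (hvV : v₀ ≤ V) : 8 * oracleSlack P n v₀ V ≤ penCoef P n := by
  have hV : 0 < V := hv₀.trans_le hvV
  unfold oracleSlack
  rw [← mul_div_assoc, div_le_iff₀ (by positivity)]
  nlinarith

lemma sum_thetaHat_tail_varCut_le {n k : ℕ} (hn : Odd n) (hk : 1 ≤ k) {r : ℝ} (hr : 0 < r) {S : ℝ → ℝ}
    (hS : S ∈ sobolevClass k r) :
    ∑ j ∈ Finset.Icc 1 n, (1 - if j ≤ varCut n then (1 : ℝ) else 0)
      * thetaHat n (fun i => S (designPoint n i)) j ^ 2 ≤ r * (n : ℝ) ^ (-(2 / 3) : ℝ) := by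
  have hn' : (0 : ℝ) < n := by exact_mod_cast hn.pos
  have h1 : 1 ≤ varCut n := by
    rw [varCut, Nat.one_le_floor_iff]
    have : 0 ≤ (n : ℝ) ^ (1 / 3 : ℝ) := by positivity
    linarith
  refine (sum_thetaHat_tail_le hn hk hS h1).trans ?_
  have h2 : (n : ℝ) ^ (1 / 3 : ℝ) ≤ varCut n := by
    have := Nat.lt_floor_add_one ((n : ℝ) ^ (1 / 3 : ℝ) + 1)
    unfold varCut
    linarith
  have h3 : (n : ℝ) ^ (-(2 / 3) : ℝ) = 1 / ((n : ℝ) ^ (1 / 3 : ℝ)) ^ 2 := by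
    rw [← Real.rpow_natCast, ← Real.rpow_mul hn'.le, Real.rpow_neg hn'.le, one_div]
    norm_num
  have h4 : 0 < (n : ℝ) ^ (1 / 3 : ℝ) := Real.rpow_pos_of_pos hn' _
  rw [h3, mul_one_div]
  gcongr

section Risks

variable {P : Tuning} {lstar : ℕ → ℝ} {sel : ∀ n : ℕ, (Fin n → ℝ) → ℕ × ℕ} {k : ℕ} {r : ℝ}
  {g : ℝ → (ℝ → ℝ) → ℝ}

lemma sum_thetaHat_sq_le_of_mem {n : ℕ} (hn : Odd n) (hk : 1 ≤ k) {S : ℝ → ℝ}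
    (hS : S ∈ sobolevClass k r) :
    ∑ j ∈ Finset.Icc 1 n, thetaHat n (fun i => S (designPoint n i)) j ^ 2 ≤ 4 * r := by
  rw [sum_thetaHat_sq hn, ← empNormSq_eq]
  exact empNormSq_le_of_mem_sobolevClass hn.pos hk hS

/-- `oracle_risk` is applied with the index from `eventually_oracle_sharp`, which depends on S.
Penalty coefficient and slack tend to zero because L_n → ∞, and the remainder is of smaller order
than the rate. -/
lemma eventually_empNormSq_mean_le (hP : P.Admissible) (hl : IsSlowlyIncreasing lstar)
    (hl3 : ∀ n, 3 ≤ n → Odd n → 3 ≤ lstar n)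
    (hsel : ∀ n, 3 ≤ n → Odd n → IsCostMinimiser P n (sel n)) (hk : 1 ≤ k) (hr : 0 < r)
    (hg : ScaleCondition k r g) {η : ℝ} (hη : 0 < η) :
    ∀ᶠ n : ℕ in oddAtTop, ∀ S ∈ sobolevClass k r, ∀ p : Measure (Fin n → ℝ),
      IsNoiseLaw n (lstar n) p → ∃ (F : (Fin n → ℝ) → ℝ) (f : ℝ),
        (∀ ξ, empNormSq n (fun x =>
          selectedEstimator P n (sel n) (observation n g S ξ) x - S x) ≤ F ξ) ∧ HasMean p F f ∧
          (n : ℝ) ^ (2 * (k : ℝ) / (2 * k + 1)) * f ≤ (1 + η) * gammaK k r g S := by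
  obtain ⟨c₀, C₀, hc₀, hcC, hgb, hvb⟩ := hg.exists_bounds
  have hk0 : (0 : ℝ) < k := by exact_mod_cast hk
  have hΓ := pinskerConst_pos hk
  -- A lower bound for γ_k(S) uniform in S, which turns an absolute bound on the remainder into a
  -- relative one.
  set γ₀ := pinskerConst k * r ^ (1 / (2 * (k : ℝ) + 1)) * c₀ ^ (2 * (k : ℝ) / (2 * k + 1)) with hγ₀
  have hγ₀0 : 0 < γ₀ := by positivity
  obtain ⟨x, hx, hx1, hxη⟩ : ∃ x : ℝ, 0 < x ∧ x ≤ 1 / 20 ∧ x ≤ η / 20 :=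
    ⟨min (1 / 20) (η / 20), by positivity, min_le_left _ _, min_le_right _ _⟩
  have E1 := eventually_oracle_sharp hP hk hr hg hx
  have E2 := eventually_div_le_of_isSubpoly (isSubpoly_remBound hP hl c₀ C₀ (4 * r) r)
    (ν := 1 / (2 * (k : ℝ) + 1)) (by positivity) (η := x * γ₀) (by positivity)
  have E3 := hP.L_slow.1.eventually_ge_atTop (1 / x)
  filter_upwards [E1, E2, E3, eventually_odd, eventually_three_le] with n E1 E2 E3 hn hn3 S hS p hp
  have hn' : (0 : ℝ) < n := by exact_mod_cast hn.pos
  obtain ⟨α, hα, E1⟩ := E1 S hS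
  have hexp : 1 - 1 / (2 * (k : ℝ) + 1) = 2 * (k : ℝ) / (2 * k + 1) := by field_simp; ring
  rw [hexp] at E2
  have hl3' := hl3 n hn3 hn
  have hL := hP.L_nonneg n hn3 hn
  obtain ⟨F, hF, f, hf, hm⟩ := oracle_risk (c := lstar n) (s := fun l => S (designPoint n l))
    (σ := fun l => g (designPoint n l) S) (Θ := 4 * r) (τ := r * (n : ℝ) ^ (-(2 / 3) : ℝ))
    (a := (n : ℝ) ^ (-(1 / 3) : ℝ)) hP hn3 hn (hsel n hn3 hn) (by linarith) hp hc₀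
    (fun l => (hgb _ (designPoint_mem_Icc l) S hS).1)
    (fun l => (hgb _ (designPoint_mem_Icc l) S hS).2) (by positivity)
    (sum_thetaHat_sq_le_of_mem hn hk hS) (sum_thetaHat_tail_varCut_le hn hk hr hS) hα
  refine ⟨F, f, fun ξ => ?_, hm, ?_⟩
  · refine le_of_eq_of_le ?_ (hF ξ)
    unfold selectedEstimator observation
    rw [empNormSq_wlsEstimator_sub hn]
    unfold coordLoss
    refine Finset.sum_congr rfl fun j _ => ?_
    rw [thetaHat_add]
    rfl
  · set m := ∑ j ∈ Finset.Icc 1 n, ((1 - weight P n α j)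
            * thetaHat n (fun l => S (designPoint n l)) j) ^ 2
          + meanVar n (fun l => g (designPoint n l) S)
            * ∑ j ∈ Finset.Icc 1 n, weight P n α j ^ 2 with hmdef
    have hm0 : 0 ≤ m := add_nonneg (Finset.sum_nonneg fun _ _ => sq_nonneg _)
      (mul_nonneg meanVar_nonneg (Finset.sum_nonneg fun _ _ => sq_nonneg _))
    have hrem := oracleRem_le (c := lstar n) (v₀ := c₀) (V := C₀) (Θ := 4 * r) (τ := r) hP hn3 hn
      (by linarith) hc₀ hcC (by positivity) hr.le
    have hρ0 : 0 < penCoef P n := by unfold penCoef; positivity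
    have hρx : penCoef P n ≤ x := by
      unfold penCoef
      rw [div_le_iff₀ (by positivity)]
      rw [div_le_iff₀ hx] at E3
      nlinarith
    have hδ := eight_mul_oracleSlack_le hρ0.le hc₀ hcC
    set δ := oracleSlack P n c₀ C₀ with hδdef
    have hδx : 4 * δ ≤ x := by linarith
    set N := (n : ℝ) ^ (2 * (k : ℝ) / (2 * k + 1)) with hN
    have hN0 : 0 < N := Real.rpow_pos_of_pos hn' _
    set γ := gammaK k r g S with hγ
    have hγ0 : γ₀ ≤ γ := by
      have := (hvb S hS).1
      rw [hγ₀, hγ, gammaK]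
      gcongr
    have hγpos : 0 < γ := hγ₀0.trans_le hγ0
    set R := oracleRem P n (lstar n) c₀ C₀ (4 * r) (r * (n : ℝ) ^ (-(2 / 3) : ℝ))
      ((n : ℝ) ^ (-(1 / 3) : ℝ)) with hR
    have hNR : N * R ≤ x * γ := by
      calc N * R ≤ N * (remBound P n (lstar n) c₀ C₀ (4 * r) r / n) := by gcongr
        _ ≤ x * γ₀ := E2
        _ ≤ _ := by gcongr
    have h4δ : 0 < 1 - 4 * δ := by linarith
    have hδ0 : 0 ≤ δ := by
      have : 0 < C₀ := hc₀.trans_le hcC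
      rw [hδdef, oracleSlack]; positivity
    have key : N * ((1 + 4 * δ + 2 * penCoef P n) * m + R) ≤ (1 + 5 * x + 3 * x ^ 2) * γ := by
      calc _ = (1 + 4 * δ + 2 * penCoef P n) * (N * m) + N * R := by ring
        _ ≤ (1 + x + 2 * x) * ((1 + x) * γ) + x * γ := by gcongr
        _ = _ := by ring
    calc N * f ≤ N * ((1 - 4 * δ)⁻¹ * ((1 + 4 * δ + 2 * penCoef P n) * m + R)) := by gcongr
      _ = (1 - 4 * δ)⁻¹ * (N * ((1 + 4 * δ + 2 * penCoef P n) * m + R)) := by ring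
      _ ≤ (1 - 4 * δ)⁻¹ * ((1 + 5 * x + 3 * x ^ 2) * γ) := by gcongr
      _ ≤ (1 + η) * γ := by
          rw [inv_mul_le_iff₀ h4δ, ← mul_assoc]
          refine mul_le_mul_of_nonneg_right ?_ hγpos.le
          nlinarith

/-- A bound for `n` times the additional error of the integrated loss. -/
noncomputable def derivBound (P : Tuning) (n : ℕ) (r V : ℝ) : ℝ :=
  4 * Real.pi ^ 2 * (P.omegaBar + 1 / P.eps n) ^ 3 * (8 * r + 4 * V) + 2 * r

lemma isSubpoly_derivBound (hP : P.Admissible) (r V : ℝ) :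
    IsSubpoly (fun n => derivBound P n r V) := by
  have C := IsSubpoly.const
  unfold derivBound
  exact (((C _).mul (((C _).add hP.subpoly_inv_eps).pow 3)).mul (C _)).add (C _)

/-- A loss that exceeds the empirical one by a factor close to one and a small random term has
the same asymptotic bound. -/
lemma eventually_mean_le_of_empNormSq (hP : P.Admissible) (hl : IsSlowlyIncreasing lstar)
    (hl3 : ∀ n, 3 ≤ n → Odd n → 3 ≤ lstar n)
    (hsel : ∀ n, 3 ≤ n → Odd n → IsCostMinimiser P n (sel n)) (hk : 1 ≤ k) (hr : 0 < r)
    (hg : ScaleCondition k r g) (loss : ∀ n, (ℝ → ℝ) → (Fin n → ℝ) → ℝ)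
    (hloss : ∀ δ > 0, ∀ n, 3 ≤ n → Odd n → ∀ S ∈ sobolevClass k r, ∀ ξ,
      loss n S ξ ≤ (1 + δ) * empNormSq n (fun x =>
          selectedEstimator P n (sel n) (observation n g S ξ) x - S x)
        + (1 + 1 / δ) * ((1 / n) ^ 2 * (4 * Real.pi ^ 2 * maxFreq P n ^ 3
          * ∑ j ∈ Finset.Icc 1 n, thetaHat n (observation n g S ξ) j ^ 2 + 2 * r)))
    {η : ℝ} (hη : 0 < η) :
    ∀ᶠ n : ℕ in oddAtTop, ∀ S ∈ sobolevClass k r, ∀ p : Measure (Fin n → ℝ),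
      IsNoiseLaw n (lstar n) p → ∃ (F : (Fin n → ℝ) → ℝ) (f : ℝ),
        (∀ ξ, loss n S ξ ≤ F ξ) ∧ HasMean p F f ∧
          (n : ℝ) ^ (2 * (k : ℝ) / (2 * k + 1)) * f ≤ (1 + η) * gammaK k r g S := by
  obtain ⟨c₀, C₀, hc₀, hcC, hgb, hvb⟩ := hg.exists_bounds
  have hC₀ : 0 < C₀ := hc₀.trans_le hcC
  have hk0 : (0 : ℝ) < k := by exact_mod_cast hk
  have hΓ := pinskerConst_pos hk
  set γ₀ := pinskerConst k * r ^ (1 / (2 * (k : ℝ) + 1)) * c₀ ^ (2 * (k : ℝ) / (2 * k + 1)) with hγ₀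
  have hγ₀0 : 0 < γ₀ := by positivity
  obtain ⟨x, hx, hx1, hxη⟩ : ∃ x : ℝ, 0 < x ∧ x ≤ 1 ∧ x ≤ η / 4 :=
    ⟨min 1 (η / 4), by positivity, min_le_left _ _, min_le_right _ _⟩
  have E1 := eventually_empNormSq_mean_le hP hl hl3 hsel hk hr hg hx
  have E2 := eventually_div_le_of_isSubpoly (isSubpoly_derivBound hP r C₀)
    (ν := 1 / (2 * (k : ℝ) + 1)) (by positivity) (η := x * γ₀ / (1 + 1 / x)) (by positivity)
  filter_upwards [E1, E2, eventually_odd, eventually_three_le] with n E1 E2 hn hn3 S hS p hp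
  have := hp.isProb
  have hn0 := hn.pos
  have hn' : (0 : ℝ) < n := by exact_mod_cast hn0
  obtain ⟨F, f, hF, hm, hf⟩ := E1 S hS p hp
  have hexp : 1 - 1 / (2 * (k : ℝ) + 1) = 2 * (k : ℝ) / (2 * k + 1) := by field_simp; ring
  rw [hexp] at E2
  set σ : Fin n → ℝ := fun l => g (designPoint n l) S with hσ
  set θ := thetaHat n (fun l => S (designPoint n l)) with hθ
  have hε := hP.eps_pos n hn3 hn
  have hH0 : 0 ≤ maxFreq P n := by
    have := hP.omegaBar_nonneg
    unfold maxFreq; positivity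
  have hη2 := HasMean.sum (Finset.Icc 1 n) fun j _ => hp.hasMean_noiseCoef_sq (σ := σ) j
  have hmean := (hm.const_mul (1 + x)).add (((((HasMean.const (p := p)
    (2 * ∑ j ∈ Finset.Icc 1 n, θ j ^ 2)).add (hη2.const_mul 2)).const_mul
    (4 * Real.pi ^ 2 * maxFreq P n ^ 3)).add (HasMean.const (2 * r))).const_mul
    ((1 + 1 / x) * (1 / n : ℝ) ^ 2))
  refine ⟨_, _, fun ξ => ?_, hmean, ?_⟩
  · refine (hloss x hx n hn3 hn S hS ξ).trans ?_
    have h1 : ∑ j ∈ Finset.Icc 1 n, thetaHat n (observation n g S ξ) j ^ 2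
        ≤ 2 * ∑ j ∈ Finset.Icc 1 n, θ j ^ 2 + 2 * ∑ j ∈ Finset.Icc 1 n, noiseCoef n σ ξ j ^ 2 := by
      rw [Finset.mul_sum, Finset.mul_sum, ← Finset.sum_add_distrib]
      refine Finset.sum_le_sum fun j _ => ?_
      have e : thetaHat n (observation n g S ξ) j = θ j + noiseCoef n σ ξ j := by
        unfold observation
        rw [thetaHat_add]; rfl
      rw [e]
      nlinarith only [sq_nonneg (θ j - noiseCoef n σ ξ j)]
    rw [← mul_assoc (1 + 1 / x)]
    gcongr
    exact hF ξ
  · set N := (n : ℝ) ^ (2 * (k : ℝ) / (2 * k + 1)) with hN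
    have hN0 : 0 < N := Real.rpow_pos_of_pos hn' _
    set γ := gammaK k r g S with hγ
    have hγ0 : γ₀ ≤ γ := by
      have := (hvb S hS).1
      rw [hγ₀, hγ, gammaK]
      gcongr
    have hγpos : 0 < γ := hγ₀0.trans_le hγ0
    have h1 : ∑ j ∈ Finset.Icc 1 n, θ j ^ 2 ≤ 4 * r := sum_thetaHat_sq_le_of_mem hn hk hS
    have h2 : ∑ j ∈ Finset.Icc 1 n, noiseVar n σ j ≤ 2 * C₀ := by
      refine (Finset.sum_le_sum fun j _ => noiseVar_le hn0
        (fun l => (hgb _ (designPoint_mem_Icc l) S hS).2) j).trans ?_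
      rw [Finset.sum_const, Nat.card_Icc, nsmul_eq_mul, Nat.add_sub_cancel]
      refine le_of_eq ?_
      field_simp
    -- The cube of the bandwidth is n times a subpolynomial factor, so it cancels only one of the
    -- two factors 1/n and the extra term is still negligible.
    have h3 : maxFreq P n ^ 3 ≤ n * (P.omegaBar + 1 / P.eps n) ^ 3 := by
      have := pow_le_pow_left₀ hH0 (maxFreq_le hn0 hε (hP.eps_le_one n hn3 hn)
        hP.omegaBar_nonneg) 3
      rw [mul_pow, ← Real.rpow_natCast ((n : ℝ) ^ (1 / 3 : ℝ)) 3, ← Real.rpow_mul hn'.le] at this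
      norm_num at this ⊢
      exact this
    have hω := hP.omegaBar_nonneg
    have hn1 : (1 : ℝ) ≤ n := by exact_mod_cast hn0
    have h4 : (1 / n : ℝ) ^ 2 * (4 * Real.pi ^ 2 * maxFreq P n ^ 3
        * (2 * ∑ j ∈ Finset.Icc 1 n, θ j ^ 2 + 2 * ∑ j ∈ Finset.Icc 1 n, noiseVar n σ j) + 2 * r)
        ≤ derivBound P n r C₀ / n := by
      calc _ ≤ (1 / n : ℝ) ^ 2 * (4 * Real.pi ^ 2 * (n * (P.omegaBar + 1 / P.eps n) ^ 3)
            * (2 * (4 * r) + 2 * (2 * C₀)) + n * (2 * r)) := by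
            have h0 : 0 ≤ 2 * ∑ j ∈ Finset.Icc 1 n, θ j ^ 2
                + 2 * ∑ j ∈ Finset.Icc 1 n, noiseVar n σ j :=
              add_nonneg (mul_nonneg zero_le_two (Finset.sum_nonneg fun _ _ => sq_nonneg _))
                (mul_nonneg zero_le_two (Finset.sum_nonneg fun _ _ => noiseVar_nonneg _))
            refine mul_le_mul_of_nonneg_left (add_le_add (mul_le_mul
              ?_ (by linarith) h0 (by positivity))
              (le_mul_of_one_le_left (by positivity) hn1)) (by positivity)
            exact mul_le_mul_of_nonneg_left h3 (by positivity)
        _ = _ := by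
            unfold derivBound
            field_simp
            ring
    calc _ = (1 + x) * (N * f) + (1 + 1 / x) * (N * ((1 / n : ℝ) ^ 2 *
          (4 * Real.pi ^ 2 * maxFreq P n ^ 3 * (2 * ∑ j ∈ Finset.Icc 1 n, θ j ^ 2
            + 2 * ∑ j ∈ Finset.Icc 1 n, noiseVar n σ j) + 2 * r))) := by ring
      _ ≤ (1 + x) * ((1 + x) * γ) + (1 + 1 / x) * (x * γ₀ / (1 + 1 / x)) := by
          gcongr
          exact (mul_le_mul_of_nonneg_left h4 hN0.le).trans E2
      _ = (1 + x) * ((1 + x) * γ) + x * γ₀ := by field_simp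
      _ ≤ (1 + x) * ((1 + x) * γ) + x * γ := by gcongr
      _ = (1 + 3 * x + x * x) * γ := by ring
      _ ≤ (1 + η) * γ := by
          refine mul_le_mul_of_nonneg_right ?_ hγpos.le
          nlinarith

end Risks

end HeteroReg

theorem theorem4p2
    (P : HeteroReg.Tuning) (hP : P.Admissible)
    (lstar : ℕ → ℝ) (hlstar : HeteroReg.IsSlowlyIncreasing lstar)
    (hlstar3 : ∀ n, 3 ≤ n → Odd n → 3 ≤ lstar n)
    (sel : ∀ n : ℕ, (Fin n → ℝ) → ℕ × ℕ)
    (hsel : ∀ n, 3 ≤ n → Odd n → HeteroReg.IsCostMinimiser P n (sel n))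
    (k : ℕ) (hk : 1 ≤ k) (r : ℝ) (hr : 0 < r)
    (g : ℝ → (ℝ → ℝ) → ℝ) (hg : HeteroReg.ScaleCondition k r g) :
    limsup (HeteroReg.normalisedRisk k r g fun n S =>
        HeteroReg.empRisk n (lstar n) g (HeteroReg.selectedEstimator P n (sel n)) S)
      HeteroReg.oddAtTop ≤ 1 ∧
    limsup (HeteroReg.normalisedRisk k r g fun n S =>
        HeteroReg.intRisk n (lstar n) g (HeteroReg.selectedEstimator P n (sel n)) S)
      HeteroReg.oddAtTop ≤ 1 ∧
    limsup (HeteroReg.normalisedRisk k r g fun n S =>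
        HeteroReg.intRisk n (lstar n) g
          (fun y => HeteroReg.stepExtension n (HeteroReg.selectedEstimator P n (sel n) y)) S)
      HeteroReg.oddAtTop ≤ 1 := by
  have hemp : ∀ n f, 0 ≤ HeteroReg.empNormSq n f := fun n f => by
    rw [HeteroReg.empNormSq_eq]; positivity
  have hint : ∀ (_ : ℕ) f, 0 ≤ HeteroReg.normSq f := fun _ f =>
    intervalIntegral.integral_nonneg zero_le_one fun _ _ => sq_nonneg _
  have hH0 : ∀ n, 3 ≤ n → Odd n → 0 ≤ HeteroReg.maxFreq P n := fun n hn3 hn => by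
    have := hP.omegaBar_nonneg
    have := hP.eps_pos n hn3 hn
    unfold HeteroReg.maxFreq; positivity
  refine ⟨HeteroReg.limsup_normalisedRisk_le_one hk hr hg lstar
      (fun n => HeteroReg.empNormSq n) hemp _ fun η hη =>
      HeteroReg.eventually_empNormSq_mean_le hP hlstar hlstar3 hsel hk hr hg hη,
    HeteroReg.limsup_normalisedRisk_le_one hk hr hg lstar
      (fun _ => HeteroReg.normSq) hint _ fun η hη =>
      HeteroReg.eventually_mean_le_of_empNormSq hP hlstar hlstar3 hsel hk hr hg
        (fun n S ξ => HeteroReg.normSq (fun x => HeteroReg.selectedEstimator P n (sel n)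
          (HeteroReg.observation n g S ξ) x - S x)) (fun δ hδ n hn3 hn S hS ξ => ?_) hη,
    HeteroReg.limsup_normalisedRisk_le_one hk hr hg lstar
      (fun _ => HeteroReg.normSq) hint
      (fun n y => HeteroReg.stepExtension n (HeteroReg.selectedEstimator P n (sel n) y))
      fun η hη => HeteroReg.eventually_mean_le_of_empNormSq hP hlstar hlstar3 hsel hk hr hg
        (fun n S ξ => HeteroReg.normSq (fun x => HeteroReg.stepExtension n
          (HeteroReg.selectedEstimator P n (sel n) (HeteroReg.observation n g S ξ)) x - S x))
        (fun δ hδ n hn3 hn S hS ξ => ?_) hη⟩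
  · have hα := (hsel n hn3 hn).mem (HeteroReg.observation n g S ξ)
    have hε := hP.eps_pos n hn3 hn
    have hε1 := hP.eps_le_one n hn3 hn
    exact HeteroReg.normSq_wlsEstimator_sub_le hn.pos
      ((HeteroReg.isWeight_weight (HeteroReg.omega_pos hn.pos hε hP.omegaBar_nonneg hα.1
        hα.2.2.1) hε1).mono (HeteroReg.omega_le_maxFreq hn.pos hε hε1 hα))
      (hH0 n hn3 hn) _ hk hS hδ
  -- For the step function only the derivative of S enters. The contribution of the estimator's
  -- derivative in the common bound is nonnegative and is simply added.
  · have hreg := (HeteroReg.sobolevClass_reg hS).one hk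
    refine (HeteroReg.normSq_stepExtension_sub_le hn.pos _ hreg.differentiable
      (fun a b => hreg.perSqInt_deriv.intervalIntegrable a b) hδ).trans ?_
    have h1 := HeteroReg.sobolevClass_integral_le hS hk
    rw [iteratedDeriv_one] at h1
    have h2 : 0 ≤ 4 * Real.pi ^ 2 * HeteroReg.maxFreq P n ^ 3 * ∑ j ∈ Finset.Icc 1 n,
        HeteroReg.thetaHat n (HeteroReg.observation n g S ξ) j ^ 2 := by
      have := hH0 n hn3 hn
      have : 0 ≤ ∑ j ∈ Finset.Icc 1 n,
        HeteroReg.thetaHat n (HeteroReg.observation n g S ξ) j ^ 2 :=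
        Finset.sum_nonneg fun _ _ => sq_nonneg _
      positivity
    gcongr
    linarith
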